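/- Let $\mathfrak{n}$ be a finite-dimensional complex nilpotent Lie algebra, and let $U$ be a unipotent linear algebraic group over $\mathbb{C}$ (a Zariski closed subgroup of some $GL_N(\mathbb{C})$ all of whose elements are unipotent) with an identification of $\mathfrak{n}$ with $\operatorname{Lie}(U)$, the Lie algebra of left invariant derivations of $\mathbb{C}[U]$. Let $n\ge 0$ be an integer. An invariant D-module of rank $n$ over $U$ is a module $\mathbb{M}_\alpha$ over the algebra $D(U)$ of differential operators on $U$, where $\alpha$ is an $n\times n$ matrix of algebraic 1-forms on $U$ that is invariant under left translations and flat, $d\alpha+\alpha\wedge\alpha=0$; as a $\mathbb{C}[U]$-module $\mathbb{M}_\alpha=\mathbb{C}[U]^{\oplus n}$, and every algebraic vector field $v$ acts on the standard basis by $v(e_1,\dots,e_n)=(e_1,\dots,e_n)\,\alpha(v)$. Let $\sim$ denote isomorphism of $D(U)$-modules. Let $V=\operatorname{Hom}_{\text{Lie alg}}(\mathfrak{n},\mathfrak{gl}_n(\mathbb{C}))$, an affine variety on which $GL_n(\mathbb{C})$ acts by conjugation, and let $V/\!\!/GL_n(\mathbb{C})=\operatorname{Spec}\big(\mathbb{C}[V]^{GL_n(\mathbb{C})}\big)$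 be its categorical quotient, whose points are the maximal ideals of $\mathbb{C}[V]^{GL_n(\mathbb{C})}$; the quotient map $\pi$ sends $\rho\in V$ to the ideal of invariants vanishing at $\rho$. Then there is a bijection $\rho\mapsto\mathbb{M}_{\alpha_\rho}$ from $V$ onto the set of invariant D-modules of rank $n$ over $U$, where $\alpha_\rho$ is the form with $\alpha_\rho(x)=\rho(x)$ (a constant matrix) for all $x\in\mathfrak{n}=\operatorname{Lie}(U)$. The map $\pi:V\to V/\!\!/GL_n(\mathbb{C})$ is surjective, and $\pi(\rho)\mapsto[\mathbb{M}_{\alpha_\rho}]$ is a well-defined bijection $$V/\!\!/GL_n(\mathbb{C})\;\longrightarrow\;\{\text{invariant D-modules of rank } n \text{ over } U\}/\sim .$$ The fibers of $\pi$ correspond under $\rho\mapsto\mathbb{M}_{\alpha_\rho}$ exactly to the isomorphism classes of invariant D-modules of rank $n$ over $U$: for $\rho_1,\rho_2\in V$, $$\mathbb{M}_{\alpha_{\rho_1}}\cong\mathbb{M}_{\alpha_{\rho_2}}\ \text{ as } D(U)\text{-modules}\iff \pi(\rho_1)=\pi(\rho_2)\iff \rho_{1,s}\text{ and }\rho_{2,s}\text{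 are conjugate},$$ where $\rho_s(x)=\rho(x)_s$ is the semisimple part in the Jordan decomposition of the matrix $\rho(x)$, and conjugate means that there is $g\in GL_n(\mathbb{C})$ with $\rho_{1,s}(x)=g\,\rho_{2,s}(x)\,g^{-1}$ for all $x\in\mathfrak{n}$. -/

import Mathlib

open scoped Matrix KaehlerDifferential

attribute [local instance 100] LieRing.ofAssociativeRing

noncomputable section

namespace InvDMod

/-! ## Linear algebraic groups over the complex numbers -/

section Groups

variable {N : ℕ}

/-- `G` is Zariski closed in `GL_N(ℂ)`, i.e. `G` is a linear algebraic group. -/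
def IsZariskiClosed (G : Subgroup (GL (Fin N) ℂ)) : Prop :=
  ∃ S : Set (MvPolynomial (Fin N × Fin N) ℂ), ∀ g : GL (Fin N) ℂ,
    g ∈ G ↔ ∀ p ∈ S, MvPolynomial.eval (fun ij : Fin N × Fin N => g.val ij.1 ij.2) p = 0

/-- Every element of `G` is a unipotent matrix. -/
def IsUnipotentGroup (G : Subgroup (GL (Fin N) ℂ)) : Prop :=
  ∀ g ∈ G, IsNilpotent (g.val - 1)

/-- The algebra `ℂ[G]` of regular functions on `G`: generated, among all functions `G → ℂ`, by the
matrix entries of `g` and of `g⁻¹`. -/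
def coordRing (G : Subgroup (GL (Fin N) ℂ)) : Subalgebra ℂ (G → ℂ) :=
  Algebra.adjoin ℂ
    ({f | ∃ i j, f = fun g : G => g.val.val i j} ∪
      {f | ∃ i j, f = fun g : G => (g⁻¹).val.val i j})

/-- Left translation of arbitrary functions on `G`: `(L_g f)(x) = f (g x)`. -/
def translateFun (G : Subgroup (GL (Fin N) ℂ)) (g : G) : (G → ℂ) →ₐ[ℂ] (G → ℂ) where
  toFun f := fun x => f (g * x)
  map_one' := rfl
  map_mul' _ _ := rfl
  map_zero' := rfl
  map_add' _ _ := rfl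
  commutes' _ := rfl

theorem translateFun_mem (G : Subgroup (GL (Fin N) ℂ)) (g : G) (f : G → ℂ)
    (hf : f ∈ coordRing G) : translateFun G g f ∈ coordRing G := by
  have h : coordRing G ≤ (coordRing G).comap (translateFun G g) := by
    refine Algebra.adjoin_le ?_
    rintro f (⟨i, j, rfl⟩ | ⟨i, j, rfl⟩)
    · have e : translateFun G g (fun x : G => x.val.val i j)
          = ∑ k, (g.val.val i k) • (fun x : G => x.val.val k j) := by
        funext x
        simp only [Finset.sum_apply, Pi.smul_apply, smul_eq_mul]
        exact Matrix.mul_apply (M := g.val.val) (N := x.val.val)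
      change translateFun G g _ ∈ coordRing G
      rw [e]
      refine Subalgebra.sum_mem _ fun k _ => Subalgebra.smul_mem _ ?_ _
      exact Algebra.subset_adjoin (Or.inl ⟨k, j, rfl⟩)
    · have e : translateFun G g (fun x : G => (x⁻¹).val.val i j)
          = ∑ k, ((g⁻¹).val.val k j) • (fun x : G => (x⁻¹).val.val i k) := by
        funext x
        simp only [Finset.sum_apply, Pi.smul_apply, smul_eq_mul]
        change ((g * x)⁻¹).val.val i j = _
        rw [mul_inv_rev]
        refine (Matrix.mul_apply (M := (x⁻¹).val.val) (N := (g⁻¹).val.val)).trans ?_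
        exact Finset.sum_congr rfl fun k _ => mul_comm _ _
      change translateFun G g _ ∈ coordRing G
      rw [e]
      refine Subalgebra.sum_mem _ fun k _ => Subalgebra.smul_mem _ ?_ _
      exact Algebra.subset_adjoin (Or.inr ⟨i, k, rfl⟩)
  exact h hf

/-- Left translation `L_g : ℂ[G] → ℂ[G]`, `(L_g f)(x) = f (g x)`. -/
def translate (G : Subgroup (GL (Fin N) ℂ)) (g : G) : coordRing G →ₐ[ℂ] coordRing G :=
  ((translateFun G g).comp (coordRing G).val).codRestrict (coordRing G)
    fun f => translateFun_mem G g f.1 f.2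

/-- The Lie algebra of `G`: the left invariant derivations of `ℂ[G]`, with the commutator. -/
def lieAlg (G : Subgroup (GL (Fin N) ℂ)) :
    LieSubalgebra ℂ (Derivation ℂ (coordRing G) (coordRing G)) where
  carrier := {v | ∀ (g : G) (f : coordRing G), v (translate G g f) = translate G g (v f)}
  add_mem' := by
    intro u v hu hv g f
    simp [hu g f, hv g f]
  zero_mem' := by
    intro g f
    simp
  smul_mem' := by
    intro c v hv g f
    simp [hv g f]
  lie_mem' := by
    intro u v hu hv g f
    simp only [Derivation.commutator_apply, map_sub]
    rw [hv g f, hu g f, hu g (v f), hv g (u f)]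

end Groups

/-! ## Differential operators -/

section DiffOps

variable {A : Type*} [CommRing A] [Algebra ℂ A]

/-- Multiplication by `a`, as a `ℂ`-linear endomorphism of `A`. -/
def mulOp (a : A) : Module.End ℂ A := LinearMap.mulLeft ℂ a

/-- `P` is a differential operator of order at most `k` on `A`. -/
def IsDiffOp : ℕ → Module.End ℂ A → Prop
  | 0, P => ∀ a : A, P * mulOp a - mulOp a * P = 0
  | k + 1, P => ∀ a : A, IsDiffOp k (P * mulOp a - mulOp a * P)

theorem isDiffOp_zero (k : ℕ) : IsDiffOp k (0 : Module.End ℂ A) := by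
  induction k with
  | zero => intro a; simp
  | succ k ih => intro a; simpa using ih

theorem IsDiffOp.succ {k : ℕ} {P : Module.End ℂ A} (h : IsDiffOp k P) : IsDiffOp (k + 1) P := by
  induction k generalizing P with
  | zero => intro a; rw [h a]; exact isDiffOp_zero 0
  | succ k ih => intro a; exact ih (h a)

theorem IsDiffOp.mono {k l : ℕ} (hkl : k ≤ l) {P : Module.End ℂ A} (h : IsDiffOp k P) :
    IsDiffOp l P := by
  induction l, hkl using Nat.le_induction with
  | base => exact h
  | succ l _ ih => exact ih.succ

theorem IsDiffOp.add {k : ℕ} {P Q : Module.End ℂ A} (hP : IsDiffOp k P) (hQ : IsDiffOp k Q) :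
    IsDiffOp k (P + Q) := by
  induction k generalizing P Q with
  | zero =>
    intro a
    have e : (P + Q) * mulOp a - mulOp a * (P + Q)
      = (P * mulOp a - mulOp a * P) + (Q * mulOp a - mulOp a * Q) := by noncomm_ring
    rw [e, hP a, hQ a, add_zero]
  | succ k ih =>
    intro a
    have e : (P + Q) * mulOp a - mulOp a * (P + Q)
      = (P * mulOp a - mulOp a * P) + (Q * mulOp a - mulOp a * Q) := by noncomm_ring
    rw [e]
    exact ih (hP a) (hQ a)

theorem IsDiffOp.mul {k l : ℕ} {P Q : Module.End ℂ A} (hP : IsDiffOp k P) (hQ : IsDiffOp l Q) :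
    IsDiffOp (k + l) (P * Q) := by
  have e : ∀ (P Q : Module.End ℂ A) (a : A), P * Q * mulOp a - mulOp a * (P * Q)
      = P * (Q * mulOp a - mulOp a * Q) + (P * mulOp a - mulOp a * P) * Q := by
    intro P Q a
    simp only [mul_sub, sub_mul, mul_assoc]
    abel
  induction hm : k + l generalizing k l P Q with
  | zero =>
    obtain ⟨rfl, rfl⟩ : k = 0 ∧ l = 0 := by omega
    intro a
    rw [e, hQ a, hP a, mul_zero, zero_mul, add_zero]
  | succ m ih =>
    intro a
    rw [e]
    refine IsDiffOp.add ?_ ?_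
    · cases l with
      | zero => rw [hQ a, mul_zero]; exact isDiffOp_zero m
      | succ l => exact ih hP (hQ a) (by omega)
    · cases k with
      | zero => rw [hP a, zero_mul]; exact isDiffOp_zero m
      | succ k => exact ih (hP a) hQ (by omega)

theorem isDiffOp_mulOp (a : A) : IsDiffOp 0 (mulOp a) := by
  intro b
  ext x
  simp [mulOp, mul_left_comm]

variable (A) in
/-- The algebra `D(X)` of (Grothendieck) differential operators on an affine variety with
coordinate ring `A`. -/
def diffOps : Subalgebra ℂ (Module.End ℂ A) where
  carrier := {P | ∃ k, IsDiffOp k P}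
  mul_mem' := by
    rintro P Q ⟨k, hP⟩ ⟨l, hQ⟩
    exact ⟨k + l, hP.mul hQ⟩
  add_mem' := by
    rintro P Q ⟨k, hP⟩ ⟨l, hQ⟩
    exact ⟨max k l, (hP.mono (le_max_left _ _)).add (hQ.mono (le_max_right _ _))⟩
  algebraMap_mem' := by
    intro c
    refine ⟨0, fun a => ?_⟩
    ext x
    simp [mulOp, Module.algebraMap_end_apply]

/-- A function, as a differential operator. -/
def opOfFun (a : A) : diffOps A := ⟨mulOp a, 0, isDiffOp_mulOp a⟩

/-- A vector field, as a differential operator. -/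
def opOfDer (v : Derivation ℂ A A) : diffOps A :=
  ⟨(v : A →ₗ[ℂ] A), 1, fun a => by
    have e : (v : A →ₗ[ℂ] A) * mulOp a - mulOp a * (v : A →ₗ[ℂ] A) = mulOp (v a) := by
      ext x
      simp [mulOp, mul_comm]
    rw [e]
    exact isDiffOp_mulOp _⟩

end DiffOps

/-! ## One-forms -/

section Forms

/-- The map induced on Kähler differentials by a homomorphism of algebras: `a db ↦ φ(a) dφ(b)`. -/
def kaehlerMap {A B : Type*} [CommRing A] [Algebra ℂ A] [CommRing B] [Algebra ℂ B]
    (φ : A →ₐ[ℂ] B) : Ω[A⁄ℂ] →+ Ω[B⁄ℂ] :=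
  letI : Algebra A B := φ.toRingHom.toAlgebra
  haveI : IsScalarTower ℂ A B := IsScalarTower.of_algebraMap_eq fun c => (φ.commutes c).symm
  (KaehlerDifferential.map ℂ ℂ A B).toAddMonoidHom

theorem kaehlerMap_smul_D {A B : Type*} [CommRing A] [Algebra ℂ A] [CommRing B] [Algebra ℂ B]
    (φ : A →ₐ[ℂ] B) (a b : A) :
    kaehlerMap φ (a • KaehlerDifferential.D ℂ A b) = φ a • KaehlerDifferential.D ℂ B (φ b) := by
  let _ : Algebra A B := φ.toRingHom.toAlgebra
  have _ : IsScalarTower ℂ A B := IsScalarTower.of_algebraMap_eq fun c => (φ.commutes c).symm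
  have h : kaehlerMap φ (a • KaehlerDifferential.D ℂ A b)
      = a • KaehlerDifferential.map ℂ ℂ A B (KaehlerDifferential.D ℂ A b) :=
    LinearMap.map_smul (KaehlerDifferential.map ℂ ℂ A B) a (KaehlerDifferential.D ℂ A b)
  rw [h, KaehlerDifferential.map_D, ← IsScalarTower.algebraMap_smul B a]
  rfl

variable {A : Type*} [CommRing A] [Algebra ℂ A] {n : ℕ}

/-- The matrix of functions `α(v)`, for a matrix `α` of one-forms and a vector field `v`. -/
def evalForm (α : Matrix (Fin n) (Fin n) (Ω[A⁄ℂ])) (v : Derivation ℂ A A) :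
    Matrix (Fin n) (Fin n) A :=
  α.map v.liftKaehlerDifferential

/-- `dα + α ∧ α = 0`, evaluated on all pairs of vector fields; here
`dα(u, v) = u(α(v)) - v(α(u)) - α([u, v])` and `(α ∧ α)(u, v) = α(u) α(v) - α(v) α(u)`. -/
def IsFlat (α : Matrix (Fin n) (Fin n) (Ω[A⁄ℂ])) : Prop :=
  ∀ u v : Derivation ℂ A A,
    ((evalForm α v).map u - (evalForm α u).map v - evalForm α ⁅u, v⁆)
      + (evalForm α u * evalForm α v - evalForm α v * evalForm α u) = 0

end Forms

/-! ## Invariant D-modules on a linear algebraic group -/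

section DModules

variable {N : ℕ}

/-- The matrix-valued one-form `α` is invariant under left translations. -/
def IsInvariantForm (G : Subgroup (GL (Fin N) ℂ)) {n : ℕ}
    (α : Matrix (Fin n) (Fin n) (Ω[coordRing G⁄ℂ])) : Prop :=
  ∀ g : G, α.map (kaehlerMap (translate G g)) = α

/-- An invariant D-module of rank `n` on `G`: a flat invariant matrix-valued one-form `α`, and the
`D(G)`-module structure on `ℂ[G]ⁿ` that extends the `ℂ[G]`-module structure and satisfies
`v (e₁, …, eₙ) = (e₁, …, eₙ) α(v)` for all vector fields `v`. -/
@[ext]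
structure InvariantDModule (G : Subgroup (GL (Fin N) ℂ)) (n : ℕ) where
  form : Matrix (Fin n) (Fin n) (Ω[coordRing G⁄ℂ])
  invariant : IsInvariantForm G form
  flat : IsFlat form
  act : diffOps (coordRing G) →ₐ[ℂ] Module.End ℂ (Fin n → coordRing G)
  act_fun : ∀ (f : coordRing G) (m : Fin n → coordRing G), act (opOfFun f) m = f • m
  act_der : ∀ (v : Derivation ℂ (coordRing G) (coordRing G)) (j : Fin n),
    act (opOfDer v) (Pi.single j 1) = fun i => evalForm form v i j

/-- Isomorphism of `D(G)`-modules. -/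
def InvariantDModule.Iso {G : Subgroup (GL (Fin N) ℂ)} {n : ℕ} (M M' : InvariantDModule G n) :
    Prop :=
  ∃ Φ : (Fin n → coordRing G) ≃ₗ[ℂ] (Fin n → coordRing G),
    ∀ (P : diffOps (coordRing G)) (m : Fin n → coordRing G), Φ (M.act P m) = M'.act P (Φ m)

instance isoSetoid (G : Subgroup (GL (Fin N) ℂ)) (n : ℕ) : Setoid (InvariantDModule G n) where
  r := InvariantDModule.Iso
  iseqv :=
    { refl := fun _ => ⟨LinearEquiv.refl _ _, fun _ _ => rfl⟩
      symm := by
        rintro M M' ⟨Φ, h⟩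
        refine ⟨Φ.symm, fun P m => ?_⟩
        rw [LinearEquiv.symm_apply_eq, h, LinearEquiv.apply_symm_apply]
      trans := by
        rintro M M' M'' ⟨Φ, h⟩ ⟨Ψ, h'⟩
        exact ⟨Φ.trans Ψ, fun P m => by simp [h, h']⟩ }

/-- Isomorphism classes of invariant D-modules of rank `n` on `G`. -/
abbrev IsoClasses (G : Subgroup (GL (Fin N) ℂ)) (n : ℕ) : Type :=
  Quotient (isoSetoid G n)

end DModules

/-! ## Representations and the categorical quotient -/

section Representations

variable (𝔫 : Type*) [LieRing 𝔫] [LieAlgebra ℂ 𝔫] (n : ℕ)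

/-- The set of Lie algebra homomorphisms from `𝔫` to `gl_n(ℂ)`. -/
abbrev Rep : Type _ := 𝔫 →ₗ⁅ℂ⁆ Matrix (Fin n) (Fin n) ℂ

/-- The algebra of regular functions on the affine variety of `n`-dimensional representations:
generated, among all functions, by the matrix entries of the `ρ x`. -/
def repCoordRing : Subalgebra ℂ (Rep 𝔫 n → ℂ) :=
  Algebra.adjoin ℂ {f | ∃ (x : 𝔫) (i j : Fin n), f = fun ρ => ρ x i j}

/-- The regular functions that are invariant under conjugation by `GL_n(ℂ)`. -/
def invariantRing : Subalgebra ℂ (Rep 𝔫 n → ℂ) where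
  carrier := {f | f ∈ repCoordRing 𝔫 n ∧
    ∀ (g : GL (Fin n) ℂ) (ρ ρ' : Rep 𝔫 n),
      (∀ x, ρ' x = g.val * ρ x * (g⁻¹).val) → f ρ' = f ρ}
  mul_mem' := by
    rintro a b ⟨ha, ha'⟩ ⟨hb, hb'⟩
    refine ⟨mul_mem ha hb, fun g ρ ρ' h => ?_⟩
    simp only [Pi.mul_apply, ha' g ρ ρ' h, hb' g ρ ρ' h]
  add_mem' := by
    rintro a b ⟨ha, ha'⟩ ⟨hb, hb'⟩
    refine ⟨add_mem ha hb, fun g ρ ρ' h => ?_⟩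
    simp only [Pi.add_apply, ha' g ρ ρ' h, hb' g ρ ρ' h]
  algebraMap_mem' := fun c => ⟨Subalgebra.algebraMap_mem _ c, fun _ _ _ _ => rfl⟩

/-- The points of the categorical quotient: the closed points of the spectrum of the ring of
invariants. -/
abbrev CategoricalQuotient : Type _ := MaximalSpectrum (invariantRing 𝔫 n)

variable {𝔫 n}

/-- Evaluation of invariants at a representation. -/
def evalAt (ρ : Rep 𝔫 n) : invariantRing 𝔫 n →ₐ[ℂ] ℂ :=
  (Pi.evalAlgHom ℂ (fun _ : Rep 𝔫 n => ℂ) ρ).comp (invariantRing 𝔫 n).val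

/-- The quotient map: `ρ` goes to the maximal ideal of the invariants that vanish at `ρ`. -/
def quotientMap (ρ : Rep 𝔫 n) : CategoricalQuotient 𝔫 n :=
  ⟨RingHom.ker (evalAt ρ), RingHom.ker_isMaximal_of_surjective (evalAt ρ)
    fun c => ⟨algebraMap ℂ _ c, (evalAt ρ).commutes c⟩⟩

theorem exists_semisimplePart (A : Matrix (Fin n) (Fin n) ℂ) :
    ∃ S : Matrix (Fin n) (Fin n) ℂ,
      Module.End.IsSemisimple (Matrix.toLin' S) ∧ IsNilpotent (A - S) ∧ Commute A S := by
  obtain ⟨ν, hν, s, hs, hνn, hss, h⟩ := 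
    Module.End.exists_isNilpotent_isSemisimple (f := Matrix.toLin' A)
  have hA : A = LinearMap.toMatrix' ν + LinearMap.toMatrix' s := by
    rw [← map_add, ← h, LinearMap.toMatrix'_toLin']
  refine ⟨LinearMap.toMatrix' s, by rwa [Matrix.toLin'_toMatrix'], ?_, ?_⟩
  · rw [hA, add_sub_cancel_right]
    exact hνn.map LinearMap.toMatrixAlgEquiv'
  · have hc : Commute (Matrix.toLin' A) s := Algebra.commute_of_mem_adjoin_self hs
    have := hc.map LinearMap.toMatrixAlgEquiv'
    simpa [LinearMap.toMatrixAlgEquiv'] using this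

/-- The semisimple part `A_s` of the (additive) Jordan decomposition `A = A_s + A_n`: the unique
semisimple matrix that commutes with `A` such that `A - A_s` is nilpotent. -/
def semisimplePart (A : Matrix (Fin n) (Fin n) ℂ) : Matrix (Fin n) (Fin n) ℂ :=
  (exists_semisimplePart A).choose

/-- The semisimple parts of the two representations are conjugate. -/
def SemisimplePartsConjugate (ρ₁ ρ₂ : Rep 𝔫 n) : Prop :=
  ∃ g : GL (Fin n) ℂ, ∀ x : 𝔫,
    semisimplePart (ρ₁ x) = g.val * semisimplePart (ρ₂ x) * (g⁻¹).val

/-- The one-form of `M` is the left invariant form that corresponds to `ρ`: on the left invariant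
vector field given by `x` it takes the constant value `ρ x`. -/
def CorrespondsTo {N : ℕ} {G : Subgroup (GL (Fin N) ℂ)} (e : 𝔫 ≃ₗ⁅ℂ⁆ lieAlg G)
    (M : InvariantDModule G n) (ρ : Rep 𝔫 n) : Prop :=
  ∀ x : 𝔫, evalForm M.form (e x).val = (ρ x).map (algebraMap ℂ (coordRing G))

end Representations

end InvDMod

end

/-! Only three infinitesimal facts about `U` are used, collected in `IsUnipotentAction`: left
invariant vector fields act locally nilpotently on ℂ[U], the only functions they all kill are
constants, and they are determined by their value at the unit. For a nilpotent Lie algebra these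
facts already produce coordinates: along a basis adapted to a central series each vector has a slice
(`exists_slice`), so ℂ[U] is generated by coordinates with dual derivations. Hence invariant fields
span all vector fields over ℂ[U], and functions and vector fields generate D(U). The invariant form
is therefore constant on invariant fields, flatness says that its values form a representation `ρ`,
and an isomorphism of two modules is a matrix `H` in GL_n(ℂ[U]) with x(H) + ρ₂(x) H = H ρ₁(x), a
gauge transformation.

From modules to diagonal ones: by Lie's theorem `ρ` is triangular after conjugation. The
off-diagonal entries can be removed by a gauge transformation, since each one satisfies an equation
x(h) + ψ(x) h = f(x) with `ψ` a character, solvable in ℂ[U] by the twisted Poincaré lemma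
(`exists_primitive`). So every module is a sum of rank one modules given by the diagonal characters
(`exists_gauge_triangular`). The same decomposition constructs the modules: P ↦ exp(-l) P exp(l),
with `l` a primitive of a character, makes sense on all of D(U) although exp(l) is not a regular
function.

From isomorphism to conjugacy: in a gauge transformation between constant connections the nilpotent
parts and the vector field together act locally nilpotently, and they commute with the semisimple
parts. This forces H(1) to intertwine the semisimple parts (`semisimple_intertwine_of_gauge`).

Invariants: a torus degenerates a triangular representation to its diagonal, so the two have the
same image in the quotient. Characteristic polynomials separate families of characters up to
permutation. Together these facts close the cycle from isomorphism through conjugate semisimple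
parts and equal invariants back to isomorphism. Surjectivity of the quotient map comes from the
restriction of invariants to diagonal representations, which is injective and integral, and from the
Nullstellensatz (`quotientMap_surjective`). -/

namespace InvDMod

/-! ### Central bases and triangularization -/

section Flags

variable {V : Type*} [AddCommGroup V] [Module ℂ V] [FiniteDimensional ℂ V]

/-- A basis adapted to a flag of subspaces that is constructed one vector at a time. -/
theorem exists_basis_of_extension (Stable : Submodule ℂ V → Prop)
    (Rel : Submodule ℂ V → V → Prop) (h0 : Stable ⊥)
    (hstep : ∀ W, Stable W → W ≠ ⊤ → ∃ v ∉ W, Rel W v ∧ Stable (W ⊔ Submodule.span ℂ {v})) :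
    ∃ b : Module.Basis (Fin (Module.finrank ℂ V)) ℂ V,
      ∀ i, Rel (Submodule.span ℂ (b '' Set.Iio i)) (b i) := by
  have key : ∀ m ≤ Module.finrank ℂ V, ∃ v : Fin m → V, LinearIndependent ℂ v ∧
      Stable (Submodule.span ℂ (Set.range v)) ∧
      ∀ i, Rel (Submodule.span ℂ (v '' Set.Iio i)) (v i) := by
    intro m
    induction m with
    | zero =>
      intro _
      refine ⟨Fin.elim0, linearIndependent_empty_type, ?_, fun i => i.elim0⟩
      simpa using h0
    | succ m ih =>
      intro hm
      obtain ⟨v, hv, hs, hr⟩ := ih (by omega)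
      have hne : Submodule.span ℂ (Set.range v) ≠ ⊤ := by
        intro h
        have h1 := finrank_span_eq_card hv
        rw [h, finrank_top, Fintype.card_fin] at h1
        omega
      obtain ⟨w, hw, hR, hS⟩ := hstep _ hs hne
      refine ⟨Fin.snoc v w, linearIndependent_finSnoc.2 ⟨hv, hw⟩, ?_, ?_⟩
      · rw [Fin.range_snoc, Set.insert_eq, Submodule.span_union, sup_comm]
        exact hS
      · intro i
        induction i using Fin.lastCases with
        | last =>
          have e : (Fin.snoc v w : Fin (m + 1) → V) '' Set.Iio (Fin.last m) = Set.range v := by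
            ext y
            constructor
            · rintro ⟨j, hj, rfl⟩
              obtain ⟨j, rfl⟩ := Fin.exists_castSucc_eq.2 (ne_of_lt hj)
              exact ⟨j, by simp⟩
            · rintro ⟨j, rfl⟩
              exact ⟨j.castSucc, Fin.castSucc_lt_last j, by simp⟩
          rw [e, Fin.snoc_last]
          exact hR
        | cast i =>
          have e : (Fin.snoc v w : Fin (m + 1) → V) '' Set.Iio i.castSucc = v '' Set.Iio i := by
            ext y
            constructor
            · rintro ⟨j, hj, rfl⟩
              obtain ⟨j, rfl⟩ := Fin.exists_castSucc_eq.2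
                (ne_of_lt (lt_trans hj (Fin.castSucc_lt_last i)))
              exact ⟨j, Fin.castSucc_lt_castSucc_iff.1 hj, by simp⟩
            · rintro ⟨j, hj, rfl⟩
              exact ⟨j.castSucc, Fin.castSucc_lt_castSucc_iff.2 hj, by simp⟩
          rw [e, Fin.snoc_castSucc]
          exact hr i
  obtain ⟨v, hv, -, hr⟩ := key _ le_rfl
  let b : Module.Basis (Fin (Module.finrank ℂ V)) ℂ V :=
    Module.Basis.mk hv (hv.span_eq_top_of_card_eq_finrank' (by simp)).ge
  have hb : ⇑b = v := Module.Basis.coe_mk _ _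
  exact ⟨b, fun i => by rw [hb]; exact hr i⟩

variable {L : Type*} [LieRing L] [LieAlgebra ℂ L]

/-- A nilpotent Lie algebra has a basis adapted to a central series. -/
theorem exists_central_basis [FiniteDimensional ℂ L] [LieRing.IsNilpotent L] :
    ∃ b : Module.Basis (Fin (Module.finrank ℂ L)) ℂ L,
      ∀ i, ∀ y : L, ⁅y, b i⁆ ∈ Submodule.span ℂ (b '' Set.Iio i) := by
  refine exists_basis_of_extension (fun W => ∀ y : L, ∀ w ∈ W, ⁅y, w⁆ ∈ W)
    (fun W v => ∀ y : L, ⁅y, v⁆ ∈ W) (by simp) ?_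
  intro W hW hne
  have hex : ∃ k, (LieModule.lowerCentralSeries ℂ L L k).toSubmodule ≤ W := by
    obtain ⟨k, hk⟩ := LieModule.IsNilpotent.nilpotent ℂ L L
    exact ⟨k, by simp [hk]⟩
  classical
  -- At the last term of the lower central series not inside `W`, any vector outside `W` becomes
  -- central modulo `W`.
  obtain ⟨k, hk, hmin⟩ : ∃ k, (LieModule.lowerCentralSeries ℂ L L (k + 1)).toSubmodule ≤ W ∧
      ¬ (LieModule.lowerCentralSeries ℂ L L k).toSubmodule ≤ W := by
    cases hk : Nat.find hex with
    | zero =>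
      have := Nat.find_spec hex
      rw [hk] at this
      simp only [LieModule.lowerCentralSeries_zero, LieSubmodule.top_toSubmodule,
        top_le_iff] at this
      exact absurd this hne
    | succ k =>
      refine ⟨k, hk ▸ Nat.find_spec hex, Nat.find_min hex (by omega)⟩
  obtain ⟨v, hv, hvW⟩ := SetLike.not_le_iff_exists.1 hmin
  have hbr : ∀ y : L, ⁅y, v⁆ ∈ W := fun y => hk (by
    change ⁅y, v⁆ ∈ LieModule.lowerCentralSeries ℂ L L (k + 1)
    rw [LieModule.lowerCentralSeries_succ]
    exact LieSubmodule.lie_mem_lie (LieSubmodule.mem_top y) hv)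
  refine ⟨v, hvW, hbr, fun y w hw => ?_⟩
  obtain ⟨w₁, hw₁, w₂, hw₂, rfl⟩ := Submodule.mem_sup.1 hw
  obtain ⟨c, rfl⟩ := Submodule.mem_span_singleton.1 hw₂
  rw [lie_add, lie_smul]
  exact Submodule.mem_sup_left (add_mem (hW y _ hw₁) (W.smul_mem c (hbr y)))

/-- Lie's theorem: a basis that makes a representation triangular. -/
theorem exists_triangular_basis [LieAlgebra.IsSolvable L] [LieRingModule L V] [LieModule ℂ L V] :
    ∃ b : Module.Basis (Fin (Module.finrank ℂ V)) ℂ V,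
      ∀ i, ∀ y : L, ⁅y, b i⁆ ∈ Submodule.span ℂ (b '' Set.Iio i) ⊔ Submodule.span ℂ {b i} := by
  refine exists_basis_of_extension (fun W => ∀ y : L, ∀ w ∈ W, ⁅y, w⁆ ∈ W)
    (fun W v => ∀ y : L, ⁅y, v⁆ ∈ W ⊔ Submodule.span ℂ {v}) (by simp) ?_
  intro W hW hne
  let N : LieSubmodule ℂ L V := { W with lie_mem := fun {x m} hm => hW x m hm }
  have hnt : Nontrivial (V ⧸ N) := Submodule.Quotient.nontrivial_iff.2 hne
  -- A common eigenvector of the quotient lifts to the next vector of the flag.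
  obtain ⟨χ, hχ⟩ := LieModule.exists_nontrivial_weightSpace_of_isSolvable ℂ L (V ⧸ N)
  obtain ⟨⟨u, hu⟩, hu0⟩ := exists_ne (0 : LieModule.weightSpace (V ⧸ N) χ)
  obtain ⟨v, rfl⟩ := LieSubmodule.Quotient.surjective_mk' N u
  rw [LieModule.mem_weightSpace] at hu
  have hvW : v ∉ W := fun h => hu0 (Subtype.ext
    ((LieSubmodule.Quotient.mk_eq_zero (N := N)).2 h))
  have hbr : ∀ y : L, ⁅y, v⁆ - χ y • v ∈ W := by
    intro y
    have := hu y
    rw [← LieModuleHom.map_lie, ← map_smul, ← sub_eq_zero, ← map_sub] at this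
    exact (LieSubmodule.Quotient.mk_eq_zero (N := N)).1 this
  have hbr' : ∀ y : L, ⁅y, v⁆ ∈ W ⊔ Submodule.span ℂ {v} := fun y => by
    rw [← sub_add_cancel ⁅y, v⁆ (χ y • v)]
    exact add_mem (Submodule.mem_sup_left (hbr y))
      (Submodule.mem_sup_right (Submodule.smul_mem _ _ (Submodule.mem_span_singleton_self v)))
  refine ⟨v, hvW, hbr', fun y w hw => ?_⟩
  obtain ⟨w₁, hw₁, w₂, hw₂, rfl⟩ := Submodule.mem_sup.1 hw
  obtain ⟨c, rfl⟩ := Submodule.mem_span_singleton.1 hw₂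
  rw [lie_add, lie_smul]
  exact add_mem (Submodule.mem_sup_left (hW y _ hw₁)) (Submodule.smul_mem _ c (hbr' y))

/-- A matrix representation of a solvable Lie algebra is conjugate to an upper triangular one. -/
theorem exists_conj_triangular [LieAlgebra.IsSolvable L] {n : ℕ} (ρ : Rep L n) :
    ∃ (P : GL (Fin n) ℂ) (T : Rep L n), (∀ x, T x = (P⁻¹).val * ρ x * P.val) ∧
      ∀ x i j, j < i → T x i j = 0 := by
  let φ : L →ₗ⁅ℂ⁆ Module.End ℂ (Fin n → ℂ) := lieEquivMatrix'.symm.toLieHom.comp ρ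
  let _ : LieRingModule L (Fin n → ℂ) := LieRingModule.compLieHom (Fin n → ℂ) φ
  have _ : LieModule ℂ L (Fin n → ℂ) := LieModule.compLieHom (Fin n → ℂ) φ
  obtain ⟨b', hb'⟩ := exists_triangular_basis (L := L) (V := Fin n → ℂ)
  obtain ⟨b, hb⟩ : ∃ b : Module.Basis (Fin n) ℂ (Fin n → ℂ), ∀ i, ∀ y : L,
      ρ y *ᵥ b i ∈ Submodule.span ℂ (b '' Set.Iio i) ⊔ Submodule.span ℂ {b i} := by
    revert b'
    rw [Module.finrank_fin_fun]
    exact fun b' hb' => ⟨b', hb'⟩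
  let e := Pi.basisFun ℂ (Fin n)
  let P : GL (Fin n) ℂ := ⟨e.toMatrix b, b.toMatrix e, e.toMatrix_mul_toMatrix_flip b,
    b.toMatrix_mul_toMatrix_flip e⟩
  let T : Rep L n :=
    { toFun := fun x => (P⁻¹).val * ρ x * P.val
      map_add' := fun x y => by rw [map_add, mul_add, add_mul]
      map_smul' := fun c x => by simp
      map_lie' := fun {x y} => by
        simp only [LieHom.map_lie, Ring.lie_def, mul_sub, sub_mul]
        congr 1 <;> simp only [mul_assoc, Units.mul_inv_cancel_left] }
  refine ⟨P, T, fun _ => rfl, fun x i j hij => ?_⟩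
  have hT : T x = LinearMap.toMatrix b b (Matrix.toLin' (ρ x)) := by
    have h : LinearMap.toMatrix e e (Matrix.toLin' (ρ x)) = ρ x := by
      rw [LinearMap.toMatrix_eq_toMatrix', LinearMap.toMatrix'_toLin']
    rw [← basis_toMatrix_mul_linearMap_toMatrix_mul_basis_toMatrix b e b e, h]
    rfl
  rw [hT, LinearMap.toMatrix_apply, Matrix.toLin'_apply]
  have hle : Submodule.span ℂ (b '' Set.Iio j) ⊔ Submodule.span ℂ {b j}
      ≤ LinearMap.ker (b.coord i) := by
    rw [sup_le_iff, Submodule.span_le, Submodule.span_le]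
    constructor
    · rintro _ ⟨k, hk, rfl⟩
      have : k ≠ i := ne_of_lt (lt_trans hk hij)
      simp [this]
    · rintro _ rfl
      simp [ne_of_lt hij]
  exact hle (hb j x)

end Flags

end InvDMod

namespace InvDMod

/-! ### Solving equations with locally nilpotent operators -/

section Integration

variable {R : Type*} [Ring R] [Algebra ℂ R]

/-- A derivation `δ` with a slice `p`, `δ p = 1`, is surjective on locally nilpotent elements. -/
theorem exists_preimage_of_slice (δ : R →ₗ[ℂ] R) (hδ : ∀ a b, δ (a * b) = δ a * b + a * δ b)
    {p : R} (hp : δ p = 1) (G : Submodule ℂ R) (hGδ : ∀ g ∈ G, δ g ∈ G)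
    (hGp : ∀ g ∈ G, g * p ∈ G) {m : ℕ} {g : R} (hg : g ∈ G) (hm : (δ ^ m) g = 0) :
    ∃ h ∈ G, δ h = g := by
  have hpow : ∀ j : ℕ, δ (p ^ (j + 1)) = ((j : ℂ) + 1) • p ^ j := by
    intro j
    induction j with
    | zero => simp [hp]
    | succ j ih =>
      rw [pow_succ, hδ, ih, hp, mul_one, smul_mul_assoc, ← pow_succ, Nat.cast_succ]
      module
  have hGpow : ∀ j : ℕ, ∀ g ∈ G, g * p ^ j ∈ G := by
    intro j
    induction j with
    | zero => simp
    | succ j ih => intro g hg; rw [pow_succ, ← mul_assoc]; exact hGp _ (ih g hg)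
  -- Repeated integration by parts: a primitive of g p^j is (g p^(j+1) - h) / (j+1), where `h` is a
  -- primitive of (δ g) p^(j+1). The powers of `p` make the induction on the nilpotency order go
  -- through.
  have key : ∀ m : ℕ, ∀ j : ℕ, ∀ g ∈ G, (δ ^ m) g = 0 → ∃ h ∈ G, δ h = g * p ^ j := by
    intro m
    induction m with
    | zero =>
      intro j g _ h0
      have : g = 0 := by simpa using h0
      exact ⟨0, G.zero_mem, by simp [this]⟩
    | succ m ih =>
      intro j g hg hm
      obtain ⟨h, hh, e⟩ := ih (j + 1) (δ g) (hGδ g hg) (by rwa [pow_succ] at hm)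
      refine ⟨((j : ℂ) + 1)⁻¹ • (g * p ^ (j + 1) - h),
        G.smul_mem _ (G.sub_mem (hGpow _ g hg) hh), ?_⟩
      rw [map_smul, map_sub, hδ, e, hpow, add_sub_cancel_left, mul_smul_comm, smul_smul,
        inv_mul_cancel₀ (Nat.cast_add_one_ne_zero j), one_smul]
  obtain ⟨h, hh, e⟩ := key m 0 g hg hm
  exact ⟨h, hh, by simpa using e⟩

/-- A locally nilpotent operator plus a nonzero scalar is surjective. -/
theorem exists_preimage_add_smul {M : Type*} [AddCommGroup M] [Module ℂ M] (δ : M →ₗ[ℂ] M)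
    {c : ℂ} (hc : c ≠ 0) (G : Submodule ℂ M) (hGδ : ∀ g ∈ G, δ g ∈ G) {m : ℕ} {g : M} (hg : g ∈ G)
    (hm : (δ ^ m) g = 0) : ∃ h ∈ G, δ h + c • h = g := by
  induction m generalizing g with
  | zero => exact ⟨0, G.zero_mem, by simpa using hm.symm⟩
  | succ m ih =>
    obtain ⟨h, hh, e⟩ := ih (hGδ g hg) (by rwa [pow_succ] at hm)
    -- One step of the finite Neumann series for the inverse of δ + c; here `h` solves the equation
    -- with right-hand side δ g.
    refine ⟨c⁻¹ • (g - h), G.smul_mem _ (G.sub_mem hg hh), ?_⟩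
    rw [map_smul, smul_comm c, ← smul_add, map_sub, smul_sub, inv_smul_eq_iff₀ hc, ← e]
    abel

/-- An eigenvector for the nonzero eigenvalue -c cannot be killed by a power of `δ`. -/
theorem eq_zero_of_pow_eq_zero_of_smul {M : Type*} [AddCommGroup M] [Module ℂ M] (δ : M →ₗ[ℂ] M)
    {c : ℂ} (hc : c ≠ 0) {m : ℕ} {g : M} (hm : (δ ^ m) g = 0) (hg : δ g + c • g = 0) : g = 0 := by
  have h1 : δ g = (-c) • g := by rw [neg_smul]; exact eq_neg_of_add_eq_zero_left hg
  have h2 : ∀ k : ℕ, (δ ^ k) g = (-c) ^ k • g := by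
    intro k
    induction k with
    | zero => simp
    | succ k ih => rw [pow_succ, Module.End.mul_apply, h1, map_smul, ih, smul_smul, pow_succ']
  rw [h2] at hm
  exact (smul_eq_zero.1 hm).resolve_left (pow_ne_zero _ (neg_ne_zero.2 hc))

variable {A : Type*} [CommRing A] [Algebra ℂ A]

/-- Induction on the nilpotency order: δ f lies in the algebra generated by constants of `δ` and the
slice, so it has a primitive there, which differs from `f` by a constant of `δ` in `B`. -/
theorem mem_adjoin_of_slice (δ : Derivation ℂ A A) (B : Subalgebra ℂ A) (hB : ∀ f ∈ B, δ f ∈ B)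
    {s : A} (hs : s ∈ B) (hs1 : δ s = 1) {m : ℕ} {f : A} (hf : f ∈ B)
    (hm : ((δ : A →ₗ[ℂ] A) ^ m) f = 0) (hnil : ∀ f, ∃ m : ℕ, ((δ : A →ₗ[ℂ] A) ^ m) f = 0) :
    f ∈ Algebra.adjoin ℂ ({g | g ∈ B ∧ δ g = 0} ∪ {s}) := by
  set G := Algebra.adjoin ℂ ({g | g ∈ B ∧ δ g = 0} ∪ {s}) with hG
  have hGB : G ≤ B := by
    refine Algebra.adjoin_le ?_
    rintro g (hg | rfl)
    · exact hg.1
    · exact hs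
  have hGδ : ∀ g ∈ G, δ g ∈ G := by
    intro g hg
    refine Algebra.adjoin_induction ?_ ?_ ?_ ?_ hg
    · rintro g (hg | rfl)
      · rw [hg.2]; exact G.zero_mem
      · rw [hs1]; exact G.one_mem
    · intro r; rw [Derivation.map_algebraMap]; exact G.zero_mem
    · intro x y _ _ hx hy; rw [map_add]; exact G.add_mem hx hy
    · intro x y hx hy hx' hy'
      rw [Derivation.leibniz]
      exact G.add_mem (G.mul_mem hx hy') (G.mul_mem hy hx')
  have hsG : s ∈ G := Algebra.subset_adjoin (Or.inr rfl)
  induction m generalizing f with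
  | zero =>
    have : f = 0 := by simpa using hm
    rw [this]
    exact G.zero_mem
  | succ m ih =>
    have h1 : δ f ∈ G := ih (hB f hf) (by rwa [pow_succ] at hm)
    obtain ⟨m', hm'⟩ := hnil (δ f)
    obtain ⟨h, hh, e⟩ := exists_preimage_of_slice (δ : A →ₗ[ℂ] A)
      (fun a b => by simp [Derivation.leibniz, mul_comm, add_comm]) hs1
      G.toSubmodule hGδ (fun g hg => G.mul_mem hg hsG) h1 hm'
    have h2 : f - h ∈ G := Algebra.subset_adjoin (Or.inl ⟨B.sub_mem hf (hGB hh), by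
      rw [map_sub, sub_eq_zero]; exact e.symm⟩)
    rw [← sub_add_cancel f h]
    exact G.add_mem h2 hh

end Integration

/-! ### Slices, coordinates and the twisted Poincaré lemma -/

section Coordinates

variable {A : Type*} [CommRing A] [Algebra ℂ A] {L : Type*} [LieRing L] [LieAlgebra ℂ L]

/-- The infinitesimal properties of the action of the Lie algebra of a unipotent group on the
regular functions of the group. -/
structure IsUnipotentAction (D : L →ₗ⁅ℂ⁆ Derivation ℂ A A) (ε : A →ₐ[ℂ] ℂ) : Prop where
  locallyNilpotent : ∀ (x : L) (f : A), ∃ m : ℕ, ((D x : A →ₗ[ℂ] A) ^ m) f = 0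
  invariants : ∀ f : A, (∀ x, D x f = 0) → ∃ c : ℂ, f = algebraMap ℂ A c
  eval_injective : ∀ x : L, (∀ f, ε (D x f) = 0) → x = 0

theorem sum_derivation_apply {ι : Type*} (t : Finset ι) (v : ι → Derivation ℂ A A) (f : A) :
    (∑ i ∈ t, v i) f = ∑ i ∈ t, v i f := by
  classical
  induction t using Finset.induction_on with
  | empty => simp
  | insert i t hi ih => rw [Finset.sum_insert hi, Finset.sum_insert hi, Derivation.add_apply, ih]

variable {d : ℕ} (D : L →ₗ⁅ℂ⁆ Derivation ℂ A A) (b : Module.Basis (Fin d) ℂ L)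

/-- The functions that are killed by the first `k` basis vectors. -/
def killedBy (k : ℕ) : Subalgebra ℂ A where
  carrier := {f | ∀ j : Fin d, j.val < k → D (b j) f = 0}
  mul_mem' := by
    intro f g hf hg j hj
    simp [hf j hj, hg j hj]
  add_mem' := by
    intro f g hf hg j hj
    simp [hf j hj, hg j hj]
  algebraMap_mem' := by
    intro c j _
    simp

variable {D b}

theorem apply_eq_sum_repr (x : L) (f : A) : D x f = ∑ i, b.repr x i • D (b i) f := by
  conv_lhs => rw [← b.sum_repr x, map_sum, sum_derivation_apply]
  simp

theorem killedBy_anti {k l : ℕ} (h : k ≤ l) : killedBy D b l ≤ killedBy D b k :=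
  fun _ hf j hj => hf j (lt_of_lt_of_le hj h)

theorem apply_eq_zero_of_mem_span {i : Fin d} {z : L}
    (hz : z ∈ Submodule.span ℂ (b '' Set.Iio i)) {f : A} (hf : f ∈ killedBy D b i) :
    D z f = 0 := by
  induction hz using Submodule.span_induction with
  | mem z hz => obtain ⟨j, hj, rfl⟩ := hz; exact hf j hj
  | zero => simp
  | add x y _ _ hx hy => simp [hx, hy]
  | smul c x _ hx => simp [hx]

variable (hb : ∀ i, ∀ y : L, ⁅y, b i⁆ ∈ Submodule.span ℂ (b '' Set.Iio i))
include hb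

/-- The bracket of `y` with `b i` lies in the span of the earlier basis vectors, which kill `f`.
Thus on such functions `b i` acts as a central element. -/
theorem apply_comm_of_mem_killedBy (i : Fin d) (y : L) {f : A} (hf : f ∈ killedBy D b i) :
    D (b i) (D y f) = D y (D (b i) f) := by
  have h := apply_eq_zero_of_mem_span (D := D) (hb i y) hf
  rw [LieHom.map_lie, Derivation.commutator_apply, sub_eq_zero] at h
  exact h.symm

theorem apply_mem_killedBy {k : ℕ} (y : L) {f : A} (hf : f ∈ killedBy D b k) :
    D y f ∈ killedBy D b k := by
  intro j hj
  rw [apply_comm_of_mem_killedBy hb j y (killedBy_anti hj.le hf), hf j hj, map_zero]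

omit hb in
theorem mem_killedBy_succ {i : Fin d} {f : A} (hf : f ∈ killedBy D b i) (h : D (b i) f = 0) :
    f ∈ killedBy D b (i + 1) := by
  intro j hj
  rcases Nat.lt_succ_iff_lt_or_eq.1 hj with h1 | h1
  · exact hf j h1
  · rwa [Fin.ext h1]

theorem iterate_mem_killedBy {k : ℕ} (y : L) (m : ℕ) {f : A} (hf : f ∈ killedBy D b k) :
    ((D y : A →ₗ[ℂ] A) ^ m) f ∈ killedBy D b k := by
  induction m with
  | zero => simpa using hf
  | succ m ih => rw [pow_succ', Module.End.mul_apply]; exact apply_mem_killedBy hb y ih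

omit hb in
theorem exists_triangular_solution {R : Type*} [CommRing R] (C : Matrix (Fin d) (Fin d) R)
    (h1 : ∀ i, C i i = 1) (h0 : ∀ i j, i < j → C i j = 0) (t : Fin d → R) :
    ∃ a : Fin d → R, a ᵥ* C = t := by
  have hdet : IsUnit C.det := by
    rw [Matrix.det_of_isLowerTriangular C (fun i j h => h0 i j h)]
    simp [h1]
  exact ⟨t ᵥ* C⁻¹, by rw [Matrix.vecMul_vecMul, Matrix.nonsing_inv_mul _ hdet, Matrix.vecMul_one]⟩

variable {ε : A →ₐ[ℂ] ℂ} (hD : IsUnipotentAction D ε)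
include hD

/-- Each slice allows one more basis vector to be imposed: `mem_adjoin_of_slice` writes functions
killed by the first `k` vectors as polynomials in the next slice with coefficients killed by `k + 1`
vectors. -/
theorem adjoin_killedBy_union_slices (k : ℕ) (hk : k ≤ d) (s : Fin d → A)
    (hs : ∀ j : Fin d, j.val < k → s j ∈ killedBy D b j ∧ D (b j) (s j) = 1) :
    Algebra.adjoin ℂ ((killedBy D b k : Set A) ∪ s '' {j | j.val < k}) = ⊤ := by
  induction k with
  | zero =>
    refine top_le_iff.1 fun f _ => Algebra.subset_adjoin (Or.inl ?_)
    intro j hj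
    exact absurd hj (Nat.not_lt_zero _)
  | succ k ih =>
    rw [← top_le_iff, ← ih (by omega) fun j hj => hs j (by omega)]
    refine Algebra.adjoin_le ?_
    rintro f (hf | ⟨j, hj, rfl⟩)
    · let i : Fin d := ⟨k, by omega⟩
      obtain ⟨m, hm⟩ := hD.locallyNilpotent (b i) f
      have := mem_adjoin_of_slice (D (b i)) (killedBy D b k)
        (fun f hf => apply_mem_killedBy hb _ hf) (hs i (Nat.lt_succ_self k)).1
        (hs i (Nat.lt_succ_self k)).2 hf hm (hD.locallyNilpotent (b i))
      refine Algebra.adjoin_mono ?_ this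
      rintro g (hg | rfl)
      · exact Or.inl (mem_killedBy_succ (i := i) hg.1 hg.2)
      · exact Or.inr ⟨i, Nat.lt_succ_self k, rfl⟩
    · exact Algebra.subset_adjoin (Or.inr ⟨j, Nat.lt_succ_of_lt hj, rfl⟩)

/-- Otherwise the slices already found, with the functions killed by the earlier vectors, would
generate `A` and show that D(b i) is a combination over `A` of the earlier fields. Evaluation at `ε`
turns this into a linear relation between basis vectors. -/
theorem exists_apply_ne_zero (i : Fin d) (s : Fin d → A)
    (hs : ∀ j, j < i → s j ∈ killedBy D b j ∧ D (b j) (s j) = 1) :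
    ∃ f ∈ killedBy D b i, D (b i) f ≠ 0 := by
  by_contra! hcon
  -- The system is padded by identity columns with right-hand side zero for k ≥ i, so that it is
  -- square and unitriangular and its solution vanishes from index `i` on.
  obtain ⟨a, ha⟩ := exists_triangular_solution
    (Matrix.of fun j k : Fin d => if k < i then D (b j) (s k) else if j = k then 1 else 0)
    (fun k => by
      by_cases h : k < i
      · simp [h, (hs k h).2]
      · simp [h])
    (fun j k hjk => by
      by_cases h : k < i
      · simp [h, (hs k h).1 j hjk]
      · simp [h, hjk.ne])
    (fun k => if k < i then D (b i) (s k) else 0)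
  have ha0 : ∀ k, ¬ k < i → a k = 0 := by
    intro k hk
    have := congrFun ha k
    simpa [Matrix.vecMul, dotProduct, hk] using this
  have ha1 : ∀ k, k < i → ∑ j, a j * D (b j) (s k) = D (b i) (s k) := by
    intro k hk
    have := congrFun ha k
    simpa [Matrix.vecMul, dotProduct, hk] using this
  have happ : ∀ f, (∑ j, a j • D (b j)) f = ∑ j, a j * D (b j) f := by
    intro f
    exact sum_derivation_apply _ _ _
  have hder : D (b i) = ∑ j, a j • D (b j) := by
    refine Derivation.ext_of_adjoin_eq_top _
      (adjoin_killedBy_union_slices hb hD i i.2.le s fun j hj => hs j hj) ?_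
    rintro f (hf | ⟨k, hk, rfl⟩)
    · rw [happ, hcon f hf, Finset.sum_eq_zero]
      intro j _
      by_cases h : j < i
      · rw [hf j h, mul_zero]
      · rw [ha0 j h, zero_mul]
    · rw [happ, ha1 k hk]
  have hz := hD.eval_injective (b i - ∑ j, ε (a j) • b j) fun f => by
    have h1 : D (b i) f = ∑ j, a j * D (b j) f := by rw [hder, happ]
    rw [map_sub, map_sum, Derivation.sub_apply, map_sub, h1, sum_derivation_apply]
    simp
  have := congrArg (fun v => b.repr v i) (sub_eq_zero.1 hz)
  simp [Finsupp.single_apply, ha0 i (lt_irrefl i)] at this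

/-- For one basis vector after another, replace `f` by its image under the largest power that does
not kill D(b i) f. This commutes with D(b i) and finally makes D(b i) f a nonzero invariant, hence a
constant that can be scaled to 1. -/
theorem exists_slice_of_apply_ne_zero (i : Fin d) (h : ∃ f ∈ killedBy D b i, D (b i) f ≠ 0) :
    ∃ s ∈ killedBy D b i, D (b i) s = 1 := by
  have key : ∀ k ≤ d, ∃ f ∈ killedBy D b i, D (b i) f ≠ 0 ∧ D (b i) f ∈ killedBy D b k := by
    intro k
    induction k with
    | zero =>
      intro _
      obtain ⟨f, hf, h⟩ := h
      exact ⟨f, hf, h, fun j hj => absurd hj (Nat.not_lt_zero _)⟩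
    | succ k ih =>
      intro hk
      obtain ⟨f, hf, h0, hfk⟩ := ih (by omega)
      let l : Fin d := ⟨k, by omega⟩
      have hcomm : ∀ m : ℕ, D (b i) (((D (b l) : A →ₗ[ℂ] A) ^ m) f)
          = ((D (b l) : A →ₗ[ℂ] A) ^ m) (D (b i) f) := by
        intro m
        induction m with
        | zero => simp
        | succ m ihm =>
          rw [pow_succ', Module.End.mul_apply, Module.End.mul_apply, ← ihm]
          exact apply_comm_of_mem_killedBy hb i _ (iterate_mem_killedBy hb _ m hf)
      classical
      have hex := hD.locallyNilpotent (b l) (D (b i) f)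
      obtain ⟨m, hm, hm'⟩ : ∃ m, ((D (b l) : A →ₗ[ℂ] A) ^ (m + 1)) (D (b i) f) = 0 ∧
          ((D (b l) : A →ₗ[ℂ] A) ^ m) (D (b i) f) ≠ 0 := by
        cases hk : Nat.find hex with
        | zero =>
          have := Nat.find_spec hex
          rw [hk] at this
          exact absurd this (by simpa using h0)
        | succ m => exact ⟨m, hk ▸ Nat.find_spec hex, Nat.find_min hex (by omega)⟩
      refine ⟨((D (b l) : A →ₗ[ℂ] A) ^ m) f, iterate_mem_killedBy hb _ m hf, ?_, ?_⟩
      · rwa [hcomm]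
      · rw [hcomm]
        refine mem_killedBy_succ (i := l) (iterate_mem_killedBy hb _ m hfk) ?_
        rwa [pow_succ', Module.End.mul_apply] at hm
  obtain ⟨f, hf, h0, hfd⟩ := key d le_rfl
  obtain ⟨c, hc⟩ := hD.invariants (D (b i) f) fun x => by
    have h1 : ∀ j, D (b j) (D (b i) f) = 0 := fun j => hfd j j.2
    rw [apply_eq_sum_repr (b := b)]
    exact Finset.sum_eq_zero fun j _ => by simp [h1]
  have hc0 : c ≠ 0 := by
    rintro rfl
    exact h0 (by rw [hc, map_zero])
  refine ⟨c⁻¹ • f, Subalgebra.smul_mem _ hf _, ?_⟩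
  rw [Derivation.map_smul, hc, Algebra.smul_def, ← map_mul, inv_mul_cancel₀ hc0, map_one]

theorem exists_slice (i : Fin d) : ∃ s ∈ killedBy D b i, D (b i) s = 1 := by
  induction i using WellFoundedLT.induction with
  | ind i ih =>
    choose s hs using ih
    refine exists_slice_of_apply_ne_zero hb hD i
      (exists_apply_ne_zero hb hD i (fun j => if h : j < i then s j h else 0) fun j hj => ?_)
    simp only [hj, dif_pos]
    exact hs j hj

/-- Algebraic coordinates: generators `s` of the algebra with dual derivations `δ`, which are
combinations of the derivations that come from the Lie algebra. -/
theorem exists_coordinates : ∃ (s : Fin d → A) (C : Matrix (Fin d) (Fin d) A),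
    Algebra.adjoin ℂ (Set.range s) = ⊤ ∧ IsUnit C.det ∧ ∀ i j, D (b i) (s j) = C i j := by
  choose s hs hs1 using exists_slice hb hD
  refine ⟨s, Matrix.of fun i j => D (b i) (s j), ?_, ?_, fun _ _ => rfl⟩
  · have h := adjoin_killedBy_union_slices hb hD d le_rfl s fun j _ => ⟨hs j, hs1 j⟩
    rw [← top_le_iff, ← h]
    refine Algebra.adjoin_le ?_
    rintro f (hf | ⟨j, -, rfl⟩)
    · obtain ⟨c, rfl⟩ := hD.invariants f fun x => by
        have h1 : ∀ j, D (b j) f = 0 := fun j => hf j j.2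
        rw [apply_eq_sum_repr (b := b)]
        exact Finset.sum_eq_zero fun j _ => by simp [h1]
      exact Subalgebra.algebraMap_mem _ c
    · exact Algebra.subset_adjoin ⟨j, rfl⟩
  · rw [Matrix.det_of_isLowerTriangular (Matrix.of fun i j => D (b i) (s j)) fun i j h => hs j i h]
    simp [hs1]

/-- The algebraic Poincaré lemma in degree one, twisted by a character. -/
theorem exists_primitive (ψ : L →ₗ[ℂ] ℂ) (hψ : ∀ x y : L, ψ ⁅x, y⁆ = 0) (f : L →ₗ[ℂ] A)
    (hf : ∀ x y, D x (f y) + ψ x • f y - (D y (f x) + ψ y • f x) = f ⁅x, y⁆) :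
    ∃ h : A, ∀ x, D x h + ψ x • h = f x := by
  have key : ∀ k ≤ d, ∃ h : A, ∀ j : Fin d, j.val < k → D (b j) h + ψ (b j) • h = f (b j) := by
    intro k
    induction k with
    | zero => exact fun _ => ⟨0, fun j hj => absurd hj (Nat.not_lt_zero _)⟩
    | succ k ih =>
      intro hk
      obtain ⟨h, hh⟩ := ih (by omega)
      let i : Fin d := ⟨k, by omega⟩
      -- The error of the current approximation is again a cocycle, and it vanishes on the earlier
      -- basis vectors.
      let g : L →ₗ[ℂ] A :=
        { toFun := fun x => f x - (D x h + ψ x • h)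
          map_add' := fun x y => by simp only [map_add, Derivation.add_apply, add_smul]; abel
          map_smul' := fun c x => by
            simp only [map_smul, Derivation.smul_apply, smul_eq_mul, mul_smul, smul_sub, smul_add,
              RingHom.id_apply] }
      have hg : ∀ x y, D x (g y) + ψ x • g y - (D y (g x) + ψ y • g x) = g ⁅x, y⁆ := by
        intro x y
        simp only [g, LinearMap.coe_mk, AddHom.coe_mk, ← hf x y, hψ, zero_smul, add_zero,
          LieHom.map_lie, Derivation.commutator_apply, map_sub, map_add, Derivation.map_smul, smul_sub,
          smul_add, smul_comm (ψ y) (ψ x)]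
        abel
      have hg0 : ∀ z ∈ Submodule.span ℂ (b '' Set.Iio i), g z = 0 := by
        intro z hz
        have : Submodule.span ℂ (b '' Set.Iio i) ≤ LinearMap.ker g := by
          rw [Submodule.span_le]
          rintro _ ⟨j, hj, rfl⟩
          exact sub_eq_zero.2 (hh j hj).symm
        exact this hz
      -- Centrality of the basis kills the bracket term of the cocycle identity, so g(b i) is
      -- twisted-constant along earlier directions.
      have hgi : ∀ j, j < i → D (b j) (g (b i)) + ψ (b j) • g (b i) = 0 := by
        intro j hj
        have h1 := hg (b j) (b i)
        rwa [hg0 _ (hb i (b j)), hg0 (b j) (Submodule.subset_span ⟨j, hj, rfl⟩), map_zero,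
          smul_zero, add_zero, sub_zero] at h1
      suffices h2 : ∃ h', (∀ j, j < i → D (b j) h' + ψ (b j) • h' = 0) ∧
          D (b i) h' + ψ (b i) • h' = g (b i) by
        obtain ⟨h', h0, h1⟩ := h2
        refine ⟨h + h', fun j hj => ?_⟩
        rcases Nat.lt_succ_iff_lt_or_eq.1 hj with hj | hj
        · rw [map_add, smul_add, add_add_add_comm, hh j hj, h0 j hj, add_zero]
        · obtain rfl : j = i := Fin.ext hj
          rw [map_add, smul_add, add_add_add_comm, h1]
          simp [g]
      -- If some earlier twist is nonzero, D(b j) + ψ(b j) is injective and there is nothing to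
      -- correct. Otherwise the correction has to be found inside `killedBy D b i`.
      by_cases hz : ∃ j, j < i ∧ ψ (b j) ≠ 0
      · obtain ⟨j, hj, hj0⟩ := hz
        obtain ⟨m, hm⟩ := hD.locallyNilpotent (b j) (g (b i))
        have h0 := eq_zero_of_pow_eq_zero_of_smul _ hj0 hm (hgi j hj)
        exact ⟨0, by simp, by simp [h0]⟩
      · push Not at hz
        have hgB : g (b i) ∈ killedBy D b i := fun j hj => by
          have := hgi j hj
          rwa [hz j hj, zero_smul, add_zero] at this
        obtain ⟨m, hm⟩ := hD.locallyNilpotent (b i) (g (b i))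
        obtain ⟨h', hB, h1⟩ : ∃ h' ∈ killedBy D b i, D (b i) h' + ψ (b i) • h' = g (b i) := by
          by_cases hc : ψ (b i) = 0
          · obtain ⟨s, hs, hs1⟩ := exists_slice hb hD i
            obtain ⟨h', hB, h1⟩ := exists_preimage_of_slice (D (b i) : A →ₗ[ℂ] A)
              (fun a b => by simp [Derivation.leibniz, mul_comm, add_comm]) hs1
              (killedBy D b i).toSubmodule (fun g hg => apply_mem_killedBy hb _ hg)
              (fun g hg => (killedBy D b i).mul_mem hg hs) hgB hm
            exact ⟨h', hB, by rw [hc, zero_smul, add_zero]; exact h1⟩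
          · exact exists_preimage_add_smul (D (b i) : A →ₗ[ℂ] A) hc
              (killedBy D b i).toSubmodule (fun g hg => apply_mem_killedBy hb _ hg) hgB hm
        exact ⟨h', fun j hj => by rw [hB j hj, hz j hj, zero_smul, add_zero], h1⟩
  obtain ⟨h, hh⟩ := key d le_rfl
  refine ⟨h, fun x => ?_⟩
  have : ∀ x, (∑ i, b.repr x i • (D (b i) h + ψ (b i) • h)) = f x := by
    intro x
    rw [Finset.sum_congr rfl fun i _ => by rw [hh i i.2, ← map_smul], ← map_sum, b.sum_repr]
  rw [← this x]
  simp only [smul_add, Finset.sum_add_distrib]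
  congr 1
  · exact apply_eq_sum_repr x h
  · conv_lhs => rw [← b.sum_repr x, map_sum, Finset.sum_smul]
    simp [smul_smul]

end Coordinates

end InvDMod

namespace InvDMod

/-! ### Vector fields and one-forms in coordinates -/

section Coordinates

variable {A : Type*} [CommRing A] [Algebra ℂ A]

theorem lift_apply_D (v : Derivation ℂ A A) (f : A) :
    v.liftKaehlerDifferential (KaehlerDifferential.D ℂ A f) = v f :=
  Derivation.liftKaehlerDifferential_comp_D v f

theorem lift_add (v w : Derivation ℂ A A) (ω : Ω[A⁄ℂ]) :
    (v + w).liftKaehlerDifferential ω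
      = v.liftKaehlerDifferential ω + w.liftKaehlerDifferential ω :=
  congrArg (fun l => l ω) ((KaehlerDifferential.linearMapEquivDerivation ℂ A (M := A)).symm.map_add v w)

theorem lift_smul (a : A) (v : Derivation ℂ A A) (ω : Ω[A⁄ℂ]) :
    (a • v).liftKaehlerDifferential ω = a * v.liftKaehlerDifferential ω :=
  congrArg (fun l => l ω)
    ((KaehlerDifferential.linearMapEquivDerivation ℂ A (M := A)).symm.map_smul a v)

theorem lift_zero (ω : Ω[A⁄ℂ]) : (0 : Derivation ℂ A A).liftKaehlerDifferential ω = 0 :=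
  congrArg (fun l => l ω) ((KaehlerDifferential.linearMapEquivDerivation ℂ A (M := A)).symm.map_zero)

/-- Differentials of generators of the algebra span the differentials. -/
theorem exists_eq_sum_smul_D {d : ℕ} {s : Fin d → A} (hs : Algebra.adjoin ℂ (Set.range s) = ⊤)
    (ω : Ω[A⁄ℂ]) : ∃ a : Fin d → A, ω = ∑ i, a i • KaehlerDifferential.D ℂ A (s i) := by
  have hD : ∀ f : A, KaehlerDifferential.D ℂ A f ∈
      Submodule.span A (Set.range fun i => KaehlerDifferential.D ℂ A (s i)) := by
    intro f
    have hf : f ∈ Algebra.adjoin ℂ (Set.range s) := hs ▸ Algebra.mem_top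
    refine Algebra.adjoin_induction ?_ ?_ ?_ ?_ hf
    · rintro _ ⟨i, rfl⟩
      exact Submodule.subset_span ⟨i, rfl⟩
    · intro r
      rw [Derivation.map_algebraMap]
      exact Submodule.zero_mem _
    · intro x y _ _ hx hy
      rw [map_add]
      exact Submodule.add_mem _ hx hy
    · intro x y _ _ hx hy
      rw [Derivation.leibniz]
      exact Submodule.add_mem _ (Submodule.smul_mem _ _ hy) (Submodule.smul_mem _ _ hx)
  have hω : ω ∈ Submodule.span A (Set.range fun i => KaehlerDifferential.D ℂ A (s i)) := by
    have : (⊤ : Submodule A (Ω[A⁄ℂ])) ≤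
        Submodule.span A (Set.range fun i => KaehlerDifferential.D ℂ A (s i)) := by
      rw [← KaehlerDifferential.span_range_derivation, Submodule.span_le]
      rintro _ ⟨f, rfl⟩
      exact hD f
    exact this Submodule.mem_top
  obtain ⟨a, ha⟩ := (Submodule.mem_span_range_iff_exists_fun A).1 hω
  exact ⟨a, ha.symm⟩

variable {L : Type*} [LieRing L] [LieAlgebra ℂ L] [FiniteDimensional ℂ L] [LieRing.IsNilpotent L]
  {D : L →ₗ⁅ℂ⁆ Derivation ℂ A A} {ε : A →ₐ[ℂ] ℂ} (hD : IsUnipotentAction D ε)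
include hD

theorem IsUnipotentAction.exists_primitive (ψ : L →ₗ[ℂ] ℂ) (hψ : ∀ x y : L, ψ ⁅x, y⁆ = 0)
    (f : L →ₗ[ℂ] A)
    (hf : ∀ x y, D x (f y) + ψ x • f y - (D y (f x) + ψ y • f x) = f ⁅x, y⁆) :
    ∃ h : A, ∀ x, D x h + ψ x • h = f x := by
  obtain ⟨b, hb⟩ := exists_central_basis (L := L)
  exact InvDMod.exists_primitive hb hD ψ hψ f hf

/-- Generators of the algebra with dual derivations. -/
theorem IsUnipotentAction.exists_dual_derivations : ∃ (d : ℕ) (s : Fin d → A)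
    (δ : Fin d → Derivation ℂ A A), Algebra.adjoin ℂ (Set.range s) = ⊤ ∧
      (∀ i j, δ i (s j) = if i = j then 1 else 0) ∧
      ∀ i, δ i ∈ Submodule.span A (Set.range D) := by
  obtain ⟨b, hb⟩ := exists_central_basis (L := L)
  obtain ⟨s, C, hs, hC, hsC⟩ := exists_coordinates hb hD
  refine ⟨_, s, fun i => ∑ j, C⁻¹ i j • D (b j), hs, fun i k => ?_, fun i => ?_⟩
  · rw [sum_derivation_apply]
    simp only [Derivation.smul_apply, hsC, smul_eq_mul]
    rw [← Matrix.mul_apply, Matrix.nonsing_inv_mul _ hC, Matrix.one_apply]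
  · exact Submodule.sum_mem _ fun j _ => Submodule.smul_mem _ _ (Submodule.subset_span ⟨_, rfl⟩)

theorem IsUnipotentAction.mem_span (v : Derivation ℂ A A) :
    v ∈ Submodule.span A (Set.range D) := by
  obtain ⟨d, s, δ, hs, hδ, hδD⟩ := hD.exists_dual_derivations
  have : v = ∑ i, v (s i) • δ i := by
    refine Derivation.ext_of_adjoin_eq_top _ hs ?_
    rintro _ ⟨j, rfl⟩
    rw [sum_derivation_apply]
    simp [hδ]
  rw [this]
  exact Submodule.sum_mem _ fun j _ => Submodule.smul_mem _ _ (hδD j)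

/-- The dual derivations are combinations over `A` of the fields `D x`, and they read off the
coefficients of a form in the differentials of the coordinates. -/
theorem IsUnipotentAction.form_eq_zero (ω : Ω[A⁄ℂ])
    (hω : ∀ x, (D x).liftKaehlerDifferential ω = 0) : ω = 0 := by
  obtain ⟨d, s, δ, hs, hδ, hδD⟩ := hD.exists_dual_derivations
  obtain ⟨a, rfl⟩ := exists_eq_sum_smul_D hs ω
  have h0 : ∀ v ∈ Submodule.span A (Set.range D), v.liftKaehlerDifferential
      (∑ i, a i • KaehlerDifferential.D ℂ A (s i)) = 0 := by
    intro v hv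
    induction hv using Submodule.span_induction with
    | mem z hz => obtain ⟨x, rfl⟩ := hz; exact hω x
    | zero => exact lift_zero _
    | add x y _ _ hx hy => rw [lift_add, hx, hy, add_zero]
    | smul c x _ hx => rw [lift_smul, hx, mul_zero]
  refine Finset.sum_eq_zero fun i _ => ?_
  have := h0 _ (hδD i)
  rw [map_sum] at this
  simp only [map_smul, lift_apply_D, hδ, smul_eq_mul, mul_ite, mul_one, mul_zero,
    Finset.sum_ite_eq, Finset.mem_univ, if_true] at this
  rw [this, zero_smul]

theorem IsUnipotentAction.exists_form (φ : L →ₗ[ℂ] A) :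
    ∃ ω : Ω[A⁄ℂ], ∀ x, (D x).liftKaehlerDifferential ω = φ x := by
  obtain ⟨b, hb⟩ := exists_central_basis (L := L)
  obtain ⟨s, C, hs, hC, hsC⟩ := exists_coordinates hb hD
  let a := C⁻¹ *ᵥ fun j => φ (b j)
  let ω := ∑ i, a i • KaehlerDifferential.D ℂ A (s i)
  have hb' : ∀ j, (D (b j)).liftKaehlerDifferential ω = φ (b j) := by
    intro j
    have h1 : (C *ᵥ a) j = φ (b j) := by
      rw [Matrix.mulVec_mulVec, Matrix.mul_nonsing_inv _ hC, Matrix.one_mulVec]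
    rw [← h1, map_sum]
    simp only [map_smul, lift_apply_D, hsC, Matrix.mulVec, dotProduct, smul_eq_mul, mul_comm]
  let ev : L →ₗ[ℂ] A :=
    { toFun := fun x => (D x).liftKaehlerDifferential ω
      map_add' := fun x y => by rw [map_add, lift_add]
      map_smul' := fun c x => by
        rw [map_smul, ← algebraMap_smul A c (D x), lift_smul, RingHom.id_apply, Algebra.smul_def] }
  have h : ev = φ := b.ext hb'
  exact ⟨ω, fun x => congrArg (fun l => l x) h⟩

end Coordinates

/-! ### Generation of the algebra of differential operators -/

section DiffOpGeneration

variable {A : Type*} [CommRing A] [Algebra ℂ A]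

/-- The commutator with multiplication by `a`. -/
def comm (a : A) : Module.End ℂ A →ₗ[ℂ] Module.End ℂ A :=
  LinearMap.mulRight ℂ (mulOp a) - LinearMap.mulLeft ℂ (mulOp a)

theorem comm_apply (a : A) (P : Module.End ℂ A) : comm a P = P * mulOp a - mulOp a * P := rfl

theorem comm_mul (a : A) (P Q : Module.End ℂ A) :
    comm a (P * Q) = comm a P * Q + P * comm a Q := by
  simp only [comm_apply]
  noncomm_ring

theorem mulOp_mul (a b : A) : mulOp (a * b) = mulOp a * mulOp b := by
  ext x
  simp [mulOp]

theorem comm_mulOp (a b : A) : comm a (mulOp b) = 0 := by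
  rw [comm_apply, ← mulOp_mul, ← mulOp_mul, mul_comm, sub_self]

theorem comm_comm (a b : A) (P : Module.End ℂ A) : comm a (comm b P) = comm b (comm a P) := by
  have h : mulOp a * mulOp b = mulOp b * mulOp a := by rw [← mulOp_mul, ← mulOp_mul, mul_comm]
  simp only [comm_apply, sub_mul, mul_sub, mul_assoc, h]
  rw [← mul_assoc (mulOp b) (mulOp a), ← h, mul_assoc]
  abel

theorem comm_derivation (a : A) (v : Derivation ℂ A A) : comm a (v : A →ₗ[ℂ] A) = mulOp (v a) := by
  ext x
  simp [comm_apply, mulOp, mul_comm]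

theorem IsDiffOp.comm_iterate (a : A) {k : ℕ} {P : Module.End ℂ A} (hP : IsDiffOp k P) :
    ((comm a) ^ (k + 1)) P = 0 := by
  induction k generalizing P with
  | zero => simpa [comm_apply] using hP a
  | succ k ih => rw [pow_succ, Module.End.mul_apply]; exact ih (hP a)

theorem isDiffOp_derivation (v : Derivation ℂ A A) : IsDiffOp 1 (v : A →ₗ[ℂ] A) := by
  intro a
  rw [← comm_apply, comm_derivation]
  exact isDiffOp_mulOp _

theorem eq_mulOp_of_comm_eq_zero {s : Set A} (hs : Algebra.adjoin ℂ s = ⊤) {P : Module.End ℂ A}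
    (hP : ∀ a ∈ s, comm a P = 0) : P = mulOp (P 1) := by
  have h : ∀ a : A, ∀ x, P (a * x) = a * P x := by
    intro a
    have ha : a ∈ Algebra.adjoin ℂ s := hs ▸ Algebra.mem_top
    refine Algebra.adjoin_induction ?_ ?_ ?_ ?_ ha
    · intro a ha x
      have := congrArg (fun Q : Module.End ℂ A => Q x) (hP a ha)
      simpa [comm_apply, mulOp, sub_eq_zero] using this
    · intro r x
      rw [← Algebra.smul_def, ← Algebra.smul_def, map_smul]
    · intro a b _ _ ha hb x
      rw [add_mul, add_mul, map_add, ha, hb]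
    · intro a b _ _ ha hb x
      rw [mul_assoc, mul_assoc, ha, hb]
  ext x
  have := h x 1
  rw [mul_one] at this
  rw [this]
  simp [mulOp, mul_comm]

/-- Differential operators are generated by functions and derivations. -/
theorem IsDiffOp.mem_adjoin {d : ℕ} {s : Fin d → A} {δ : Fin d → Derivation ℂ A A}
    (hs : Algebra.adjoin ℂ (Set.range s) = ⊤) (hδ : ∀ i j, δ i (s j) = if i = j then 1 else 0)
    {k : ℕ} {P : Module.End ℂ A} (hP : IsDiffOp k P) :
    P ∈ Algebra.adjoin ℂ (Set.range (mulOp (A := A)) ∪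
      Set.range fun v : Derivation ℂ A A => (v : A →ₗ[ℂ] A)) := by
  set E := Algebra.adjoin ℂ (Set.range (mulOp (A := A)) ∪
      Set.range fun v : Derivation ℂ A A => (v : A →ₗ[ℂ] A)) with hE
  have hmul : ∀ a : A, mulOp a ∈ E := fun a => Algebra.subset_adjoin (Or.inl ⟨a, rfl⟩)
  have hder : ∀ v : Derivation ℂ A A, (v : A →ₗ[ℂ] A) ∈ E :=
    fun v => Algebra.subset_adjoin (Or.inr ⟨v, rfl⟩)
  have hEd : E ≤ diffOps A := by
    refine Algebra.adjoin_le ?_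
    rintro _ (⟨a, rfl⟩ | ⟨v, rfl⟩)
    · exact ⟨0, isDiffOp_mulOp a⟩
    · exact ⟨1, isDiffOp_derivation v⟩
  have hcomm : ∀ (a : A), ∀ Q ∈ E, comm a Q ∈ E := fun a Q hQ =>
    E.sub_mem (E.mul_mem hQ (hmul a)) (E.mul_mem (hmul a) hQ)
  have main : ∀ P : Module.End ℂ A, (∀ i, comm (s i) P ∈ E) → P ∈ E := by
    intro P hP
    -- The operators `comm (s j)` behave like commuting partial derivatives in the symbol variables.
    -- `P` is integrated one variable at a time, with dual derivations as slices, until only a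
    -- multiplication operator remains.
    have hJ : ∀ J : Finset (Fin d), ∃ Q ∈ E, ∀ j ∈ J, comm (s j) (P - Q) = 0 := by
      classical
      intro J
      induction J using Finset.induction_on with
      | empty => exact ⟨0, E.zero_mem, by simp⟩
      | insert i J hi ih =>
        obtain ⟨Q, hQ, hQJ⟩ := ih
        -- Integration inside `G` preserves the commutators that are already correct.
        let G : Submodule ℂ (Module.End ℂ A) :=
          E.toSubmodule ⊓ ⨅ j ∈ J, LinearMap.ker (comm (s j))
        have hG : ∀ g, g ∈ G ↔ g ∈ E ∧ ∀ j ∈ J, comm (s j) g = 0 := by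
          intro g
          simp [G]
        have hg : comm (s i) (P - Q) ∈ G := by
          rw [hG]
          refine ⟨?_, fun j hj => ?_⟩
          · rw [map_sub]
            exact E.sub_mem (hP i) (hcomm _ _ hQ)
          · rw [comm_comm, hQJ j hj, map_zero]
        obtain ⟨m, hm⟩ := hEd ((hG _).1 hg).1
        obtain ⟨h, hh, e⟩ := exists_preimage_of_slice (comm (s i)) (comm_mul (s i))
          (p := (δ i : A →ₗ[ℂ] A))
          (by rw [comm_derivation, hδ, if_pos rfl]; ext x; simp [mulOp]) G
          (fun g hg => (hG _).2 ⟨hcomm _ _ ((hG g).1 hg).1, fun j hj => by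
            rw [comm_comm, ((hG g).1 hg).2 j hj, map_zero]⟩)
          (fun g hg => (hG _).2 ⟨E.mul_mem ((hG g).1 hg).1 (hder _), fun j hj => by
            have hij : i ≠ j := by rintro rfl; exact hi hj
            rw [comm_mul, ((hG g).1 hg).2 j hj, comm_derivation, hδ, if_neg hij, zero_mul, zero_add]
            ext x
            simp [mulOp]⟩)
          hg (hm.comm_iterate (s i))
        refine ⟨Q + h, E.add_mem hQ ((hG h).1 hh).1, fun j hj => ?_⟩
        rw [← sub_sub, map_sub]
        rcases Finset.mem_insert.1 hj with rfl | hj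
        · rw [e, sub_self]
        · rw [hQJ j hj, ((hG h).1 hh).2 j hj, sub_self]
    obtain ⟨Q, hQ, h⟩ := hJ Finset.univ
    have := eq_mulOp_of_comm_eq_zero hs (P := P - Q)
      (by rintro _ ⟨j, rfl⟩; exact h j (Finset.mem_univ j))
    rw [← sub_add_cancel P Q, this]
    exact E.add_mem (hmul _) hQ
  induction k generalizing P with
  | zero => exact main P fun i => by rw [comm_apply, hP (s i)]; exact E.zero_mem
  | succ k ih => exact main P fun i => ih (hP (s i))

end DiffOpGeneration

end InvDMod

noncomputable section

namespace InvDMod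

/-! ### Exponentials of locally nilpotent derivations -/

section Exponential

variable {R : Type*} [Ring R] [Algebra ℂ R]

/-- The divided powers `δ ^ k / k!` of an operator. -/
def dividedPower (δ : R →ₗ[ℂ] R) (k : ℕ) : R →ₗ[ℂ] R := ((k.factorial : ℂ)⁻¹) • δ ^ k

theorem dividedPower_zero (δ : R →ₗ[ℂ] R) (a : R) : dividedPower δ 0 a = a := by
  simp [dividedPower]

theorem apply_dividedPower (δ : R →ₗ[ℂ] R) (k : ℕ) (a : R) :
    δ (dividedPower δ k a) = ((k : ℂ) + 1) • dividedPower δ (k + 1) a := by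
  have h : ((k : ℂ) + 1) ≠ 0 := Nat.cast_add_one_ne_zero k
  simp only [dividedPower, LinearMap.smul_apply, map_smul, smul_smul, Nat.factorial_succ,
    Nat.cast_mul, Nat.cast_succ, pow_succ', Module.End.mul_apply]
  congr 1
  field_simp

theorem dividedPower_mul (δ : R →ₗ[ℂ] R) (hδ : ∀ a b, δ (a * b) = δ a * b + a * δ b) (k : ℕ)
    (a b : R) : dividedPower δ k (a * b)
      = ∑ p ∈ Finset.HasAntidiagonal.antidiagonal k, dividedPower δ p.1 a * dividedPower δ p.2 b := by
  induction k with
  | zero => simp [dividedPower_zero]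
  | succ k ih =>
    have h : ((k : ℂ) + 1) ≠ 0 := Nat.cast_add_one_ne_zero k
    -- The factor `k + 1` is split as p.1 + p.2; the two sums then match the two terms of the
    -- Leibniz rule.
    have h1 : ((k : ℂ) + 1) • ∑ p ∈ Finset.HasAntidiagonal.antidiagonal (k + 1),
        dividedPower δ p.1 a * dividedPower δ p.2 b
        = ∑ p ∈ Finset.HasAntidiagonal.antidiagonal (k + 1),
            (p.1 : ℂ) • (dividedPower δ p.1 a * dividedPower δ p.2 b)
          + ∑ p ∈ Finset.HasAntidiagonal.antidiagonal (k + 1),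
            (p.2 : ℂ) • (dividedPower δ p.1 a * dividedPower δ p.2 b) := by
      rw [Finset.smul_sum, ← Finset.sum_add_distrib]
      refine Finset.sum_congr rfl fun p hp => ?_
      rw [← add_smul, ← Nat.cast_add, Finset.HasAntidiagonal.mem_antidiagonal.1 hp, Nat.cast_succ]
    apply smul_right_injective R h
    dsimp only
    rw [← apply_dividedPower, ih, h1, Finset.Nat.antidiagonal_succ, Finset.sum_cons,
      ← Finset.Nat.antidiagonal_succ, Finset.Nat.antidiagonal_succ', Finset.sum_cons]
    simp only [map_sum, hδ, apply_dividedPower, Finset.sum_add_distrib, Finset.sum_map,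
      Function.Embedding.prodMap, Function.Embedding.coeFn_mk, Prod.map_fst, Prod.map_snd,
      smul_mul_assoc, mul_smul_comm, Nat.cast_zero, zero_smul, zero_add,
      Function.Embedding.refl_apply, Nat.cast_succ, Nat.succ_eq_add_one]

variable (δ : R →ₗ[ℂ] R) (hnil : ∀ a, ∃ m : ℕ, (δ ^ m) a = 0)

theorem dividedPower_eq_zero {δ : R →ₗ[ℂ] R} {m k : ℕ} {a : R} (h : (δ ^ m) a = 0) (hk : m ≤ k) :
    dividedPower δ k a = 0 := by
  rw [dividedPower, LinearMap.smul_apply, ← Nat.sub_add_cancel hk, pow_add, Module.End.mul_apply,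
    h, map_zero, smul_zero]

open Classical in
/-- The polynomial `exp (t δ) a` in `t`. -/
def expPoly (a : R) : Polynomial R :=
  ∑ k ∈ Finset.range (Nat.find (hnil a)), Polynomial.monomial k (dividedPower δ k a)

theorem coeff_expPoly (a : R) (k : ℕ) : (expPoly δ hnil a).coeff k = dividedPower δ k a := by
  classical
  simp only [expPoly, Polynomial.finsetSum_coeff, Polynomial.coeff_monomial, Finset.sum_ite_eq',
    Finset.mem_range]
  split_ifs with h
  · rfl
  · exact (dividedPower_eq_zero (Nat.find_spec (hnil a)) (not_lt.1 h)).symm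

/-- The exponential of a locally nilpotent derivation is an automorphism. -/
def expDerivation (hδ : ∀ a b, δ (a * b) = δ a * b + a * δ b) : R →ₐ[ℂ] R :=
  AlgHom.ofLinearMap
    { toFun := fun a => (expPoly δ hnil a).eval 1
      map_add' := fun a b => by
        have : expPoly δ hnil (a + b) = expPoly δ hnil a + expPoly δ hnil b := by
          ext k; simp [coeff_expPoly]
        rw [this, Polynomial.eval_add]
      map_smul' := fun c a => by
        have : expPoly δ hnil (c • a) = c • expPoly δ hnil a := by
          ext k; simp [coeff_expPoly]
        rw [this, Polynomial.eval_smul, RingHom.id_apply] }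
    (by
      have h1 : δ 1 = 0 := by simpa using hδ 1 1
      have : expPoly δ hnil 1 = 1 := by
        ext k
        rw [coeff_expPoly, Polynomial.coeff_one]
        cases k with
        | zero => simp [dividedPower_zero]
        | succ k =>
          rw [dividedPower_eq_zero (m := 1) (by simpa using h1) (by omega), if_neg (by omega)]
      simp [this])
    (fun a b => by
      have : expPoly δ hnil (a * b) = expPoly δ hnil a * expPoly δ hnil b := by
        ext k
        simp only [coeff_expPoly, Polynomial.coeff_mul, dividedPower_mul δ hδ]
      simp only [LinearMap.coe_mk, AddHom.coe_mk, this]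
      -- Evaluation is multiplicative over the noncommutative `R` because it takes place at the
      -- central element 1.
      exact Polynomial.eval₂_mul_noncomm _ _ fun k => Commute.one_right _)

theorem expDerivation_eq_sum (hδ : ∀ a b, δ (a * b) = δ a * b + a * δ b) {m : ℕ} {a : R}
    (h : (δ ^ m) a = 0) :
    expDerivation δ hnil hδ a = ∑ k ∈ Finset.range m, dividedPower δ k a := by
  have : expPoly δ hnil a = ∑ k ∈ Finset.range m, Polynomial.monomial k (dividedPower δ k a) := by
    ext k
    simp only [coeff_expPoly, Polynomial.finsetSum_coeff, Polynomial.coeff_monomial,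
      Finset.sum_ite_eq', Finset.mem_range]
    split_ifs with hk
    · rfl
    · exact dividedPower_eq_zero h (not_lt.1 hk)
  change (expPoly δ hnil a).eval 1 = _
  rw [this, Polynomial.eval_finsetSum]
  simp

end Exponential

/-! ### Rank one modules and intertwiners -/

section Twist

variable {A : Type*} [CommRing A] [Algebra ℂ A]

/-- The commutator with multiplication by `a` on differential operators. -/
def commOp (a : A) : diffOps A →ₗ[ℂ] diffOps A :=
  LinearMap.mulRight ℂ (opOfFun a) - LinearMap.mulLeft ℂ (opOfFun a)

theorem commOp_coe (a : A) (P : diffOps A) : (commOp a P : Module.End ℂ A) = comm a P := rfl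

theorem commOp_mul (a : A) (P Q : diffOps A) :
    commOp a (P * Q) = commOp a P * Q + P * commOp a Q :=
  Subtype.ext (comm_mul a P.1 Q.1)

theorem commOp_pow_coe (a : A) (k : ℕ) (P : diffOps A) :
    (((commOp a) ^ k) P : Module.End ℂ A) = ((comm a) ^ k) P := by
  induction k with
  | zero => simp
  | succ k ih => rw [pow_succ', pow_succ', Module.End.mul_apply, Module.End.mul_apply, commOp_coe, ih]

theorem commOp_nilpotent (a : A) (P : diffOps A) : ∃ m : ℕ, ((commOp a) ^ m) P = 0 := by
  obtain ⟨k, hk⟩ := P.2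
  refine ⟨k + 1, Subtype.ext ?_⟩
  rw [commOp_pow_coe]
  exact hk.comm_iterate a

/-- The automorphism `P ↦ exp (-a) ∘ P ∘ exp a` of the algebra of differential operators. -/
def twist (a : A) : diffOps A →ₐ[ℂ] diffOps A :=
  expDerivation (commOp a) (commOp_nilpotent a) (commOp_mul a)

theorem commOp_opOfFun (a f : A) : commOp a (opOfFun f) = 0 := Subtype.ext (comm_mulOp a f)

theorem commOp_opOfDer (a : A) (v : Derivation ℂ A A) : commOp a (opOfDer v) = opOfFun (v a) :=
  Subtype.ext (comm_derivation a v)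

theorem twist_opOfFun (a f : A) : twist a (opOfFun f) = opOfFun f := by
  rw [twist, expDerivation_eq_sum (m := 1) _ _ _ (by simp [commOp_opOfFun])]
  simp [dividedPower_zero]

theorem twist_opOfDer (a : A) (v : Derivation ℂ A A) :
    twist a (opOfDer v) = opOfDer v + opOfFun (v a) := by
  rw [twist, expDerivation_eq_sum (m := 2) _ _ _
    (by rw [pow_two, Module.End.mul_apply, commOp_opOfDer, commOp_opOfFun])]
  simp [Finset.sum_range_succ, dividedPower, commOp_opOfDer]

/-- The direct sum of the rank one modules obtained by twisting the regular functions. -/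
def diagonalAct {n : ℕ} (l : Fin n → A) : diffOps A →ₐ[ℂ] Module.End ℂ (Fin n → A) :=
  AlgHom.ofLinearMap
    { toFun := fun P =>
        { toFun := fun m i => (twist (l i) P : Module.End ℂ A) (m i)
          map_add' := fun m m' => by ext i; simp
          map_smul' := fun c m => by ext i; simp }
      map_add' := fun P Q => by ext m i; simp
      map_smul' := fun c P => by ext m i; simp }
    (by ext m i; simp)
    (fun P Q => by ext m i; simp)

theorem diagonalAct_apply {n : ℕ} (l : Fin n → A) (P : diffOps A) (m : Fin n → A) (i : Fin n) :
    diagonalAct l P m i = (twist (l i) P : Module.End ℂ A) (m i) := rfl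

end Twist

section Intertwining

variable {A : Type*} [CommRing A] [Algebra ℂ A]
variable {L : Type*} [LieRing L] [LieAlgebra ℂ L] [FiniteDimensional ℂ L] [LieRing.IsNilpotent L]
  {D : L →ₗ⁅ℂ⁆ Derivation ℂ A A} {ε : A →ₐ[ℂ] ℂ}

theorem opOfDer_add (v w : Derivation ℂ A A) : opOfDer (v + w) = opOfDer v + opOfDer w :=
  Subtype.ext rfl

theorem opOfDer_smul (a : A) (v : Derivation ℂ A A) :
    opOfDer (a • v) = opOfFun a * opOfDer v :=
  Subtype.ext rfl

theorem opOfDer_zero : opOfDer (0 : Derivation ℂ A A) = 0 :=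
  Subtype.ext rfl

/-- A linear map that commutes with functions and with the Lie algebra commutes with all
differential operators. -/
theorem IsUnipotentAction.intertwines (hD : IsUnipotentAction D ε) {V W : Type*} [AddCommGroup V]
    [Module ℂ V] [AddCommGroup W] [Module ℂ W] (act₁ : diffOps A →ₐ[ℂ] Module.End ℂ V)
    (act₂ : diffOps A →ₐ[ℂ] Module.End ℂ W) (Φ : V →ₗ[ℂ] W)
    (hf : ∀ f m, Φ (act₁ (opOfFun f) m) = act₂ (opOfFun f) (Φ m))
    (hx : ∀ x m, Φ (act₁ (opOfDer (D x)) m) = act₂ (opOfDer (D x)) (Φ m)) (P : diffOps A) (m : V) :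
    Φ (act₁ P m) = act₂ P (Φ m) := by
  let S : Subalgebra ℂ (diffOps A) :=
    { carrier := {P | ∀ m, Φ (act₁ P m) = act₂ P (Φ m)}
      mul_mem' := fun {P Q} hP hQ m => by
        rw [map_mul, map_mul, Module.End.mul_apply, Module.End.mul_apply, hP, hQ]
      add_mem' := fun {P Q} hP hQ m => by
        rw [map_add, map_add, LinearMap.add_apply, LinearMap.add_apply, map_add, hP, hQ]
      algebraMap_mem' := fun c m => by
        rw [AlgHom.commutes, AlgHom.commutes, Module.algebraMap_end_apply,
          Module.algebraMap_end_apply, map_smul] }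
  have hder : ∀ v : Derivation ℂ A A, opOfDer v ∈ S := by
    intro v
    induction hD.mem_span v using Submodule.span_induction with
    | mem z hz => obtain ⟨x, rfl⟩ := hz; exact hx x
    | zero => rw [opOfDer_zero]; exact S.zero_mem
    | add x y _ _ hx hy => rw [opOfDer_add]; exact S.add_mem hx hy
    | smul c x _ hx => rw [opOfDer_smul]; exact S.mul_mem (hf c) hx
  obtain ⟨d, s, δ, hs, hδ, -⟩ := hD.exists_dual_derivations
  -- Generation was shown inside the endomorphisms of `A`, so `S` is pushed forward there.
  have hP : P.1 ∈ S.map (diffOps A).val := by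
    obtain ⟨k, hk⟩ := P.2
    refine Algebra.adjoin_le ?_ (hk.mem_adjoin hs hδ)
    rintro _ (⟨f, rfl⟩ | ⟨v, rfl⟩)
    · exact ⟨opOfFun f, hf f, rfl⟩
    · exact ⟨opOfDer v, hder v, rfl⟩
  obtain ⟨Q, hQ, e⟩ := hP
  obtain rfl : Q = P := Subtype.ext e
  exact hQ m

end Intertwining

end InvDMod

end

noncomputable section

namespace InvDMod

/-! ### Gauge transformations to diagonal form -/

section Gauge

variable {A : Type*} [CommRing A] [Algebra ℂ A] {n : ℕ}

theorem derivation_mulVec (v : Derivation ℂ A A) (H : Matrix (Fin n) (Fin n) A) (m : Fin n → A) :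
    v ∘ (H *ᵥ m) = H.map v *ᵥ m + H *ᵥ (v ∘ m) := by
  ext i
  simp only [Function.comp_apply, Matrix.mulVec, dotProduct, map_sum, Derivation.leibniz,
    smul_eq_mul, Finset.sum_add_distrib, Pi.add_apply, Matrix.map_apply]
  rw [add_comm]
  congr 1
  exact Finset.sum_congr rfl fun j _ => mul_comm _ _

theorem derivation_matrix_mul (v : Derivation ℂ A A) (H K : Matrix (Fin n) (Fin n) A) :
    (H * K).map v = H.map v * K + H * K.map v := by
  ext i j
  simp only [Matrix.map_apply, Matrix.mul_apply, map_sum, Derivation.leibniz,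
    smul_eq_mul, Finset.sum_add_distrib, Matrix.add_apply]
  rw [add_comm]
  congr 1
  exact Finset.sum_congr rfl fun j _ => mul_comm _ _

theorem derivation_const (v : Derivation ℂ A A) (M : Matrix (Fin n) (Fin n) ℂ) :
    (M.map (algebraMap ℂ A)).map v = 0 := by
  ext i j
  simp

variable {L : Type*} [LieRing L] [LieAlgebra ℂ L] (D : L →ₗ⁅ℂ⁆ Derivation ℂ A A)

/-- The action of the Lie algebra on the free module with connection matrix `ρ`. -/
def nabla (ρ : Rep L n) (x : L) (m : Fin n → A) : Fin n → A :=
  D x ∘ m + (ρ x).map (algebraMap ℂ A) *ᵥ m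

theorem nabla_lie (ρ : Rep L n) (x y : L) (m : Fin n → A) :
    nabla D ρ x (nabla D ρ y m) - nabla D ρ y (nabla D ρ x m) = nabla D ρ ⁅x, y⁆ m := by
  have h1 : (ρ ⁅x, y⁆).map (algebraMap ℂ A)
      = (ρ x).map (algebraMap ℂ A) * (ρ y).map (algebraMap ℂ A)
        - (ρ y).map (algebraMap ℂ A) * (ρ x).map (algebraMap ℂ A) := by
    rw [LieHom.map_lie, Ring.lie_def, ← Matrix.map_mul, ← Matrix.map_mul,
      Matrix.map_sub _ (map_sub _)]
  have h2 : ∀ (v : Derivation ℂ A A) (a b : Fin n → A), v ∘ (a + b) = v ∘ a + v ∘ b := by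
    intro v a b
    ext i
    simp
  have h3 : D ⁅x, y⁆ ∘ m = D x ∘ D y ∘ m - D y ∘ D x ∘ m := by
    ext i
    simp [LieHom.map_lie, Derivation.commutator_apply]
  simp only [nabla, h1, h2, h3, derivation_mulVec, derivation_const, Matrix.mulVec_add,
    Matrix.sub_mulVec, Matrix.zero_mulVec, zero_add, Matrix.mulVec_mulVec]
  abel

theorem nabla_add_left (ρ : Rep L n) (x y : L) (m : Fin n → A) :
    nabla D ρ (x + y) m = nabla D ρ x m + nabla D ρ y m := by
  ext i
  simp only [nabla, Pi.add_apply, Function.comp_apply, map_add, Derivation.add_apply,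
    Matrix.map_add _ (map_add (algebraMap ℂ A)), Matrix.add_mulVec]
  abel

theorem nabla_smul_left (ρ : Rep L n) (c : ℂ) (x : L) (m : Fin n → A) :
    nabla D ρ (c • x) m = c • nabla D ρ x m := by
  have h : (ρ (c • x)).map (algebraMap ℂ A) = c • (ρ x).map (algebraMap ℂ A) := by
    ext i j
    rw [map_smul, Matrix.map_apply, Matrix.smul_apply, smul_eq_mul, map_mul, Matrix.smul_apply,
      Matrix.map_apply, Algebra.smul_def]
  rw [nabla, nabla, h, Matrix.smul_mulVec, smul_add, map_smul]
  rfl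

/-- A representation is upper triangular. -/
def IsTriangular (T : Rep L n) : Prop := ∀ x i j, j < i → T x i j = 0

/-- The diagonal entries of a representation. -/
def diagEntry (T : Rep L n) (i : Fin n) : L →ₗ[ℂ] ℂ where
  toFun x := T x i i
  map_add' x y := by rw [map_add, Matrix.add_apply]
  map_smul' c x := by rw [map_smul, Matrix.smul_apply, RingHom.id_apply]

theorem triangular_mul_apply_diag {M N : Matrix (Fin n) (Fin n) ℂ} (hM : ∀ i j, j < i → M i j = 0)
    (hN : ∀ i j, j < i → N i j = 0) (i : Fin n) : (M * N) i i = M i i * N i i := by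
  rw [Matrix.mul_apply]
  refine Finset.sum_eq_single i (fun j _ hj => ?_) (by simp)
  rcases lt_or_gt_of_ne hj with h | h
  · rw [hM i j h, zero_mul]
  · rw [hN j i h, mul_zero]

theorem IsTriangular.diagEntry_lie {T : Rep L n} (hT : IsTriangular T) (i : Fin n) (x y : L) :
    diagEntry T i ⁅x, y⁆ = 0 := by
  change T ⁅x, y⁆ i i = 0
  rw [LieHom.map_lie, Ring.lie_def, Matrix.sub_apply, triangular_mul_apply_diag (hT x) (hT y),
    triangular_mul_apply_diag (hT y) (hT x), mul_comm, sub_self]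

/-- Tensor product of a representation with a character. -/
def twistRep (T : Rep L n) (χ : L →ₗ[ℂ] ℂ) (hχ : ∀ x y : L, χ ⁅x, y⁆ = 0) : Rep L n where
  toFun x := T x - χ x • (1 : Matrix (Fin n) (Fin n) ℂ)
  map_add' x y := by rw [map_add, map_add, add_smul]; abel
  map_smul' c x := by simp [smul_sub, mul_smul]
  map_lie' := fun {x y} => by
    simp only [hχ, zero_smul, sub_zero, LieHom.map_lie, Ring.lie_def, sub_mul, mul_sub, smul_sub,
      smul_mul_assoc, one_mul, mul_smul_comm, mul_one, smul_comm (χ y) (χ x)]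
    abel

variable {D}
variable [FiniteDimensional ℂ L] [LieRing.IsNilpotent L] {ε : A →ₐ[ℂ] ℂ}

/-- After twisting by the inverse of the `j`-th character a horizontal vector is needed. Its entries
are found from row `j` upwards: each row is a twisted Poincaré problem, whose right-hand side is
closed because the connection is flat. -/
theorem IsUnipotentAction.exists_horizontal (hD : IsUnipotentAction D ε) {T : Rep L n}
    (hT : IsTriangular T) (j : Fin n) :
    ∃ h : Fin n → A, h j = 1 ∧ (∀ k, j < k → h k = 0) ∧
      ∀ x, nabla D T x h = diagEntry T j x • h := by
  let S := twistRep T (diagEntry T j) (hT.diagEntry_lie j)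
  have hSn : ∀ x h, nabla D S x h = nabla D T x h - diagEntry T j x • h := by
    intro x h
    have : (S x).map (algebraMap ℂ A) = (T x).map (algebraMap ℂ A)
        - algebraMap ℂ A (diagEntry T j x) • (1 : Matrix (Fin n) (Fin n) A) := by
      ext i k
      by_cases hik : i = k <;> simp [S, twistRep, hik, Algebra.algebraMap_eq_smul_one, sub_smul]
    rw [nabla, nabla, this, Matrix.sub_mulVec, Matrix.smul_mulVec, Matrix.one_mulVec,
      algebraMap_smul, add_sub_assoc]
  -- The bound says that the rows from j - m on are solved; it is written additively to avoid
  -- truncated subtraction.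
  have key : ∀ m : ℕ, ∃ h : Fin n → A, h j = 1 ∧ (∀ k, j < k → h k = 0) ∧
      ∀ x, ∀ i : Fin n, j.val ≤ i.val + m → nabla D S x h i = 0 := by
    intro m
    induction m with
    | zero =>
      refine ⟨Pi.single j 1, by simp, fun k hk => Pi.single_eq_of_ne hk.ne' 1, fun x i hi => ?_⟩
      have h1 : (D x) (Pi.single (M := fun _ => A) j 1 i) = 0 := by
        by_cases hij : i = j
        · subst hij; simp
        · simp [hij]
      have h2 : S x i j = 0 := by
        rcases (show j ≤ i from hi).eq_or_lt with h | h
        · subst h; simp [S, twistRep, diagEntry]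
        · simp [S, twistRep, hT x i j h, h.ne']
      simp [nabla, h1, h2]
    | succ m ih =>
      obtain ⟨h, hj, hk, hrow⟩ := ih
      by_cases hm : j.val < m + 1
      · exact ⟨h, hj, hk, fun x i _ => hrow x i (by omega)⟩
      let i : Fin n := ⟨j.val - (m + 1), by omega⟩
      have hi : i.val + (m + 1) = j.val := by simp only [i]; omega
      let f : L →ₗ[ℂ] A :=
        { toFun := fun x => -nabla D S x h i
          map_add' := fun x y => by rw [nabla_add_left, Pi.add_apply, neg_add]
          map_smul' := fun c x => by
            rw [nabla_smul_left, Pi.smul_apply, smul_neg, RingHom.id_apply] }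
      have hSi : ∀ x (w : Fin n → A), (∀ k, i < k → w k = 0) →
          nabla D S x w i = D x (w i) + diagEntry S i x • w i := by
        intro x w hw
        simp only [nabla, Pi.add_apply, Function.comp_apply]
        congr 1
        rw [Matrix.mulVec, dotProduct, Finset.sum_eq_single i]
        · rw [Algebra.smul_def]; rfl
        · intro k _ hki
          rcases lt_or_gt_of_ne hki with h | h
          · simp [S, twistRep, hT x i k h, h.ne']
          · rw [hw k h, mul_zero]
        · simp
      have hSlie : ∀ x y : L, diagEntry S i ⁅x, y⁆ = 0 := by
        intro x y
        have : diagEntry S i ⁅x, y⁆ = diagEntry T i ⁅x, y⁆ - diagEntry T j ⁅x, y⁆ := by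
          simp [diagEntry, S, twistRep]
        rw [this, hT.diagEntry_lie, hT.diagEntry_lie, sub_zero]
      have hrow' : ∀ x k, i < k → nabla D S x h k = 0 := fun x k hik =>
        hrow x k (by have : i.val < k.val := hik; omega)
      -- The cocycle condition is row `i` of `nabla_lie`: the lower rows of the derivative vanish,
      -- so only the diagonal entry contributes.
      obtain ⟨r, hr⟩ := hD.exists_primitive (diagEntry S i) hSlie f (fun x y => by
        have h1 := congrFun (nabla_lie D S x y h) i
        rw [Pi.sub_apply, hSi x _ (hrow' y), hSi y _ (hrow' x)] at h1
        simp only [f, LinearMap.coe_mk, AddHom.coe_mk, map_neg, smul_neg, ← h1]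
        abel)
      have hji : j ≠ i := by
        intro h
        rw [← h] at hi
        omega
      refine ⟨h + Pi.single i r, ?_, ?_, ?_⟩
      · simp [hj, hji]
      · intro k hjk
        have hki : k ≠ i := by
          rintro rfl
          have : j.val < i.val := hjk
          omega
        simp [hk k hjk, hki]
      · intro x k hk
        have hadd : nabla D S x (h + Pi.single i r)
            = nabla D S x h + nabla D S x (Pi.single i r) := by
          ext l
          simp only [nabla, Pi.add_apply, Function.comp_apply, map_add, Matrix.mulVec_add]
          abel
        rw [hadd, Pi.add_apply]
        have hik : i.val ≤ k.val := by omega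
        rcases (show i ≤ k from hik).eq_or_lt with h0 | h0
        · subst h0
          rw [hSi x (Pi.single i r) (fun l hl => by simp [hl.ne']), Pi.single_eq_same,
            hr x]
          simp [f]
        · rw [hrow' x k h0, zero_add]
          simp only [nabla, Pi.add_apply, Function.comp_apply, Pi.single_eq_of_ne h0.ne', map_zero,
            zero_add, Matrix.mulVec_single, Pi.smul_apply, Matrix.col_apply, Matrix.map_apply]
          simp [S, twistRep, hT x k i h0, h0.ne']
  obtain ⟨h, hj, hk, hrow⟩ := key n
  refine ⟨h, hj, hk, fun x => sub_eq_zero.1 ?_⟩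
  rw [← hSn]
  ext i
  exact hrow x i (by omega)

/-- The connection of a triangular representation is gauge equivalent to its diagonal part. -/
theorem IsUnipotentAction.exists_gauge_triangular (hD : IsUnipotentAction D ε) {T : Rep L n}
    (hT : IsTriangular T) : ∃ H : Matrix (Fin n) (Fin n) A, IsUnit H.det ∧ ∀ x,
      H.map (D x) + (T x).map (algebraMap ℂ A) * H
        = H * Matrix.diagonal fun i => algebraMap ℂ A (diagEntry T i x) := by
  choose h h1 h0 hh using hD.exists_horizontal hT
  refine ⟨Matrix.of fun i j => h j i, ?_, fun x => ?_⟩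
  · rw [Matrix.det_of_isUpperTriangular (M := Matrix.of fun i j => h j i) fun i j hij => h0 j i hij]
    simp [h1]
  · ext i j
    have := congrFun (hh j x) i
    rw [Matrix.mul_diagonal, Matrix.of_apply, mul_comm, ← Algebra.smul_def]
    exact this

theorem IsUnipotentAction.exists_gauge (hD : IsUnipotentAction D ε) {ρ T : Rep L n}
    (hT : IsTriangular T) (P : GL (Fin n) ℂ) (hP : ∀ x, T x = (P⁻¹).val * ρ x * P.val) :
    ∃ H : GL (Fin n) A, ∀ x,
      H.val.map (D x) + (ρ x).map (algebraMap ℂ A) * H.val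
        = H.val * Matrix.diagonal fun i => algebraMap ℂ A (diagEntry T i x) := by
  obtain ⟨H, hH, h⟩ := hD.exists_gauge_triangular hT
  obtain ⟨H, rfl⟩ := (Matrix.isUnit_iff_isUnit_det H).2 hH
  refine ⟨Units.map (algebraMap ℂ A).mapMatrix.toMonoidHom P * H, fun x => ?_⟩
  have e : (Units.map (algebraMap ℂ A).mapMatrix.toMonoidHom P * H).val
      = P.val.map (algebraMap ℂ A) * H.val := rfl
  have hρ : (ρ x).map (algebraMap ℂ A) * P.val.map (algebraMap ℂ A)
      = P.val.map (algebraMap ℂ A) * (T x).map (algebraMap ℂ A) := by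
    rw [← Matrix.map_mul, ← Matrix.map_mul, hP, ← mul_assoc, ← mul_assoc, Units.mul_inv, one_mul]
  rw [e, derivation_matrix_mul, derivation_const, zero_mul, zero_add, ← mul_assoc, hρ, mul_assoc,
    ← mul_add, h, mul_assoc]

/-- The module over differential operators with connection matrix `ρ`. -/
theorem IsUnipotentAction.exists_act (hD : IsUnipotentAction D ε) (ρ : Rep L n) :
    ∃ act : diffOps A →ₐ[ℂ] Module.End ℂ (Fin n → A),
      (∀ f m, act (opOfFun f) m = f • m) ∧ ∀ x m, act (opOfDer (D x)) m = nabla D ρ x m := by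
  obtain ⟨P, T, hP, hT⟩ := exists_conj_triangular ρ
  obtain ⟨H, hH⟩ := hD.exists_gauge hT P hP
  -- A primitive of each diagonal character. Twisting by it realizes the diagonal connection on all
  -- differential operators, and `H` transports that action to `ρ`.
  have hl : ∀ i, ∃ l : A, ∀ x, D x l = algebraMap ℂ A (diagEntry T i x) := by
    intro i
    obtain ⟨l, hl⟩ := hD.exists_primitive 0 (by simp)
      ((Algebra.linearMap ℂ A).comp (diagEntry T i)) (fun x y => by
        simp [IsTriangular.diagEntry_lie hT])
    exact ⟨l, fun x => by simpa using hl x⟩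
  choose l hl using hl
  let E : (Fin n → A) ≃ₗ[ℂ] (Fin n → A) :=
    { toFun := fun m => H.val *ᵥ m
      invFun := fun m => (H⁻¹).val *ᵥ m
      map_add' := fun m m' => Matrix.mulVec_add _ _ _
      map_smul' := fun c m => Matrix.mulVec_smul _ _ _
      left_inv := fun m => by simp only [Matrix.mulVec_mulVec, Units.inv_mul, Matrix.one_mulVec]
      right_inv := fun m => by simp only [Matrix.mulVec_mulVec, Units.mul_inv, Matrix.one_mulVec] }
  refine ⟨(LinearEquiv.conjAlgEquiv ℂ E).toAlgHom.comp (diagonalAct l), fun f m => ?_,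
    fun x m => ?_⟩
  · change E (diagonalAct l (opOfFun f) (E.symm m)) = f • m
    have : diagonalAct l (opOfFun f) (E.symm m) = f • E.symm m := by
      ext i
      rw [diagonalAct_apply, twist_opOfFun]
      rfl
    rw [this]
    change H.val *ᵥ (f • E.symm m) = f • m
    rw [Matrix.mulVec_smul]
    exact congrArg (f • ·) (E.apply_symm_apply m)
  · obtain ⟨u, rfl⟩ := E.surjective m
    change E (diagonalAct l (opOfDer (D x)) (E.symm (E u))) = nabla D ρ x (H.val *ᵥ u)
    have h1 : diagonalAct l (opOfDer (D x)) u
        = D x ∘ u + (Matrix.diagonal fun i => algebraMap ℂ A (diagEntry T i x)) *ᵥ u := by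
      ext i
      rw [diagonalAct_apply, twist_opOfDer, Pi.add_apply, Matrix.mulVec_diagonal, hl]
      rfl
    rw [E.symm_apply_apply, h1, nabla, derivation_mulVec, Matrix.mulVec_mulVec]
    change H.val *ᵥ _ = _
    rw [Matrix.mulVec_add, Matrix.mulVec_mulVec, ← hH, Matrix.add_mulVec]
    abel

end Gauge

end InvDMod

end

noncomputable section

namespace InvDMod

/-! ### D-module structures and connections -/

section GeneralCorrespondence

variable {n : ℕ}

/-- The commutator of a vector field with a function gives the Leibniz rule for the action, so its
values on the standard basis determine it. -/
theorem act_opOfDer_apply {A : Type*} [CommRing A] [Algebra ℂ A]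
    {act : diffOps A →ₐ[ℂ] Module.End ℂ (Fin n → A)}
    (hf : ∀ (f : A) (m : Fin n → A), act (opOfFun f) m = f • m) {v : Derivation ℂ A A}
    {K : Matrix (Fin n) (Fin n) A}
    (hv : ∀ j, act (opOfDer v) (Pi.single j 1) = fun i => K i j) (m : Fin n → A) :
    act (opOfDer v) m = v ∘ m + K *ᵥ m := by
  have hcomm : ∀ f : A, opOfDer v * opOfFun f = opOfFun f * opOfDer v + opOfFun (v f) := by
    intro f
    rw [← commOp_opOfDer]
    change _ = _ + (opOfDer v * opOfFun f - opOfFun f * opOfDer v)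
    abel
  have h1 : ∀ (f : A) (w : Fin n → A),
      act (opOfDer v) (f • w) = f • act (opOfDer v) w + v f • w := by
    intro f w
    rw [← hf, ← Module.End.mul_apply, ← map_mul, hcomm, map_add, map_mul, LinearMap.add_apply,
      Module.End.mul_apply, hf, hf]
  have h2 : m = ∑ j, m j • (Pi.single j 1 : Fin n → A) := by
    ext i
    simp [Finset.sum_apply, Pi.single_apply]
  conv_lhs => rw [h2, map_sum]
  ext i
  simp only [h1, hv, Finset.sum_apply, Pi.add_apply, Pi.smul_apply, smul_eq_mul,
    Finset.sum_add_distrib, Function.comp_apply, Matrix.mulVec, dotProduct]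
  rw [add_comm]
  congr 1
  · simp [Pi.single_apply]
  · exact Finset.sum_congr rfl fun j _ => mul_comm _ _

/-- The connection of a module over differential operators is flat. -/
theorem isFlat_of_act {A : Type*} [CommRing A] [Algebra ℂ A]
    {act : diffOps A →ₐ[ℂ] Module.End ℂ (Fin n → A)}
    (hf : ∀ (f : A) (m : Fin n → A), act (opOfFun f) m = f • m)
    {α : Matrix (Fin n) (Fin n) (Ω[A⁄ℂ])}
    (hv : ∀ (v : Derivation ℂ A A) j, act (opOfDer v) (Pi.single j 1) = fun i => evalForm α v i j) :
    IsFlat α := by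
  intro u v
  have hbr : opOfDer ⁅u, v⁆ = opOfDer u * opOfDer v - opOfDer v * opOfDer u :=
    Subtype.ext (LinearMap.ext (Derivation.commutator_apply (D1 := u) (D2 := v)))
  ext1 i j
  have h1 := congrFun (congrArg (fun P => act P (Pi.single j 1)) hbr) i
  simp only [map_sub, map_mul, LinearMap.sub_apply, Module.End.mul_apply, Pi.sub_apply] at h1
  rw [hv ⁅u, v⁆, hv u, hv v, act_opOfDer_apply hf (hv u), act_opOfDer_apply hf (hv v)] at h1
  simp only [Pi.add_apply, Function.comp_apply, Matrix.mulVec, dotProduct] at h1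
  simp only [Matrix.add_apply, Matrix.sub_apply, Matrix.map_apply, Matrix.mul_apply, h1,
    Matrix.zero_apply]
  abel

variable {A : Type*} [CommRing A] [Algebra ℂ A] {L : Type*} [LieRing L] [LieAlgebra ℂ L]
  [FiniteDimensional ℂ L] [LieRing.IsNilpotent L] {D : L →ₗ⁅ℂ⁆ Derivation ℂ A A} {ε : A →ₐ[ℂ] ℂ}

theorem IsUnipotentAction.exists_form_of_rep (hD : IsUnipotentAction D ε) (ρ : Rep L n) :
    ∃ α : Matrix (Fin n) (Fin n) (Ω[A⁄ℂ]), ∀ x,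
      evalForm α (D x) = (ρ x).map (algebraMap ℂ A) := by
  have hω : ∀ i j, ∃ ω : Ω[A⁄ℂ], ∀ x,
      (D x).liftKaehlerDifferential ω = algebraMap ℂ A (ρ x i j) := by
    intro i j
    obtain ⟨ω, h⟩ := hD.exists_form ((Algebra.linearMap ℂ A).comp
      { toFun := fun x => ρ x i j
        map_add' := fun x y => by rw [map_add, Matrix.add_apply]
        map_smul' := fun c x => by rw [map_smul, Matrix.smul_apply, RingHom.id_apply] })
    exact ⟨ω, h⟩
  choose ω hω using hω
  exact ⟨Matrix.of ω, fun x => by ext1 i j; exact hω i j x⟩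

theorem IsUnipotentAction.act_opOfDer_single (hD : IsUnipotentAction D ε)
    {act : diffOps A →ₐ[ℂ] Module.End ℂ (Fin n → A)}
    (hf : ∀ (f : A) (m : Fin n → A), act (opOfFun f) m = f • m) {ρ : Rep L n}
    (hx : ∀ x m, act (opOfDer (D x)) m = nabla D ρ x m) {α : Matrix (Fin n) (Fin n) (Ω[A⁄ℂ])}
    (hα : ∀ x, evalForm α (D x) = (ρ x).map (algebraMap ℂ A)) (v : Derivation ℂ A A) (j : Fin n) :
    act (opOfDer v) (Pi.single j 1) = fun i => evalForm α v i j := by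
  induction hD.mem_span v using Submodule.span_induction with
  | mem z hz =>
    obtain ⟨x, rfl⟩ := hz
    rw [hx, hα]
    ext1 i
    simp only [nabla, Pi.add_apply, Function.comp_apply, Matrix.mulVec_single_one,
      Matrix.col_apply, Matrix.map_apply]
    by_cases hij : i = j
    · subst hij; simp
    · simp [hij]
  | zero =>
    rw [opOfDer_zero, map_zero, LinearMap.zero_apply]
    ext1 i
    exact (lift_zero _).symm
  | add v w _ _ hv hw =>
    rw [opOfDer_add, map_add, LinearMap.add_apply, hv, hw]
    ext1 i
    exact (lift_add v w (α i j)).symm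
  | smul a v _ hv =>
    rw [opOfDer_smul, map_mul, Module.End.mul_apply, hf, hv]
    ext1 i
    exact (lift_smul a v (α i j)).symm

/-- Isomorphisms of modules given by connection matrices are gauge transformations. -/
theorem IsUnipotentAction.exists_intertwiner_iff (hD : IsUnipotentAction D ε)
    {act₁ act₂ : diffOps A →ₐ[ℂ] Module.End ℂ (Fin n → A)}
    (hf₁ : ∀ (f : A) (m : Fin n → A), act₁ (opOfFun f) m = f • m)
    (hf₂ : ∀ (f : A) (m : Fin n → A), act₂ (opOfFun f) m = f • m) {ρ₁ ρ₂ : Rep L n}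
    (hx₁ : ∀ x m, act₁ (opOfDer (D x)) m = nabla D ρ₁ x m)
    (hx₂ : ∀ x m, act₂ (opOfDer (D x)) m = nabla D ρ₂ x m) :
    (∃ Φ : (Fin n → A) ≃ₗ[ℂ] (Fin n → A), ∀ P m, Φ (act₁ P m) = act₂ P (Φ m)) ↔
      ∃ H : GL (Fin n) A, ∀ x, H.val.map (D x) + (ρ₂ x).map (algebraMap ℂ A) * H.val
        = H.val * (ρ₁ x).map (algebraMap ℂ A) := by
  constructor
  · rintro ⟨Φ, hΦ⟩
    -- Functions are differential operators of order zero, so `Φ` is linear over `A` and is given by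
    -- a matrix.
    have hlin : ∀ (f : A) m, Φ (f • m) = f • Φ m := fun f m => by
      rw [← hf₁, hΦ, hf₂]
    let Φ' : (Fin n → A) ≃ₗ[A] (Fin n → A) := { Φ with map_smul' := hlin }
    let H : GL (Fin n) A := ⟨LinearMap.toMatrix' Φ'.toLinearMap,
      LinearMap.toMatrix' Φ'.symm.toLinearMap,
      by rw [← LinearMap.toMatrix'_comp, LinearEquiv.comp_symm, LinearMap.toMatrix'_id],
      by rw [← LinearMap.toMatrix'_comp, LinearEquiv.symm_comp, LinearMap.toMatrix'_id]⟩
    have hH : ∀ m, H.val *ᵥ m = Φ m := fun m => by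
      rw [← Matrix.toLin'_apply, Matrix.toLin'_toMatrix']
      rfl
    refine ⟨H, fun x => ?_⟩
    have key : ∀ m, (H.val.map (D x) + (ρ₂ x).map (algebraMap ℂ A) * H.val) *ᵥ m
        = (H.val * (ρ₁ x).map (algebraMap ℂ A)) *ᵥ m := by
      intro m
      have h := hΦ (opOfDer (D x)) m
      rw [hx₁, hx₂, ← hH, ← hH, nabla, nabla, Matrix.mulVec_add,
        derivation_mulVec, Matrix.mulVec_mulVec, Matrix.mulVec_mulVec] at h
      rw [Matrix.add_mulVec]
      have h' := eq_sub_of_add_eq' h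
      rw [h']
      abel
    ext1 i j
    have := congrFun (key (Pi.single j 1)) i
    simpa using this
  · rintro ⟨H, hH⟩
    let E : (Fin n → A) ≃ₗ[ℂ] (Fin n → A) :=
      { toFun := fun m => H.val *ᵥ m
        invFun := fun m => (H⁻¹).val *ᵥ m
        map_add' := fun m m' => Matrix.mulVec_add _ _ _
        map_smul' := fun c m => Matrix.mulVec_smul _ _ _
        left_inv := fun m => by simp only [Matrix.mulVec_mulVec, Units.inv_mul, Matrix.one_mulVec]
        right_inv := fun m => by
          simp only [Matrix.mulVec_mulVec, Units.mul_inv, Matrix.one_mulVec] }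
    refine ⟨E, fun P m => hD.intertwines act₁ act₂ E.toLinearMap (fun f m => ?_)
      (fun x m => ?_) P m⟩
    · rw [hf₁, hf₂]
      exact Matrix.mulVec_smul H.val f m
    · rw [hx₁, hx₂]
      change H.val *ᵥ nabla D ρ₁ x m = nabla D ρ₂ x (H.val *ᵥ m)
      rw [nabla, nabla, derivation_mulVec, Matrix.mulVec_add, Matrix.mulVec_mulVec, ← hH,
        Matrix.add_mulVec, Matrix.mulVec_mulVec]
      abel

end GeneralCorrespondence

/-! ### Invariant D-modules and representations -/

section Correspondence

variable {N n : ℕ} {G : Subgroup (GL (Fin N) ℂ)}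

theorem lift_kaehlerMap_translate {v : Derivation ℂ (coordRing G) (coordRing G)}
    (hv : v ∈ lieAlg G) (g : G) (ω : Ω[coordRing G⁄ℂ]) :
    v.liftKaehlerDifferential (kaehlerMap (translate G g) ω)
      = translate G g (v.liftKaehlerDifferential ω) := by
  have hω : ω ∈ Submodule.span (coordRing G)
      (Set.range (KaehlerDifferential.D ℂ (coordRing G))) := by
    rw [KaehlerDifferential.span_range_derivation]
    exact Submodule.mem_top
  -- `kaehlerMap` is only an additive map, so the induction runs over sums of a db rather than by
  -- linearity.
  refine Submodule.closure_induction (p := fun ω _ =>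
    v.liftKaehlerDifferential (kaehlerMap (translate G g) ω)
      = translate G g (v.liftKaehlerDifferential ω)) ?_ ?_ ?_ hω
  · simp
  · intro x y _ _ hx hy
    simp only [map_add, hx, hy]
  · rintro a _ ⟨b, rfl⟩
    rw [kaehlerMap_smul_D, map_smul, map_smul, lift_apply_D, lift_apply_D, smul_eq_mul,
      smul_eq_mul, map_mul, hv g b]

theorem eq_algebraMap_of_translate_eq {f : coordRing G} (hf : ∀ g, translate G g f = f) :
    f = algebraMap ℂ (coordRing G) (f.1 1) := by
  refine Subtype.ext (funext fun g => ?_)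
  have := congrFun (congrArg Subtype.val (hf g)) 1
  change f.1 (g * 1) = f.1 1 at this
  rw [mul_one] at this
  exact this

theorem InvariantDModule.act_der_apply (M : InvariantDModule G n)
    (v : Derivation ℂ (coordRing G) (coordRing G)) (m : Fin n → coordRing G) :
    M.act (opOfDer v) m = v ∘ m + evalForm M.form v *ᵥ m :=
  act_opOfDer_apply M.act_fun (M.act_der v) m

variable {𝔫 : Type*} [LieRing 𝔫] [LieAlgebra ℂ 𝔫]

/-- The derivations given by an identification of a Lie algebra with the Lie algebra of `G`. -/
def derivationMap (e : 𝔫 ≃ₗ⁅ℂ⁆ lieAlg G) :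
    𝔫 →ₗ⁅ℂ⁆ Derivation ℂ (coordRing G) (coordRing G) :=
  (lieAlg G).incl.comp e.toLieHom

theorem derivationMap_apply (e : 𝔫 ≃ₗ⁅ℂ⁆ lieAlg G) (x : 𝔫) : derivationMap e x = (e x).val := rfl

theorem CorrespondsTo.act_apply {e : 𝔫 ≃ₗ⁅ℂ⁆ lieAlg G} {M : InvariantDModule G n} {ρ : Rep 𝔫 n}
    (h : CorrespondsTo e M ρ) (x : 𝔫) (m : Fin n → coordRing G) :
    M.act (opOfDer (derivationMap e x)) m = nabla (derivationMap e) ρ x m := by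
  rw [M.act_der_apply, derivationMap_apply, h x]
  rfl

theorem exists_rep_correspondsTo (e : 𝔫 ≃ₗ⁅ℂ⁆ lieAlg G) (M : InvariantDModule G n) :
    ∃ ρ : Rep 𝔫 n, CorrespondsTo e M ρ := by
  let r : 𝔫 → Matrix (Fin n) (Fin n) ℂ := fun x =>
    (evalForm M.form (derivationMap e x)).map fun f : coordRing G => f.1 1
  have hr : ∀ x, evalForm M.form (derivationMap e x) = (r x).map (algebraMap ℂ (coordRing G)) := by
    intro x
    ext1 i j
    -- An invariant form takes translation invariant values on left invariant fields, and
    -- translations act transitively.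
    refine eq_algebraMap_of_translate_eq fun g => ?_
    change translate G g ((e x).val.liftKaehlerDifferential (M.form i j)) = _
    rw [← lift_kaehlerMap_translate (e x).2]
    have := congrFun (congrFun (M.invariant g) i) j
    rw [Matrix.map_apply] at this
    rw [this]
    rfl
  have hinj : ∀ X Y : Matrix (Fin n) (Fin n) ℂ, X.map (algebraMap ℂ (coordRing G))
      = Y.map (algebraMap ℂ (coordRing G)) → X = Y := by
    intro X Y h
    ext i j
    have := congrFun (congrArg Subtype.val (congrFun (congrFun h i) j)) 1
    exact this
  let ρ : Rep 𝔫 n :=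
    { toFun := r
      map_add' := fun x y => by
        ext i j
        simp only [r, map_add, Matrix.map_apply, evalForm, lift_add]
        rfl
      map_smul' := fun c x => by
        ext i j
        simp only [r, map_smul, Matrix.map_apply, evalForm]
        rw [← algebraMap_smul (coordRing G) c (derivationMap e x), lift_smul]
        rfl
      map_lie' := fun {x y} => by
        apply hinj
        -- On constant matrices the derivative terms of flatness vanish, leaving compatibility with
        -- brackets.
        have h := M.flat (derivationMap e x) (derivationMap e y)
        rw [← LieHom.map_lie, hr, hr, hr, derivation_const, derivation_const, sub_zero, zero_sub,
          neg_add_eq_zero] at h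
        rw [h, Ring.lie_def, Matrix.map_sub _ (map_sub _), Matrix.map_mul, Matrix.map_mul] }
  exact ⟨ρ, hr⟩

theorem CorrespondsTo.rep_eq {e : 𝔫 ≃ₗ⁅ℂ⁆ lieAlg G} {M : InvariantDModule G n} {ρ ρ' : Rep 𝔫 n}
    (h : CorrespondsTo e M ρ) (h' : CorrespondsTo e M ρ') : ρ = ρ' := by
  ext x i j
  have := congrFun (congrArg Subtype.val (congrFun (congrFun ((h x).symm.trans (h' x)) i) j)) 1
  exact this

variable [FiniteDimensional ℂ 𝔫] [LieRing.IsNilpotent 𝔫] {e : 𝔫 ≃ₗ⁅ℂ⁆ lieAlg G}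
  {ε : coordRing G →ₐ[ℂ] ℂ}

theorem exists_correspondsTo (hD : IsUnipotentAction (derivationMap e) ε) (ρ : Rep 𝔫 n) :
    ∃ M : InvariantDModule G n, CorrespondsTo e M ρ := by
  obtain ⟨act, hf, hx⟩ := hD.exists_act ρ
  obtain ⟨α, hα⟩ := hD.exists_form_of_rep ρ
  have hv := hD.act_opOfDer_single hf hx hα
  have hinv : IsInvariantForm G α := by
    intro g
    ext1 i j
    rw [Matrix.map_apply, ← sub_eq_zero]
    refine hD.form_eq_zero _ fun x => ?_
    have h1 : (derivationMap e x).liftKaehlerDifferential (α i j)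
        = algebraMap ℂ (coordRing G) (ρ x i j) := congrFun (congrFun (hα x) i) j
    rw [map_sub, derivationMap_apply, lift_kaehlerMap_translate (e x).2, ← derivationMap_apply, h1,
      AlgHom.commutes, sub_self]
  exact ⟨⟨α, hinv, isFlat_of_act hf hv, act, hf, hv⟩, hα⟩

theorem CorrespondsTo.eq (hD : IsUnipotentAction (derivationMap e) ε)
    {M M' : InvariantDModule G n} {ρ : Rep 𝔫 n} (h : CorrespondsTo e M ρ)
    (h' : CorrespondsTo e M' ρ) : M = M' := by
  refine InvariantDModule.ext ?_ ?_
  · ext1 i j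
    rw [← sub_eq_zero]
    refine hD.form_eq_zero _ fun x => ?_
    rw [map_sub, sub_eq_zero]
    exact congrFun (congrFun ((h x).trans (h' x).symm) i) j
  · refine AlgHom.ext fun P => LinearMap.ext fun m => ?_
    exact hD.intertwines M.act M'.act LinearMap.id
      (fun f m => by rw [M.act_fun]; exact (M'.act_fun f m).symm)
      (fun x m => by rw [h.act_apply]; exact (h'.act_apply x m).symm) P m

theorem iso_iff_exists_gauge (hD : IsUnipotentAction (derivationMap e) ε)
    {M₁ M₂ : InvariantDModule G n} {ρ₁ ρ₂ : Rep 𝔫 n} (h₁ : CorrespondsTo e M₁ ρ₁)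
    (h₂ : CorrespondsTo e M₂ ρ₂) : M₁.Iso M₂ ↔ ∃ H : GL (Fin n) (coordRing G), ∀ x,
      H.val.map (derivationMap e x) + (ρ₂ x).map (algebraMap ℂ (coordRing G)) * H.val
        = H.val * (ρ₁ x).map (algebraMap ℂ (coordRing G)) :=
  hD.exists_intertwiner_iff M₁.act_fun M₂.act_fun h₁.act_apply h₂.act_apply

end Correspondence

end InvDMod

end

noncomputable section

namespace InvDMod

/-! ### Gauge transformations and semisimple parts -/

section LocallyNilpotent

variable {W : Type*} [AddCommGroup W] [Module ℂ W]

/-- In the binomial expansion of exponent k + l every term has enough factors `b` to vanish or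
enough factors `a` to kill `w`. -/
theorem exists_pow_add_apply_eq_zero {a b : Module.End ℂ W} (hab : Commute a b)
    (ha : ∀ w, ∃ k : ℕ, (a ^ k) w = 0) (hb : IsNilpotent b) (w : W) :
    ∃ k : ℕ, ((a + b) ^ k) w = 0 := by
  obtain ⟨k, hk⟩ := ha w
  obtain ⟨l, hl⟩ := hb
  refine ⟨k + l, ?_⟩
  rw [hab.add_pow', LinearMap.sum_apply]
  refine Finset.sum_eq_zero fun p hp => ?_
  have hp' := Finset.HasAntidiagonal.mem_antidiagonal.1 hp
  rw [LinearMap.smul_apply]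
  by_cases h : l ≤ p.2
  · rw [pow_eq_zero_of_le h hl, mul_zero, LinearMap.zero_apply, smul_zero]
  · rw [(hab.pow_pow p.1 p.2).eq, Module.End.mul_apply, ← Nat.sub_add_cancel (show k ≤ p.1 by omega),
      pow_add a, Module.End.mul_apply, hk, map_zero, map_zero, smul_zero]

theorem pow_apply_eq_of_commute {a b : Module.End ℂ W} (hab : Commute a b) {w : W} (h : a w = b w)
    (k : ℕ) : (a ^ k) w = (b ^ k) w := by
  induction k with
  | zero => simp
  | succ k ih =>
    rw [pow_succ, Module.End.mul_apply, h, ← Module.End.mul_apply, (hab.pow_left k).eq,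
      Module.End.mul_apply, ih, pow_succ', Module.End.mul_apply]

end LocallyNilpotent

section SemisimpleMatrices

variable {n : ℕ}

/-- The squarefree minimal polynomial of `S` also annihilates multiplication by `S`. -/
theorem isSemisimple_mulLeft {S : Matrix (Fin n) (Fin n) ℂ}
    (hS : Module.End.IsSemisimple (Matrix.toLin' S)) :
    Module.End.IsSemisimple (LinearMap.mulLeft ℂ S) := by
  have h := hS.minpoly_squarefree
  rw [Matrix.minpoly_toLin'] at h
  refine Module.End.isSemisimple_of_squarefree_aeval_eq_zero h ?_
  have := Polynomial.aeval_algHom_apply (Algebra.lmul ℂ (Matrix (Fin n) (Fin n) ℂ)) S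
    (minpoly ℂ S)
  rw [minpoly.aeval, map_zero] at this
  exact this

theorem aeval_mulRight {R : Type*} [Ring R] [Algebra ℂ R] (S : R) (p : Polynomial ℂ) :
    Polynomial.aeval (LinearMap.mulRight ℂ S) p = LinearMap.mulRight ℂ (Polynomial.aeval S p) := by
  induction p using Polynomial.induction_on' with
  | add p q hp hq =>
    rw [map_add, map_add, hp, hq]
    ext x
    simp [mul_add]
  | monomial k c =>
    rw [Polynomial.aeval_monomial, Polynomial.aeval_monomial, LinearMap.pow_mulRight]
    ext x
    simp [Algebra.algebraMap_eq_smul_one]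

theorem isSemisimple_mulRight {S : Matrix (Fin n) (Fin n) ℂ}
    (hS : Module.End.IsSemisimple (Matrix.toLin' S)) :
    Module.End.IsSemisimple (LinearMap.mulRight ℂ S) := by
  have h := hS.minpoly_squarefree
  rw [Matrix.minpoly_toLin'] at h
  refine Module.End.isSemisimple_of_squarefree_aeval_eq_zero h ?_
  rw [aeval_mulRight, minpoly.aeval]
  ext x
  simp

theorem isSemisimple_diagonal (d : Fin n → ℂ) :
    Module.End.IsSemisimple (Matrix.toLin' (Matrix.diagonal d)) := by
  classical
  let p : Polynomial ℂ := ∏ c ∈ Finset.univ.image d, (Polynomial.X - Polynomial.C c)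
  have hp : Squarefree p :=
    (Polynomial.separable_prod_X_sub_C_iff'.2 fun _ _ _ _ h => h).squarefree
  refine Module.End.isSemisimple_of_squarefree_aeval_eq_zero hp ?_
  have h1 := Polynomial.aeval_algHom_apply (Matrix.diagonalAlgHom ℂ : (Fin n → ℂ) →ₐ[ℂ] _) d p
  have h2 : Polynomial.aeval d p = 0 := by
    ext i
    rw [Polynomial.aeval_pi]
    change Polynomial.aeval (d i) p = 0
    rw [Polynomial.coe_aeval_eq_eval, Polynomial.eval_prod]
    exact Finset.prod_eq_zero (Finset.mem_image_of_mem d (Finset.mem_univ i)) (by simp)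
  rw [h2, map_zero] at h1
  have h3 := Polynomial.aeval_algHom_apply (Matrix.toLinAlgEquiv' : Matrix (Fin n) (Fin n) ℂ ≃ₐ[ℂ] _)
    (Matrix.diagonal d) p
  change Polynomial.aeval (Matrix.toLin' (Matrix.diagonal d)) p = _ at h3
  rw [h3]
  change Matrix.toLinAlgEquiv' (Polynomial.aeval (Matrix.diagonalAlgHom ℂ d) p) = 0
  rw [h1, map_zero]

theorem eq_zero_of_isSemisimple_of_pow {W : Type*} [AddCommGroup W] [Module ℂ W]
    [FiniteDimensional ℂ W] {f : Module.End ℂ W} (hf : f.IsSemisimple) {k : ℕ} {w : W}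
    (h : (f ^ k) w = 0) : f w = 0 := by
  -- The exponent is raised to `k + 1` so that it is positive, as the comparison with the eigenspace
  -- requires.
  have h1 : w ∈ f.genEigenspace 0 ((k + 1 : ℕ) : ℕ∞) := by
    rw [Module.End.mem_genEigenspace_nat, zero_smul, sub_zero, LinearMap.mem_ker, pow_succ',
      Module.End.mul_apply, h, map_zero]
  rw [(Module.End.isFinitelySemisimple_iff_isSemisimple.2 hf).genEigenspace_eq_eigenspace 0
    (by simp), Module.End.mem_eigenspace_iff, zero_smul] at h1
  exact h1

variable {A : Type*} [CommRing A] [Algebra ℂ A]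

/-- A gauge transformation between constant connections conjugates the semisimple parts. -/
theorem semisimple_intertwine_of_gauge (v : Derivation ℂ A A)
    (hv : ∀ f, ∃ m : ℕ, ((v : A →ₗ[ℂ] A) ^ m) f = 0) (ε : A →ₐ[ℂ] ℂ)
    {M₁ M₂ S₁ S₂ : Matrix (Fin n) (Fin n) ℂ}
    (hS₁ : Module.End.IsSemisimple (Matrix.toLin' S₁))
    (hS₂ : Module.End.IsSemisimple (Matrix.toLin' S₂))
    (hN₁ : IsNilpotent (M₁ - S₁)) (hN₂ : IsNilpotent (M₂ - S₂)) (hc₁ : Commute M₁ S₁)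
    (hc₂ : Commute M₂ S₂) {H : Matrix (Fin n) (Fin n) A}
    (hH : H.map v + M₂.map (algebraMap ℂ A) * H = H * M₁.map (algebraMap ℂ A)) :
    S₂ * H.map ε = H.map ε * S₁ := by
  let c : Matrix (Fin n) (Fin n) ℂ →+* Matrix (Fin n) (Fin n) A := (algebraMap ℂ A).mapMatrix
  let X : Module.End ℂ (Matrix (Fin n) (Fin n) A) := (v : A →ₗ[ℂ] A).mapMatrix
  have hX : ∀ K, X K = K.map v := fun _ => rfl
  let l : Matrix (Fin n) (Fin n) ℂ → Module.End ℂ (Matrix (Fin n) (Fin n) A) :=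
    fun K => LinearMap.mulLeft ℂ (c K)
  let r : Matrix (Fin n) (Fin n) ℂ → Module.End ℂ (Matrix (Fin n) (Fin n) A) :=
    fun K => LinearMap.mulRight ℂ (c K)
  have hXl : ∀ K, Commute X (l K) := fun K => LinearMap.ext fun Z => by
    change (c K * Z).map v = c K * Z.map v
    rw [derivation_matrix_mul]
    change (K.map (algebraMap ℂ A)).map v * Z + _ = _
    rw [derivation_const, zero_mul, zero_add]
  have hXr : ∀ K, Commute X (r K) := fun K => LinearMap.ext fun Z => by
    change (Z * c K).map v = Z.map v * c K
    rw [derivation_matrix_mul]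
    change _ + Z * (K.map (algebraMap ℂ A)).map v = _
    rw [derivation_const, mul_zero, add_zero]
  have hlr : ∀ K K', Commute (l K) (r K') := fun K K' => LinearMap.commute_mulLeft_right _ _
  have hll : ∀ K K', Commute K K' → Commute (l K) (l K') := fun K K' h =>
    ((h.map c).map (Algebra.lmul ℂ (Matrix (Fin n) (Fin n) A)))
  have hrr : ∀ K K', Commute K K' → Commute (r K) (r K') := fun K K' h => LinearMap.ext fun Z => by
    change Z * c K' * c K = Z * c K * c K'
    rw [mul_assoc, mul_assoc, (h.map c).eq]
  have hcN₁ : Commute (M₁ - S₁) S₁ := hc₁.sub_left (Commute.refl _)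
  have hcN₂ : Commute (M₂ - S₂) S₂ := hc₂.sub_left (Commute.refl _)
  have hnil : IsNilpotent (l (M₂ - S₂) - r (M₁ - S₁)) := by
    refine (hlr _ _).isNilpotent_sub ?_ ?_
    · obtain ⟨k, hk⟩ := hN₂
      refine ⟨k, ?_⟩
      rw [LinearMap.pow_mulLeft, ← map_pow, hk, map_zero, LinearMap.mulLeft_zero_eq_zero]
    · obtain ⟨k, hk⟩ := hN₁
      refine ⟨k, ?_⟩
      rw [LinearMap.pow_mulRight, ← map_pow, hk, map_zero, LinearMap.mulRight_zero_eq_zero]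
  have hXnil : ∀ K, ∃ k : ℕ, (X ^ k) K = 0 := by
    intro K
    choose m hm using fun i j => hv (K i j)
    have hpow : ∀ k : ℕ, ∀ i j, (X ^ k) K i j = ((v : A →ₗ[ℂ] A) ^ k) (K i j) := by
      intro k
      induction k with
      | zero => simp
      | succ k ih =>
        intro i j
        rw [pow_succ', Module.End.mul_apply, pow_succ', Module.End.mul_apply, ← ih]
        rfl
    refine ⟨∑ i, ∑ j, m i j, ?_⟩
    ext i j
    have hle : m i j ≤ ∑ i, ∑ j, m i j :=
      (Finset.single_le_sum (f := fun j => m i j) (fun _ _ => Nat.zero_le _)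
        (Finset.mem_univ j)).trans
      (Finset.single_le_sum (f := fun i => ∑ j, m i j) (fun _ _ => Nat.zero_le _)
        (Finset.mem_univ i))
    rw [hpow, ← Nat.sub_add_cancel hle, pow_add, Module.End.mul_apply, hm, map_zero,
      Matrix.zero_apply]
  -- The gauge equation is regrouped as Y H = Z H: the locally nilpotent terms go into `Y` and the
  -- semisimple ones into `Z`. As these commute, a power of `Z` kills `H`.
  let Y := X + (l (M₂ - S₂) - r (M₁ - S₁))
  let Z := r S₁ - l S₂
  have hYZ : Commute Y Z := by
    refine Commute.add_left ((hXr _).sub_right (hXl _)) (Commute.sub_left ?_ ?_)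
    · exact (hlr _ _).sub_right (hll _ _ hcN₂)
    · exact (hrr _ _ hcN₁).sub_right (hlr _ _).symm
  have hYH : Y H = Z H := by
    change H.map v + (c (M₂ - S₂) * H - H * c (M₁ - S₁)) = H * c S₁ - c S₂ * H
    have hH' : H.map v = H * c M₁ - c M₂ * H := eq_sub_of_add_eq hH
    rw [hH', map_sub, map_sub, sub_mul, mul_sub]
    abel
  obtain ⟨k, hk⟩ := exists_pow_add_apply_eq_zero ((hXl _).sub_right (hXr _)) hXnil hnil H
  change (Y ^ k) H = 0 at hk
  rw [pow_apply_eq_of_commute hYZ hYH] at hk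
  -- `Z` has constant coefficients, so `ε` carries it to `Z₀`. This operator is semisimple on a
  -- finite-dimensional space, so the power can be dropped.
  let Z₀ : Module.End ℂ (Matrix (Fin n) (Fin n) ℂ) :=
    LinearMap.mulRight ℂ S₁ - LinearMap.mulLeft ℂ S₂
  have hZ₀ : Z₀.IsSemisimple := (isSemisimple_mulRight hS₁).sub_of_commute
    (LinearMap.commute_mulLeft_right _ _).symm (isSemisimple_mulLeft hS₂)
  have hεc : ∀ K, (c K).map ε = K := by
    intro K
    ext i j
    exact ε.commutes _
  have hZε : ∀ K, (Z K).map ε = Z₀ (K.map ε) := by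
    intro K
    change (K * c S₁ - c S₂ * K).map ε = K.map ε * S₁ - S₂ * K.map ε
    rw [Matrix.map_sub _ (map_sub _), Matrix.map_mul, Matrix.map_mul, hεc, hεc]
  have hZk : ∀ k : ℕ, ((Z ^ k) H).map ε = (Z₀ ^ k) (H.map ε) := by
    intro k
    induction k with
    | zero => simp
    | succ k ih => rw [pow_succ', Module.End.mul_apply, hZε, ih, pow_succ', Module.End.mul_apply]
  have h0 : (Z₀ ^ k) (H.map ε) = 0 := by
    rw [← hZk, hk]
    ext i j
    simp
  exact (sub_eq_zero.1 (eq_zero_of_isSemisimple_of_pow hZ₀ h0)).symm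

theorem semisimplePart_isSemisimple (M : Matrix (Fin n) (Fin n) ℂ) :
    Module.End.IsSemisimple (Matrix.toLin' (semisimplePart M)) :=
  (exists_semisimplePart M).choose_spec.1

theorem isNilpotent_sub_semisimplePart (M : Matrix (Fin n) (Fin n) ℂ) :
    IsNilpotent (M - semisimplePart M) :=
  (exists_semisimplePart M).choose_spec.2.1

theorem commute_semisimplePart (M : Matrix (Fin n) (Fin n) ℂ) : Commute M (semisimplePart M) :=
  (exists_semisimplePart M).choose_spec.2.2

variable {L : Type*} [LieRing L] [LieAlgebra ℂ L] {D : L →ₗ⁅ℂ⁆ Derivation ℂ A A} {ε : A →ₐ[ℂ] ℂ}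

/-- Gauge equivalent constant connections have conjugate semisimple parts. -/
theorem IsUnipotentAction.semisimplePartsConjugate (hD : IsUnipotentAction D ε) {ρ₁ ρ₂ : Rep L n}
    (H : GL (Fin n) A) (hH : ∀ x, H.val.map (D x) + (ρ₂ x).map (algebraMap ℂ A) * H.val
        = H.val * (ρ₁ x).map (algebraMap ℂ A)) : SemisimplePartsConjugate ρ₂ ρ₁ := by
  refine ⟨Units.map ε.toRingHom.mapMatrix.toMonoidHom H, fun x => ?_⟩
  rw [Units.eq_mul_inv_iff_mul_eq]
  exact semisimple_intertwine_of_gauge (D x) (hD.locallyNilpotent x) ε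
    (semisimplePart_isSemisimple _) (semisimplePart_isSemisimple _)
    (isNilpotent_sub_semisimplePart _) (isNilpotent_sub_semisimplePart _)
    (commute_semisimplePart _) (commute_semisimplePart _) (hH x)

/-- The diagonal representation given by characters. -/
def diagRep (χ : Fin n → L →ₗ[ℂ] ℂ) (hχ : ∀ i, ∀ x y : L, χ i ⁅x, y⁆ = 0) : Rep L n where
  toFun x := Matrix.diagonal fun i => χ i x
  map_add' x y := by simp only [map_add, Matrix.diagonal_add]
  map_smul' c x := by
    ext i j
    by_cases h : i = j
    · subst h; simp
    · simp [h]
  map_lie' := fun {x y} => by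
    simp only [hχ, Ring.lie_def, Matrix.diagonal_mul_diagonal, mul_comm, sub_self]
    exact Matrix.diagonal_zero

theorem diagRep_apply (χ : Fin n → L →ₗ[ℂ] ℂ) (hχ : ∀ i, ∀ x y : L, χ i ⁅x, y⁆ = 0) (x : L) :
    diagRep χ hχ x = Matrix.diagonal fun i => χ i x := rfl

theorem semisimplePart_diagonal (d : Fin n → ℂ) :
    semisimplePart (Matrix.diagonal d) = Matrix.diagonal d := by
  -- Uniqueness of the Jordan decomposition is the case of the zero derivation and the identity
  -- gauge.
  have h := semisimple_intertwine_of_gauge (A := ℂ) (0 : Derivation ℂ ℂ ℂ)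
    (fun f => ⟨1, by simp⟩) (AlgHom.id ℂ ℂ)
    (isSemisimple_diagonal d) (semisimplePart_isSemisimple (Matrix.diagonal d))
    (M₁ := Matrix.diagonal d) (by simp) (isNilpotent_sub_semisimplePart _)
    (Commute.refl _) (commute_semisimplePart _) (H := 1) (by
      rw [mul_one, one_mul]
      ext i j
      simp)
  simpa using h

variable [FiniteDimensional ℂ L] [LieRing.IsNilpotent L]

/-- Every constant connection is gauge equivalent to a diagonal one, obtained by triangularizing
the representation. -/
theorem IsUnipotentAction.exists_diagonal_gauge (hD : IsUnipotentAction D ε) (ρ : Rep L n) :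
    ∃ (χ : Fin n → L →ₗ[ℂ] ℂ) (hχ : ∀ i, ∀ x y : L, χ i ⁅x, y⁆ = 0)
      (P : GL (Fin n) ℂ) (T : Rep L n),
      (∀ x, T x = (P⁻¹).val * ρ x * P.val) ∧ IsTriangular T ∧ (∀ i, χ i = diagEntry T i) ∧
      ∃ H : GL (Fin n) A, ∀ x, H.val.map (D x) + (ρ x).map (algebraMap ℂ A) * H.val
        = H.val * (diagRep χ hχ x).map (algebraMap ℂ A) := by
  obtain ⟨P, T, hP, hT⟩ := exists_conj_triangular ρ
  obtain ⟨H, hH⟩ := hD.exists_gauge hT P hP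
  refine ⟨diagEntry T, fun i => IsTriangular.diagEntry_lie hT i, P, T, hP, hT, fun _ => rfl, H,
    fun x => ?_⟩
  rw [hH, diagRep_apply, Matrix.diagonal_map (map_zero _)]

end SemisimpleMatrices

end InvDMod

end

noncomputable section

namespace InvDMod

/-! ### Families of characters up to permutation -/

section Permutations

/-- Families of functionals with the same values up to permutation at every point are the same up
to permutation. -/
theorem exists_perm_of_map_eq {ι α : Type*} [Fintype ι] [DecidableEq α] {f g : ι → α}
    (h : Multiset.map f Finset.univ.val = Multiset.map g Finset.univ.val) :
    ∃ σ : Equiv.Perm ι, ∀ i, f i = g (σ i) := by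
  have hcard : ∀ c, Fintype.card {i // f i = c} = Fintype.card {i // g i = c} := by
    intro c
    have h1 := congrArg (Multiset.count c) h
    rw [Multiset.count_map, Multiset.count_map] at h1
    rw [Fintype.card_subtype, Fintype.card_subtype]
    simpa only [Finset.card_def, Finset.filter_val, eq_comm] using h1
  let σ : Equiv.Perm ι := ((Equiv.sigmaFiberEquiv f).symm.trans
    (Equiv.sigmaCongrRight fun c => Fintype.equivOfCardEq (hcard c))).trans (Equiv.sigmaFiberEquiv g)
  refine ⟨σ, fun i => ?_⟩
  exact ((Fintype.equivOfCardEq (hcard (f i))) ⟨i, rfl⟩).2.symm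

/-- A matching of eigenvalues could depend on `x`. It is taken at one `x` where no nonzero
difference of the finitely many functionals vanishes, so that equal values there force equal
functionals. -/
theorem exists_perm_of_charpoly_eq {L : Type*} [AddCommGroup L] [Module ℂ L] {n : ℕ}
    {χ₁ χ₂ : Fin n → L →ₗ[ℂ] ℂ} (h : ∀ x, (Matrix.diagonal fun i => χ₁ i x).charpoly
      = (Matrix.diagonal fun i => χ₂ i x).charpoly) :
    ∃ σ : Equiv.Perm (Fin n), ∀ i, χ₁ i = χ₂ (σ i) := by
  obtain ⟨x, hx⟩ := Module.Dual.exists_forall_ne_zero_of_forall_exists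
    (fun p : {p : Fin n × Fin n // χ₁ p.1 ≠ χ₂ p.2} => χ₁ p.1.1 - χ₂ p.1.2) (by
      rintro ⟨p, hp⟩
      by_contra! hcon
      exact hp (LinearMap.ext fun x => sub_eq_zero.1 (hcon x)))
  have hroots := congrArg Polynomial.roots (h x)
  rw [Matrix.charpoly_diagonal, Matrix.charpoly_diagonal, Polynomial.roots_prod _ _
    (Finset.prod_ne_zero_iff.2 fun i _ => Polynomial.X_sub_C_ne_zero _), Polynomial.roots_prod _ _
    (Finset.prod_ne_zero_iff.2 fun i _ => Polynomial.X_sub_C_ne_zero _)] at hroots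
  simp only [Polynomial.roots_X_sub_C, Multiset.bind_singleton] at hroots
  obtain ⟨σ, hσ⟩ := exists_perm_of_map_eq hroots
  refine ⟨σ, fun i => ?_⟩
  by_contra hne
  exact hx ⟨(i, σ i), hne⟩ (sub_eq_zero.2 (hσ i))

theorem exists_conj_diagonal_perm {n : ℕ} (σ : Equiv.Perm (Fin n)) : ∃ g : GL (Fin n) ℂ,
    ∀ d : Fin n → ℂ, Matrix.diagonal (d ∘ σ) = g.val * Matrix.diagonal d * (g⁻¹).val := by
  let g : GL (Fin n) ℂ := ⟨σ.permMatrix ℂ, (σ⁻¹).permMatrix ℂ,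
    by rw [← Matrix.permMatrix_mul, inv_mul_cancel, Matrix.permMatrix_one],
    by rw [← Matrix.permMatrix_mul, mul_inv_cancel, Matrix.permMatrix_one]⟩
  refine ⟨g, fun d => ?_⟩
  rw [Units.eq_mul_inv_iff_mul_eq]
  ext i j
  rw [Matrix.diagonal_mul, Matrix.mul_diagonal]
  change d (σ i) * (σ.permMatrix ℂ) i j = (σ.permMatrix ℂ) i j * d j
  rw [Equiv.Perm.permMatrix, PEquiv.toMatrix_apply]
  by_cases h : σ i = j
  · simp [h]
  · simp [h]

end Permutations

/-! ### Invariants and degeneration to the diagonal -/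

section Invariants

variable {L : Type*} [LieRing L] [LieAlgebra ℂ L] {n : ℕ}

theorem quotientMap_eq_iff {ρ₁ ρ₂ : Rep L n} :
    quotientMap ρ₁ = quotientMap ρ₂ ↔ ∀ f : invariantRing L n, f.1 ρ₁ = f.1 ρ₂ := by
  constructor
  · intro h f
    have h1 : RingHom.ker (evalAt ρ₁) = RingHom.ker (evalAt ρ₂) :=
      congrArg MaximalSpectrum.asIdeal h
    have h2 : f - algebraMap ℂ _ (f.1 ρ₁) ∈ RingHom.ker (evalAt ρ₁) := by
      rw [RingHom.mem_ker, map_sub, AlgHom.commutes]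
      exact sub_self _
    rw [h1, RingHom.mem_ker, map_sub, AlgHom.commutes] at h2
    exact (sub_eq_zero.1 h2).symm
  · intro h
    refine MaximalSpectrum.ext ?_
    ext f
    change f.1 ρ₁ = 0 ↔ f.1 ρ₂ = 0
    rw [h]

theorem quotientMap_eq_of_conj {ρ₁ ρ₂ : Rep L n} (g : GL (Fin n) ℂ)
    (h : ∀ x, ρ₁ x = g.val * ρ₂ x * (g⁻¹).val) : quotientMap ρ₁ = quotientMap ρ₂ :=
  quotientMap_eq_iff.2 fun f => f.2.2 g ρ₂ ρ₁ h

/-- The curve of representations that degenerates a triangular representation to its diagonal. -/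
def degeneration {T : Rep L n} (hT : IsTriangular T) (t : ℂ) : Rep L n where
  -- Truncation of the exponent occurs only below the diagonal, where `T` vanishes. For nonzero `t`
  -- this is conjugation by a diagonal matrix.
  toFun x := Matrix.of fun i j : Fin n => t ^ (j.val - i.val) * T x i j
  map_add' x y := by ext i j; simp [mul_add]
  map_smul' c x := by
    ext i j
    simp only [map_smul, Matrix.of_apply, Matrix.smul_apply, smul_eq_mul, RingHom.id_apply]
    ring
  map_lie' := fun {x y} => by
    have h : ∀ x y : L, (Matrix.of fun i j : Fin n => t ^ (j.val - i.val) * T x i j)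
        * (Matrix.of fun i j : Fin n => t ^ (j.val - i.val) * T y i j)
        = Matrix.of fun i j : Fin n => t ^ (j.val - i.val) * (T x * T y) i j := by
      intro x y
      ext i j
      simp only [Matrix.mul_apply, Matrix.of_apply, Finset.mul_sum]
      refine Finset.sum_congr rfl fun k _ => ?_
      by_cases h1 : k < i
      · rw [hT x i k h1]; ring
      by_cases h2 : j < k
      · rw [hT y k j h2]; ring
      have e : j.val - i.val = (k.val - i.val) + (j.val - k.val) := by
        have h3 : i.val ≤ k.val := not_lt.1 h1
        have h4 : k.val ≤ j.val := not_lt.1 h2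
        omega
      rw [e, pow_add]
      ring
    rw [Ring.lie_def, h, h, LieHom.map_lie, Ring.lie_def]
    ext i j
    simp [mul_sub]

theorem degeneration_apply {T : Rep L n} (hT : IsTriangular T) (t : ℂ) (x : L) (i j : Fin n) :
    degeneration hT t x i j = t ^ (j.val - i.val) * T x i j := rfl

theorem exists_polynomial_degeneration {T : Rep L n} (hT : IsTriangular T) {f : Rep L n → ℂ}
    (hf : f ∈ repCoordRing L n) :
    ∃ p : Polynomial ℂ, ∀ t, f (degeneration hT t) = p.eval t := by
  refine Algebra.adjoin_induction ?_ ?_ ?_ ?_ hf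
  · rintro _ ⟨x, i, j, rfl⟩
    exact ⟨Polynomial.X ^ (j.val - i.val) * Polynomial.C (T x i j), fun t => by
      simp only [degeneration_apply, Polynomial.eval_mul, Polynomial.eval_pow, Polynomial.eval_X,
        Polynomial.eval_C]⟩
  · intro c
    exact ⟨Polynomial.C c, fun t => by simp⟩
  · rintro f g _ _ ⟨p, hp⟩ ⟨q, hq⟩
    exact ⟨p + q, fun t => by simp [hp, hq]⟩
  · rintro f g _ _ ⟨p, hp⟩ ⟨q, hq⟩
    exact ⟨p * q, fun t => by simp [hp, hq]⟩

theorem degeneration_conj {T : Rep L n} (hT : IsTriangular T) {t : ℂ} (ht : t ≠ 0) :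
    ∃ g : GL (Fin n) ℂ, ∀ x, degeneration hT t x = g.val * T x * (g⁻¹).val := by
  have hd : IsUnit (Matrix.diagonal fun i : Fin n => (t⁻¹) ^ i.val) := by
    rw [Matrix.isUnit_iff_isUnit_det, Matrix.det_diagonal, isUnit_iff_ne_zero,
      Finset.prod_ne_zero_iff]
    exact fun i _ => pow_ne_zero _ (inv_ne_zero ht)
  obtain ⟨g, hg⟩ := hd
  refine ⟨g, fun x => ?_⟩
  rw [Units.eq_mul_inv_iff_mul_eq, hg]
  ext i j
  rw [Matrix.mul_diagonal, Matrix.diagonal_mul, degeneration_apply]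
  by_cases h : j < i
  · rw [hT x i j h, mul_zero, zero_mul, mul_zero]
  · have e : j.val = i.val + (j.val - i.val) := by
      have : i.val ≤ j.val := not_lt.1 h
      omega
    have h2 : t ^ (j.val - i.val) * t⁻¹ ^ j.val = t⁻¹ ^ i.val := by
      conv_lhs => rw [e, Nat.add_sub_cancel_left, pow_add, mul_left_comm, ← mul_pow,
        mul_inv_cancel₀ ht, one_pow, mul_one]
    rw [mul_right_comm, h2]

/-- A triangular representation and its diagonal are not separated by invariants. -/
theorem quotientMap_eq_diagRep {T : Rep L n} (hT : IsTriangular T) {χ : Fin n → L →ₗ[ℂ] ℂ}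
    (hχ : ∀ i, ∀ x y : L, χ i ⁅x, y⁆ = 0) (h : ∀ i, χ i = diagEntry T i) :
    quotientMap T = quotientMap (diagRep χ hχ) := by
  rw [quotientMap_eq_iff]
  intro f
  obtain ⟨p, hp⟩ := exists_polynomial_degeneration hT f.2.1
  have h0 : degeneration hT 0 = diagRep χ hχ := by
    ext x i j
    rw [degeneration_apply, diagRep_apply, Matrix.diagonal_apply]
    rcases lt_trichotomy i j with hij | rfl | hij
    · have : j.val - i.val ≠ 0 := by
        have : i.val < j.val := hij
        omega
      rw [zero_pow this, zero_mul, if_neg hij.ne]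
    · simp [h, diagEntry]
    · rw [hT x i j hij, mul_zero, if_neg hij.ne']
  -- An invariant is constant along the degeneration for nonzero `t`, and being polynomial in `t` it
  -- is constant at 0 as well.
  have h1 : p = Polynomial.C (f.1 T) := by
    refine Polynomial.eq_of_infinite_eval_eq _ _ (Set.Infinite.mono (s := {t | t ≠ 0}) ?_
      (Set.Finite.infinite_compl (Set.finite_singleton (0 : ℂ))))
    intro t ht
    obtain ⟨g, hg⟩ := degeneration_conj hT ht
    simp only [Set.mem_ofPred_eq, Polynomial.eval_C]
    rw [← hp]
    exact f.2.2 g T _ hg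
  rw [← h0, hp, h1, Polynomial.eval_C]

/-- The coefficients of the characteristic polynomial are invariants. -/
theorem exists_charpoly_invariant (x : L) (k : ℕ) :
    ∃ f : invariantRing L n, ∀ ρ : Rep L n, f.1 ρ = (ρ x).charpoly.coeff k := by
  -- The generic matrix: its characteristic polynomial has regular coefficients and specializes at
  -- every `ρ`.
  let M : Matrix (Fin n) (Fin n) (repCoordRing L n) := Matrix.of fun i j =>
    ⟨fun ρ => ρ x i j, Algebra.subset_adjoin ⟨x, i, j, rfl⟩⟩
  have hM : ∀ ρ : Rep L n, (M.charpoly.coeff k).1 ρ = (ρ x).charpoly.coeff k := by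
    intro ρ
    let ev : repCoordRing L n →+* ℂ := (Pi.evalRingHom (fun _ : Rep L n => ℂ) ρ).comp
      (repCoordRing L n).val.toRingHom
    have h1 : M.map ev = ρ x := rfl
    rw [← h1, Matrix.charpoly_map, Polynomial.coeff_map]
    rfl
  refine ⟨⟨(M.charpoly.coeff k).1, (M.charpoly.coeff k).2, fun g ρ ρ' h => ?_⟩, hM⟩
  rw [hM, hM, h]
  rw [Matrix.coe_units_inv, Matrix.charpoly_units_conj]

theorem charpoly_eq_of_quotientMap_eq {ρ₁ ρ₂ : Rep L n} (h : quotientMap ρ₁ = quotientMap ρ₂)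
    (x : L) : (ρ₁ x).charpoly = (ρ₂ x).charpoly := by
  ext k
  obtain ⟨f, hf⟩ := exists_charpoly_invariant (n := n) x k
  rw [← hf, ← hf]
  exact quotientMap_eq_iff.1 h f

theorem exists_conj_of_quotientMap_diagRep_eq {χ₁ χ₂ : Fin n → L →ₗ[ℂ] ℂ}
    (hχ₁ : ∀ i, ∀ x y : L, χ₁ i ⁅x, y⁆ = 0) (hχ₂ : ∀ i, ∀ x y : L, χ₂ i ⁅x, y⁆ = 0)
    (h : quotientMap (diagRep χ₁ hχ₁) = quotientMap (diagRep χ₂ hχ₂)) :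
    ∃ g : GL (Fin n) ℂ, ∀ x, diagRep χ₁ hχ₁ x = g.val * diagRep χ₂ hχ₂ x * (g⁻¹).val := by
  obtain ⟨σ, hσ⟩ := exists_perm_of_charpoly_eq fun x => charpoly_eq_of_quotientMap_eq h x
  obtain ⟨g, hg⟩ := exists_conj_diagonal_perm σ
  refine ⟨g, fun x => ?_⟩
  rw [diagRep_apply, diagRep_apply, ← hg]
  congr 1
  ext i
  rw [hσ]
  rfl

end Invariants

/-! ### Surjectivity of the quotient map -/

section Surjectivity

variable {L : Type*} [LieRing L] [LieAlgebra ℂ L] {n : ℕ}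

variable (L n) in
/-- Families of characters. -/
abbrev Characters : Type _ := {χ : Fin n → L →ₗ[ℂ] ℂ // ∀ i, ∀ x y : L, χ i ⁅x, y⁆ = 0}

/-- A coordinate function on families of characters. -/
def charCoord (i : Fin n) (x : L) : Characters L n → ℂ := fun χ => χ.1 i x

variable (L n) in
/-- The regular functions on families of characters. -/
def charCoordRing : Subalgebra ℂ (Characters L n → ℂ) :=
  Algebra.adjoin ℂ (Set.range fun p : Fin n × L => charCoord p.1 p.2)

variable (L n) in
/-- Restriction of invariants to diagonal representations. -/
def restrictInvariant : invariantRing L n →ₐ[ℂ] charCoordRing L n :=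
  AlgHom.codRestrict
    { toFun := fun f χ => f.1 (diagRep χ.1 χ.2)
      map_one' := rfl
      map_mul' := fun _ _ => rfl
      map_zero' := rfl
      map_add' := fun _ _ => rfl
      commutes' := fun _ => rfl } (charCoordRing L n) (fun f => by
    change (fun χ : Characters L n => f.1 (diagRep χ.1 χ.2)) ∈ charCoordRing L n
    refine Algebra.adjoin_induction (p := fun f _ =>
      (fun χ : Characters L n => f (diagRep χ.1 χ.2)) ∈ charCoordRing L n) ?_ ?_ ?_ ?_ f.2.1
    · rintro _ ⟨x, i, j, rfl⟩
      by_cases h : i = j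
      · have : (fun χ : Characters L n => diagRep χ.1 χ.2 x i j) = charCoord i x := by
          funext χ
          rw [diagRep_apply, h, Matrix.diagonal_apply_eq]
          rfl
        rw [this]
        exact Algebra.subset_adjoin ⟨(i, x), rfl⟩
      · have : (fun χ : Characters L n => diagRep χ.1 χ.2 x i j) = 0 := by
          funext χ
          rw [diagRep_apply, Matrix.diagonal_apply_ne _ h]
          rfl
        rw [this]
        exact zero_mem _
    · exact fun c => Subalgebra.algebraMap_mem _ c
    · exact fun f g _ _ hf hg => add_mem hf hg
    · exact fun f g _ _ hf hg => mul_mem hf hg)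

theorem restrictInvariant_apply (f : invariantRing L n) (χ : Characters L n) :
    (restrictInvariant L n f).1 χ = f.1 (diagRep χ.1 χ.2) := rfl

theorem exists_diagRep_quotientMap_eq [LieAlgebra.IsSolvable L] (ρ : Rep L n) :
    ∃ χ : Characters L n, quotientMap ρ = quotientMap (diagRep χ.1 χ.2) := by
  obtain ⟨P, T, hP, hT⟩ := exists_conj_triangular ρ
  refine ⟨⟨diagEntry T, fun i => IsTriangular.diagEntry_lie hT i⟩, ?_⟩
  rw [← quotientMap_eq_diagRep hT (fun i => IsTriangular.diagEntry_lie hT i) fun _ => rfl]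
  exact (quotientMap_eq_of_conj P⁻¹ (by simpa using hP)).symm

/-- Every representation is inseparable by invariants from a diagonal one, by triangularization and
degeneration. -/
theorem restrictInvariant_injective [LieAlgebra.IsSolvable L] :
    Function.Injective (restrictInvariant L n) := by
  intro f g h
  refine Subtype.ext (funext fun ρ => ?_)
  obtain ⟨χ, hχ⟩ := exists_diagRep_quotientMap_eq ρ
  rw [quotientMap_eq_iff.1 hχ f, quotientMap_eq_iff.1 hχ g, ← restrictInvariant_apply,
    ← restrictInvariant_apply, h]

/-- Each coordinate function of a character is a root of the characteristic polynomial of the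
diagonal matrix, which is monic with coefficients that are restrictions of invariants. -/
theorem restrictInvariant_isIntegral : (restrictInvariant L n).toRingHom.IsIntegral := by
  have hgen : ∀ i x, (restrictInvariant L n).toRingHom.IsIntegralElem
      ⟨charCoord i x, Algebra.subset_adjoin ⟨(i, x), rfl⟩⟩ := by
    intro i x
    choose c hc using exists_charpoly_invariant (n := n) x
    refine ⟨Polynomial.X ^ n + ∑ k : Fin n, Polynomial.C (c k) * Polynomial.X ^ k.val,
      Polynomial.monic_X_pow_add (Polynomial.degree_sum_fin_lt _), ?_⟩
    rw [Polynomial.eval₂_add, Polynomial.eval₂_finsetSum]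
    simp only [Polynomial.eval₂_mul, Polynomial.eval₂_C, Polynomial.eval₂_pow, Polynomial.eval₂_X]
    refine Subtype.ext (funext fun χ => ?_)
    let M := diagRep χ.1 χ.2 x
    have h1 : M.charpoly.eval (χ.1 i x) = 0 := by
      change (Matrix.diagonal fun i => χ.1 i x).charpoly.eval (χ.1 i x) = 0
      rw [Matrix.charpoly_diagonal, Polynomial.eval_prod]
      exact Finset.prod_eq_zero (Finset.mem_univ i) (by simp)
    have hdeg : M.charpoly.natDegree = n := by simp [Matrix.charpoly_natDegree_eq_dim]
    have hmon : M.charpoly.coeff n = 1 := by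
      have := Matrix.charpoly_monic M
      rwa [Polynomial.Monic, Polynomial.leadingCoeff, hdeg] at this
    rw [Polynomial.eval_eq_sum_range, hdeg, Finset.sum_range_succ, hmon, one_mul,
      ← Fin.sum_univ_eq_sum_range (fun k => M.charpoly.coeff k * χ.1 i x ^ k), add_comm] at h1
    simp only [M, ← hc] at h1
    have h2 : ∀ s : charCoordRing L n, ∀ t : Fin n → charCoordRing L n,
        (s + ∑ k, t k).1 χ = s.1 χ + ∑ k, (t k).1 χ := by
      intro s t
      rw [AddMemClass.coe_add, Pi.add_apply, AddSubmonoidClass.coe_finsetSum, Finset.sum_apply]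
    rw [h2]
    exact h1
  rintro ⟨s, hs⟩
  refine Algebra.adjoin_induction (p := fun s hs => (restrictInvariant L n).toRingHom.IsIntegralElem
    (⟨s, hs⟩ : charCoordRing L n)) ?_ ?_ ?_ ?_ hs
  · rintro _ ⟨⟨i, x⟩, rfl⟩
    exact hgen i x
  · intro c
    have := (restrictInvariant L n).toRingHom.isIntegralElem_map (x := algebraMap ℂ _ c)
    exact this
  · intro f g hf hg h1 h2
    exact RingHom.IsIntegralElem.add _ h1 h2
  · intro f g hf hg h1 h2
    exact RingHom.IsIntegralElem.mul _ h1 h2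

theorem charCoordRing_finiteType [FiniteDimensional ℂ L] :
    Algebra.FiniteType ℂ (charCoordRing L n) := by
  rw [← Subalgebra.fg_iff_finiteType, Subalgebra.fg_def]
  let b := Module.finBasis ℂ L
  refine ⟨Set.range fun p : Fin n × Fin (Module.finrank ℂ L) => charCoord p.1 (b p.2),
    Set.finite_range _, le_antisymm ?_ ?_⟩
  · refine Algebra.adjoin_mono ?_
    rintro _ ⟨p, rfl⟩
    exact ⟨(p.1, b p.2), rfl⟩
  · refine Algebra.adjoin_le ?_
    rintro _ ⟨⟨i, x⟩, rfl⟩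
    have : charCoord (n := n) i x = ∑ k, b.repr x k • charCoord (n := n) i (b k) := by
      funext χ
      rw [Finset.sum_apply]
      change χ.1 i x = ∑ k, b.repr x k • χ.1 i (b k)
      conv_lhs => rw [← b.sum_repr x, map_sum]
      simp only [map_smul]
    change charCoord i x ∈ Algebra.adjoin ℂ _
    rw [this]
    exact Subalgebra.sum_mem _ fun k _ => Subalgebra.smul_mem _
      (Algebra.subset_adjoin (Set.mem_range_self (i, k))) _

/-- The points of `charCoordRing` are families of characters. -/
theorem exists_characters_of_algHom (φ : charCoordRing L n →ₐ[ℂ] ℂ) :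
    ∃ χ : Characters L n, ∀ s, φ s = s.1 χ := by
  let coord : Fin n → L → charCoordRing L n := fun i x =>
    ⟨charCoord i x, Algebra.subset_adjoin ⟨(i, x), rfl⟩⟩
  have hadd : ∀ i x y, coord i (x + y) = coord i x + coord i y := fun i x y =>
    Subtype.ext (funext fun χ => map_add (χ.1 i) x y)
  have hsmul : ∀ i (c : ℂ) x, coord i (c • x) = c • coord i x := fun i c x =>
    Subtype.ext (funext fun χ => map_smul (χ.1 i) c x)
  have hlie : ∀ i (x y : L), coord i ⁅x, y⁆ = 0 := fun i x y =>
    Subtype.ext (funext fun χ => χ.2 i x y)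
  let χ : Characters L n := ⟨fun i =>
    { toFun := fun x => φ (coord i x)
      map_add' := fun x y => by rw [hadd, map_add]
      map_smul' := fun c x => by rw [hsmul, map_smul, RingHom.id_apply] },
    fun i x y => by
      change φ (coord i ⁅x, y⁆) = 0
      rw [hlie, map_zero]⟩
  refine ⟨χ, ?_⟩
  rintro ⟨s, hs⟩
  refine Algebra.adjoin_induction (p := fun s hs => φ ⟨s, hs⟩ = s χ) ?_ ?_ ?_ ?_ hs
  · rintro _ ⟨⟨i, x⟩, rfl⟩
    rfl
  · exact fun c => φ.commutes c
  · intro f g hf hg h1 h2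
    rw [Pi.add_apply, ← h1, ← h2, ← map_add]
    rfl
  · intro f g hf hg h1 h2
    rw [Pi.mul_apply, ← h1, ← h2, ← map_mul]
    rfl

/-- The quotient map is surjective. -/
theorem quotientMap_surjective [FiniteDimensional ℂ L] [LieAlgebra.IsSolvable L] :
    Function.Surjective (quotientMap (𝔫 := L) (n := n)) := by
  intro m
  let _ : Algebra (invariantRing L n) (charCoordRing L n) :=
    (restrictInvariant L n).toRingHom.toAlgebra
  have _ : Algebra.IsIntegral (invariantRing L n) (charCoordRing L n) :=
    ⟨restrictInvariant_isIntegral⟩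
  have hm := m.isMaximal
  -- Lying over gives a maximal ideal upstairs. Its residue field is ℂ by the Nullstellensatz, so it
  -- is a point, that is, a family of characters.
  obtain ⟨Q, hQ, hQm⟩ := Ideal.exists_ideal_over_maximal_of_isIntegral
    (S := charCoordRing L n) m.asIdeal (by
      have : RingHom.ker (algebraMap (invariantRing L n) (charCoordRing L n)) = ⊥ :=
        (RingHom.injective_iff_ker_eq_bot _).1 restrictInvariant_injective
      rw [this]
      exact bot_le)
  let _ : Field (charCoordRing L n ⧸ Q) := Ideal.Quotient.field Q
  have _ : Algebra.FiniteType ℂ (charCoordRing L n) := charCoordRing_finiteType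
  have _ : Module.Finite ℂ (charCoordRing L n ⧸ Q) :=
    finite_of_finite_type_of_isJacobsonRing ℂ _
  have _ : Algebra.IsIntegral ℂ (charCoordRing L n ⧸ Q) := Algebra.IsIntegral.of_finite ℂ _
  have hbij := IsAlgClosed.algebraMap_bijective_of_isIntegral
    (k := ℂ) (K := charCoordRing L n ⧸ Q)
  let E : ℂ ≃ₐ[ℂ] charCoordRing L n ⧸ Q :=
    AlgEquiv.ofBijective (Algebra.ofId ℂ (charCoordRing L n ⧸ Q)) hbij
  obtain ⟨χ, hχ⟩ := exists_characters_of_algHom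
    (E.symm.toAlgHom.comp (Ideal.Quotient.mkₐ ℂ Q))
  refine ⟨diagRep χ.1 χ.2, MaximalSpectrum.ext ?_⟩
  rw [← hQm]
  ext f
  rw [Ideal.mem_comap]
  change f.1 (diagRep χ.1 χ.2) = 0 ↔ restrictInvariant L n f ∈ Q
  rw [← restrictInvariant_apply, ← hχ, ← Ideal.Quotient.eq_zero_iff_mem]
  change E.symm (Ideal.Quotient.mk Q _) = 0 ↔ _
  exact map_eq_zero_iff _ E.symm.injective

end Surjectivity

end InvDMod

end

noncomputable section

namespace InvDMod

/-! ### Trace criterion and locally nilpotent derivations -/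

section NilpotentMatrices

variable {N : ℕ}

/-- A complex matrix all of whose powers have trace zero is nilpotent. -/
theorem isNilpotent_of_trace_pow_eq_zero {M : Matrix (Fin N) (Fin N) ℂ}
    (hM : ∀ k : ℕ, (M ^ (k + 1)).trace = 0) : IsNilpotent M := by
  obtain ⟨q, hq, hndvd⟩ := Polynomial.exists_eq_pow_rootMultiplicity_mul_and_not_dvd M.charpoly
    M.charpoly_monic.ne_zero 0
  set a := M.charpoly.rootMultiplicity 0
  rw [Polynomial.C_0, sub_zero] at hq hndvd
  -- The Bézout relation gives the idempotent `e` onto the part with nonzero eigenvalues. The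
  -- exponent `a + 1` makes `e` divisible by `X` even for a = 0, so its trace vanishes and therefore
  -- e = 0.
  have hco : IsCoprime (Polynomial.X ^ (a + 1) : Polynomial ℂ) q :=
    ((Polynomial.irreducible_X).coprime_iff_not_dvd.2 hndvd).pow_left
  obtain ⟨u, v, huv⟩ := hco
  have hch : Polynomial.aeval M (Polynomial.X ^ a * q) = 0 := by
    rw [← hq, Matrix.aeval_self_charpoly]
  set e := Polynomial.aeval M (u * Polynomial.X ^ (a + 1)) with he
  have hone : e + Polynomial.aeval M (v * q) = 1 := by rw [he, ← map_add, huv, map_one]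
  have hidem : IsIdempotentElem e := by
    have h0 : e * Polynomial.aeval M (v * q) = 0 := by
      rw [he, ← map_mul, show u * Polynomial.X ^ (a + 1) * (v * q)
        = u * v * Polynomial.X * (Polynomial.X ^ a * q) by ring, map_mul, hch, mul_zero]
    rw [IsIdempotentElem, ← add_zero (e * e), ← h0, ← mul_add, hone, mul_one]
  have htr : ∀ r : Polynomial ℂ, (Polynomial.aeval M (r * Polynomial.X)).trace = 0 := by
    intro r
    induction r using Polynomial.induction_on' with
    | add p q hp hq => rw [add_mul, map_add, Matrix.trace_add, hp, hq, add_zero]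
    | monomial k c =>
      rw [Polynomial.monomial_mul_X, Polynomial.aeval_monomial, ← Algebra.smul_def,
        Matrix.trace_smul, hM, smul_zero]
  have he0 : e = 0 := by
    have h1 : IsIdempotentElem (Matrix.toLin' e) := by
      rw [IsIdempotentElem, Module.End.mul_eq_comp, ← Matrix.toLin'_mul, hidem.eq]
    have h2 : LinearMap.trace ℂ _ (Matrix.toLin' e) = 0 := by
      rw [Matrix.trace_toLin'_eq, he, pow_succ, ← mul_assoc, htr]
    exact Matrix.toLin'.map_eq_zero_iff.1 ((LinearMap.IsIdempotentElem.trace_eq_zero_iff h1).1 h2)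
  refine ⟨a, ?_⟩
  rw [he0, zero_add] at hone
  rw [← mul_one (M ^ a), ← hone, ← Polynomial.aeval_X_pow (R := ℂ) M, ← map_mul,
    mul_left_comm, map_mul, hch, mul_zero]

theorem pow_eq_zero_of_isNilpotent {M : Matrix (Fin N) (Fin N) ℂ} (hM : IsNilpotent M) :
    M ^ N = 0 := by
  have h := (Matrix.isNilpotent_charpoly_sub_pow_of_isNilpotent hM).eq_zero
  have h2 := Matrix.aeval_self_charpoly M
  rwa [sub_eq_zero.1 h, Polynomial.aeval_X_pow, Fintype.card_fin] at h2

end NilpotentMatrices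

section LocallyNilpotent

variable {A : Type*} [CommRing A] [Algebra ℂ A]

theorem derivation_pow_mul_eq_zero (v : Derivation ℂ A A) {s k l : ℕ} (hs : k + l = s) {f g : A}
    (hf : ((v : A →ₗ[ℂ] A) ^ k) f = 0) (hg : ((v : A →ₗ[ℂ] A) ^ l) g = 0) :
    ((v : A →ₗ[ℂ] A) ^ s) (f * g) = 0 := by
  induction s generalizing k l f g with
  | zero =>
    obtain rfl : k = 0 := by omega
    have : f = 0 := by simpa using hf
    simp [this]
  | succ s ih =>
    rcases k with _ | k
    · have : f = 0 := by simpa using hf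
      simp [this]
    rcases l with _ | l
    · have : g = 0 := by simpa using hg
      simp [this]
    rw [pow_succ, Module.End.mul_apply, Derivation.coeFn_coe, Derivation.leibniz, map_add,
      smul_eq_mul, smul_eq_mul, mul_comm g,
      ih (by omega) hf (by rwa [pow_succ] at hg : ((v : A →ₗ[ℂ] A) ^ l) (v g) = 0),
      ih (by omega) (by rwa [pow_succ] at hf : ((v : A →ₗ[ℂ] A) ^ k) (v f) = 0) hg, add_zero]

/-- The elements on which a derivation is locally nilpotent. -/
def nilpotentPart (v : Derivation ℂ A A) : Subalgebra ℂ A where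
  carrier := {f | ∃ m : ℕ, ((v : A →ₗ[ℂ] A) ^ m) f = 0}
  mul_mem' := by
    rintro f g ⟨k, hk⟩ ⟨l, hl⟩
    exact ⟨k + l, derivation_pow_mul_eq_zero v rfl hk hl⟩
  add_mem' := by
    rintro f g ⟨k, hk⟩ ⟨l, hl⟩
    refine ⟨k + l, ?_⟩
    rw [map_add, pow_add, Module.End.mul_apply, Module.End.mul_apply, hl, map_zero, add_zero,
      ← Module.End.mul_apply, ← pow_add, add_comm, pow_add, Module.End.mul_apply, hk, map_zero]
  algebraMap_mem' := fun c => ⟨1, by simp⟩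

theorem pow_apply_of_map_eq {N : ℕ} {v : Derivation ℂ A A} {H : Matrix (Fin N) (Fin N) A}
    {X : Matrix (Fin N) (Fin N) ℂ} (h : H.map v = H * X.map (algebraMap ℂ A)) (k : ℕ)
    (i j : Fin N) : ((v : A →ₗ[ℂ] A) ^ k) (H i j) = (H * (X ^ k).map (algebraMap ℂ A)) i j := by
  induction k generalizing i j with
  | zero => simp [Matrix.map_one]
  | succ k ih =>
    rw [pow_succ', Module.End.mul_apply, ih, Derivation.coeFn_coe, ← Matrix.map_apply (f := v),
      derivation_matrix_mul, derivation_const, mul_zero, add_zero, h, pow_succ', Matrix.map_mul,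
      mul_assoc]

theorem mem_nilpotentPart_of_map_eq {N : ℕ} {v : Derivation ℂ A A} {H : Matrix (Fin N) (Fin N) A}
    {X : Matrix (Fin N) (Fin N) ℂ} (h : H.map v = H * X.map (algebraMap ℂ A)) {k : ℕ}
    (hX : X ^ k = 0) (i j : Fin N) : H i j ∈ nilpotentPart v :=
  ⟨k, by rw [pow_apply_of_map_eq h, hX, Matrix.map_zero _ (map_zero _), mul_zero,
    Matrix.zero_apply]⟩

/-- Applying `v` repeatedly to the constant trace of `H` gives zero, but it also gives the trace of
H X^(k+1), whose value at `ε` is the trace of X^(k+1). -/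
theorem trace_pow_eq_zero_of_map_eq {N : ℕ} {v : Derivation ℂ A A} {H : Matrix (Fin N) (Fin N) A}
    {X : Matrix (Fin N) (Fin N) ℂ} (h : H.map v = H * X.map (algebraMap ℂ A)) {c : ℂ}
    (htr : H.trace = algebraMap ℂ A c) (ε : A →ₐ[ℂ] ℂ) (hε : H.map ε = 1) (k : ℕ) :
    (X ^ (k + 1)).trace = 0 := by
  have h1 : (H * (X ^ (k + 1)).map (algebraMap ℂ A)).trace = 0 := by
    have : (H * (X ^ (k + 1)).map (algebraMap ℂ A)).trace
        = ((v : A →ₗ[ℂ] A) ^ (k + 1)) H.trace := by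
      simp only [Matrix.trace, map_sum, Matrix.diag_apply, pow_apply_of_map_eq h]
    rw [this, htr, pow_succ, Module.End.mul_apply, Derivation.coeFn_coe, Derivation.map_algebraMap,
      map_zero]
  have h2 : ∀ M : Matrix (Fin N) (Fin N) A, ε M.trace = (M.map ε).trace := fun M => by
    simp only [Matrix.trace, map_sum, Matrix.diag_apply, Matrix.map_apply]
  have h3 : ((X ^ (k + 1)).map (algebraMap ℂ A)).map ε = X ^ (k + 1) := by
    ext1 i j
    exact ε.commutes _
  rw [← h3, ← one_mul (((X ^ (k + 1)).map (algebraMap ℂ A)).map ε), ← hε, ← Matrix.map_mul, ← h2,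
    h1, map_zero]

end LocallyNilpotent

/-! ### One-parameter subgroups through unipotent matrices -/

section PolynomialFunctions

/-- The polynomial functions on the line. -/
def polyFun : Subalgebra ℂ (ℂ → ℂ) := (Polynomial.aeval (id : ℂ → ℂ)).range

theorem mem_polyFun {f : ℂ → ℂ} : f ∈ polyFun ↔ ∃ p : Polynomial ℂ, ∀ t, f t = p.eval t := by
  refine exists_congr fun p => ⟨?_, fun h => ?_⟩
  · rintro rfl t
    exact Polynomial.aeval_fn_apply p id t
  · exact funext fun t => (Polynomial.aeval_fn_apply p id t).trans (h t).symm

theorem eval_mem_polyFun (p : Polynomial ℂ) : (fun t => p.eval t) ∈ polyFun :=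
  mem_polyFun.2 ⟨p, fun _ => rfl⟩

theorem const_mem_polyFun (c : ℂ) : (fun _ => c) ∈ polyFun := polyFun.algebraMap_mem c

theorem comp_mem_polyFun {f : ℂ → ℂ} (hf : f ∈ polyFun) (p : Polynomial ℂ) :
    (fun t => f (p.eval t)) ∈ polyFun := by
  obtain ⟨q, hq⟩ := mem_polyFun.1 hf
  exact mem_polyFun.2 ⟨q.comp p, fun t => by rw [hq, Polynomial.eval_comp]⟩

theorem eq_of_mem_polyFun {f g : ℂ → ℂ} (hf : f ∈ polyFun) (hg : g ∈ polyFun)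
    (h : ∀ k : ℕ, f k = g k) : f = g := by
  obtain ⟨p, hp⟩ := mem_polyFun.1 hf
  obtain ⟨q, hq⟩ := mem_polyFun.1 hg
  have : p = q := by
    refine Polynomial.eq_of_infinite_eval_eq p q
      ((Set.infinite_range_of_injective (Nat.cast_injective (R := ℂ))).mono ?_)
    rintro _ ⟨k, rfl⟩
    exact (hp k).symm.trans ((h k).trans (hq k))
  exact funext fun t => by rw [hp, hq, this]

theorem differentiable_of_mem_polyFun {f : ℂ → ℂ} (hf : f ∈ polyFun) : Differentiable ℂ f := by
  obtain ⟨p, hp⟩ := mem_polyFun.1 hf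
  rw [funext hp]
  exact p.differentiable

theorem sum_mul_mem_polyFun {ι : Type*} (s : Finset ι) {f g : ι → ℂ → ℂ}
    (hf : ∀ i, f i ∈ polyFun) (hg : ∀ i, g i ∈ polyFun) :
    (fun t => ∑ i ∈ s, f i t * g i t) ∈ polyFun := by
  have : (fun t => ∑ i ∈ s, f i t * g i t) = ∑ i ∈ s, f i * g i := by
    ext t
    simp
  rw [this]
  exact sum_mem fun i _ => mul_mem (hf i) (hg i)

end PolynomialFunctions

section UnipotentPowers

variable {N : ℕ}

/-- The power `(1 + M) ^ t` of a unipotent matrix with complex exponent. -/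
def unipotentPow (M : Matrix (Fin N) (Fin N) ℂ) (t : ℂ) : Matrix (Fin N) (Fin N) ℂ :=
  ∑ k ∈ Finset.range N, ((k.factorial : ℂ)⁻¹ * (descPochhammer ℂ k).eval t) • M ^ k

theorem unipotentPow_mem_polyFun (M : Matrix (Fin N) (Fin N) ℂ) (i j : Fin N) :
    (fun t => unipotentPow M t i j) ∈ polyFun := by
  have : (fun t => unipotentPow M t i j) = fun t => ∑ k ∈ Finset.range N,
      (descPochhammer ℂ k).eval t * ((k.factorial : ℂ)⁻¹ * (M ^ k) i j) := by
    ext t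
    simp only [unipotentPow, Matrix.sum_apply, Matrix.smul_apply, smul_eq_mul]
    exact Finset.sum_congr rfl fun k _ => by ring
  rw [this]
  exact sum_mul_mem_polyFun _ (fun k => eval_mem_polyFun _) fun k => const_mem_polyFun _

theorem unipotentPow_natCast {M : Matrix (Fin N) (Fin N) ℂ} (hM : M ^ N = 0) (m : ℕ) :
    unipotentPow M m = (1 + M) ^ m := by
  have hchoose : ∀ k : ℕ, (k.factorial : ℂ)⁻¹ * (descPochhammer ℂ k).eval (m : ℂ)
      = (m.choose k : ℂ) := by
    intro k
    rw [descPochhammer_eval_eq_descFactorial, Nat.descFactorial_eq_factorial_mul_choose,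
      Nat.cast_mul, inv_mul_cancel_left₀ (Nat.cast_ne_zero.2 k.factorial_ne_zero)]
  rw [add_comm, (Commute.one_right M).add_pow, unipotentPow]
  simp only [hchoose, one_pow, mul_one]
  have h1 : ∑ k ∈ Finset.range N, (m.choose k : ℂ) • M ^ k
      = ∑ k ∈ Finset.range (N + (m + 1)), (m.choose k : ℂ) • M ^ k := by
    refine Finset.sum_subset (Finset.range_mono (by omega)) fun k _ hk => ?_
    rw [pow_eq_zero_of_le (by simpa using hk) hM, smul_zero]
  have h2 : ∑ k ∈ Finset.range (m + 1), (m.choose k : ℂ) • M ^ k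
      = ∑ k ∈ Finset.range (N + (m + 1)), (m.choose k : ℂ) • M ^ k := by
    refine Finset.sum_subset (Finset.range_mono (by omega)) fun k _ hk => ?_
    rw [Nat.choose_eq_zero_of_lt (by simpa using hk), Nat.cast_zero, zero_smul]
  rw [h1, ← h2]
  refine Finset.sum_congr rfl fun k _ => ?_
  rw [← Nat.cast_comm, ← nsmul_eq_mul, Nat.cast_smul_eq_nsmul]

theorem unipotentPow_add {M : Matrix (Fin N) (Fin N) ℂ} (hM : M ^ N = 0) (s t : ℂ) :
    unipotentPow M (s + t) = unipotentPow M s * unipotentPow M t := by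
  have hshift : ∀ (c : ℂ) i j, (fun s => unipotentPow M (s + c) i j) ∈ polyFun := by
    intro c i j
    have := comp_mem_polyFun (unipotentPow_mem_polyFun M i j) (Polynomial.X + Polynomial.C c)
    simpa using this
  -- Both sides are polynomial in each exponent. The identity is known for natural exponents and is
  -- extended to complex ones one variable at a time.
  have hnat : ∀ (m : ℕ) (t : ℂ),
      unipotentPow M (t + m) = unipotentPow M t * unipotentPow M m := by
    intro m t
    ext i j
    refine congrFun (eq_of_mem_polyFun (g := fun t => (unipotentPow M t * unipotentPow M m) i j)
      (hshift m i j) ?_ fun k => ?_) t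
    · simp only [Matrix.mul_apply]
      exact sum_mul_mem_polyFun _ (fun l => unipotentPow_mem_polyFun M i l)
        fun l => const_mem_polyFun _
    · rw [← Nat.cast_add, unipotentPow_natCast hM, unipotentPow_natCast hM,
        unipotentPow_natCast hM, pow_add]
  ext i j
  rw [add_comm]
  refine congrFun (eq_of_mem_polyFun (f := fun t => unipotentPow M (t + s) i j)
    (g := fun t => (unipotentPow M s * unipotentPow M t) i j) (hshift s i j) ?_ fun k => ?_) t
  · simp only [Matrix.mul_apply]
    exact sum_mul_mem_polyFun _ (fun l => const_mem_polyFun _)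
      fun l => unipotentPow_mem_polyFun M l j
  · rw [add_comm, hnat]

theorem unipotentPow_zero {M : Matrix (Fin N) (Fin N) ℂ} (hM : M ^ N = 0) :
    unipotentPow M 0 = 1 := by
  simpa using unipotentPow_natCast hM 0

theorem unipotentPow_one {M : Matrix (Fin N) (Fin N) ℂ} (hM : M ^ N = 0) :
    unipotentPow M 1 = 1 + M := by
  simpa using unipotentPow_natCast hM 1

/-- The one-parameter subgroup through a unipotent matrix. -/
def unipotentGL {M : Matrix (Fin N) (Fin N) ℂ} (hM : M ^ N = 0) (t : ℂ) : GL (Fin N) ℂ :=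
  ⟨unipotentPow M t, unipotentPow M (-t),
    by rw [← unipotentPow_add hM, add_neg_cancel, unipotentPow_zero hM],
    by rw [← unipotentPow_add hM, neg_add_cancel, unipotentPow_zero hM]⟩

variable {U : Subgroup (GL (Fin N) ℂ)}

/-- Each defining equation restricts to a polynomial in `t` that vanishes at all natural numbers,
where the curve passes through powers of `u`. -/
theorem IsZariskiClosed.unipotentGL_mem (hclosed : IsZariskiClosed U) {u : GL (Fin N) ℂ}
    (hu : u ∈ U) (hM : (u.val - 1) ^ N = 0) (t : ℂ) : unipotentGL hM t ∈ U := by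
  obtain ⟨S, hS⟩ := hclosed
  refine (hS _).2 fun p hp => ?_
  have hpoly : (fun t => MvPolynomial.eval
      (fun ij : Fin N × Fin N => unipotentPow (u.val - 1) t ij.1 ij.2) p) ∈ polyFun := by
    clear hp
    induction p using MvPolynomial.induction_on with
    | C c => simpa using const_mem_polyFun c
    | add p q hp hq =>
      simp only [map_add]
      exact add_mem hp hq
    | mul_X p ij hp =>
      simp only [map_mul, MvPolynomial.eval_X]
      exact mul_mem hp (unipotentPow_mem_polyFun (u.val - 1) ij.1 ij.2)
  refine congrFun (eq_of_mem_polyFun hpoly (const_mem_polyFun 0) fun k => ?_) t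
  have hk := (hS (u ^ k)).1 (pow_mem hu k) p hp
  rw [← hk, unipotentPow_natCast hM, add_sub_cancel]
  rfl

end UnipotentPowers

end InvDMod

end

noncomputable section

namespace InvDMod

/-! ### The Lie algebra of a unipotent group -/

section UnipotentGroups

variable {N : ℕ} {U : Subgroup (GL (Fin N) ℂ)}

/-- A matrix entry, as a regular function. -/
def entryFun (U : Subgroup (GL (Fin N) ℂ)) (i j : Fin N) : coordRing U :=
  ⟨fun g => g.val.val i j, Algebra.subset_adjoin (Or.inl ⟨i, j, rfl⟩)⟩

/-- Evaluation of regular functions at the unit element. -/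
def evalOne (U : Subgroup (GL (Fin N) ℂ)) : coordRing U →ₐ[ℂ] ℂ :=
  (Pi.evalAlgHom ℂ (fun _ : U => ℂ) 1).comp (coordRing U).val

theorem IsUnipotentGroup.sub_one_pow (hunip : IsUnipotentGroup U) (g : U) :
    (g.val.val - 1) ^ N = 0 :=
  pow_eq_zero_of_isNilpotent (hunip _ g.2)

/-- On a unipotent group the regular functions are generated by the matrix entries of `g`. -/
theorem IsUnipotentGroup.coordRing_le (hunip : IsUnipotentGroup U) {S : Subalgebra ℂ (U → ℂ)}
    (hS : ∀ i j, (fun g : U => g.val.val i j) ∈ S) : coordRing U ≤ S := by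
  refine Algebra.adjoin_le ?_
  rintro f (⟨i, j, rfl⟩ | ⟨i, j, rfl⟩)
  · exact hS i j
  · have hsub : ∀ i j, (fun g : U => (1 - g.val.val) i j) ∈ S := fun i j =>
      sub_mem (S.algebraMap_mem ((1 : Matrix (Fin N) (Fin N) ℂ) i j)) (hS i j)
    have hpow : ∀ (k : ℕ) i j, (fun g : U => ((1 - g.val.val) ^ k) i j) ∈ S := by
      intro k
      induction k with
      | zero =>
        intro i j
        simp only [pow_zero]
        exact S.algebraMap_mem ((1 : Matrix (Fin N) (Fin N) ℂ) i j)
      | succ k ih =>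
        intro i j
        have : (fun g : U => ((1 - g.val.val) ^ (k + 1)) i j) = ∑ l,
            (fun g : U => ((1 - g.val.val) ^ k) i l) * fun g : U => (1 - g.val.val) l j := by
          ext g
          rw [pow_succ, Matrix.mul_apply, Finset.sum_apply]
          rfl
        rw [this]
        exact sum_mem fun l _ => mul_mem (ih i l) (hsub l j)
    -- The inverse of a unipotent matrix is a finite geometric series in 1 - g.
    have hinv : (fun g : U => (g⁻¹).val.val i j)
        = ∑ k ∈ Finset.range N, fun g : U => ((1 - g.val.val) ^ k) i j := by
      ext g
      have h1 : (1 - g.val.val) ^ N = 0 := by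
        rw [← neg_sub, neg_pow, hunip.sub_one_pow g, mul_zero]
      have h2 : g.val.val * ∑ k ∈ Finset.range N, (1 - g.val.val) ^ k = 1 := by
        have := mul_neg_geom_sum (1 - g.val.val) N
        rwa [sub_sub_cancel, h1, sub_zero] at this
      have h3 : (g⁻¹).val.val = ∑ k ∈ Finset.range N, (1 - g.val.val) ^ k := by
        have h4 : (g⁻¹).val.val * g.val.val = 1 := g.val.inv_mul
        exact left_inv_eq_right_inv h4 h2
      rw [h3, Matrix.sum_apply, Finset.sum_apply]
    rw [hinv]
    exact sum_mem fun k _ => hpow k i j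

theorem IsUnipotentGroup.mem_of_entryFun_mem (hunip : IsUnipotentGroup U)
    {S : Subalgebra ℂ (coordRing U)} (hS : ∀ i j, entryFun U i j ∈ S) (f : coordRing U) : f ∈ S := by
  obtain ⟨f', h, e⟩ := hunip.coordRing_le (S := S.map (coordRing U).val)
    (fun i j => ⟨entryFun U i j, hS i j, rfl⟩) f.2
  rwa [← Subtype.ext e]

theorem apply_eq_evalOne_translate {v : Derivation ℂ (coordRing U) (coordRing U)}
    (hv : v ∈ lieAlg U) (f : coordRing U) (g : U) : (v f).1 g = evalOne U (v (translate U g f)) := by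
  rw [hv g f]
  change (v f).1 g = (v f).1 (g * 1)
  rw [mul_one]

/-- The matrix of an element of the Lie algebra. -/
def tangentMatrix (v : Derivation ℂ (coordRing U) (coordRing U)) : Matrix (Fin N) (Fin N) ℂ :=
  Matrix.of fun i j => evalOne U (v (entryFun U i j))

/-- Left translation by `g` multiplies the generic matrix by the constant matrix `g`. A left
invariant field is thus determined on entries by its value at the unit. -/
theorem map_entryFun {v : Derivation ℂ (coordRing U) (coordRing U)} (hv : v ∈ lieAlg U) :
    (Matrix.of (entryFun U)).map v
      = Matrix.of (entryFun U) * (tangentMatrix v).map (algebraMap ℂ (coordRing U)) := by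
  ext1 i j
  refine Subtype.ext (funext fun g => ?_)
  have h1 : translate U g (entryFun U i j) = ∑ k, g.val.val i k • entryFun U k j := by
    refine Subtype.ext (funext fun x => ?_)
    rw [AddSubmonoidClass.coe_finsetSum, Finset.sum_apply]
    exact Matrix.mul_apply (M := g.val.val) (N := x.val.val)
  rw [Matrix.map_apply, Matrix.of_apply, apply_eq_evalOne_translate hv, h1, map_sum, map_sum,
    Matrix.mul_apply, AddSubmonoidClass.coe_finsetSum, Finset.sum_apply]
  refine Finset.sum_congr rfl fun k _ => ?_
  rw [Derivation.map_smul, map_smul]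
  rfl

/-- The trace is the constant `N` on a unipotent group, so all positive powers of the tangent matrix
have trace zero. -/
theorem IsUnipotentGroup.isNilpotent_tangentMatrix (hunip : IsUnipotentGroup U)
    {v : Derivation ℂ (coordRing U) (coordRing U)} (hv : v ∈ lieAlg U) :
    IsNilpotent (tangentMatrix v) := by
  refine isNilpotent_of_trace_pow_eq_zero fun k =>
    trace_pow_eq_zero_of_map_eq (map_entryFun hv) (c := N) ?_ (evalOne U) ?_ k
  · refine Subtype.ext (funext fun g => ?_)
    have h1 : (g.val.val - 1).trace = 0 :=
      (Matrix.isNilpotent_trace_of_isNilpotent (hunip _ g.2)).eq_zero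
    rw [Matrix.trace_sub, Matrix.trace_one, Fintype.card_fin, sub_eq_zero] at h1
    rw [Matrix.trace, AddSubmonoidClass.coe_finsetSum, Finset.sum_apply]
    exact h1
  · ext1 i j
    rfl

theorem IsUnipotentGroup.mem_nilpotentPart (hunip : IsUnipotentGroup U)
    {v : Derivation ℂ (coordRing U) (coordRing U)} (hv : v ∈ lieAlg U) (f : coordRing U) :
    f ∈ nilpotentPart v := by
  obtain ⟨m, hm⟩ := hunip.isNilpotent_tangentMatrix hv
  exact hunip.mem_of_entryFun_mem
    (fun i j => mem_nilpotentPart_of_map_eq (map_entryFun hv) hm i j) f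

/-- The one-parameter subgroup of `U` through `u`. -/
def oneParam (hclosed : IsZariskiClosed U) (hunip : IsUnipotentGroup U) (u : U) (t : ℂ) : U :=
  ⟨unipotentGL (hunip.sub_one_pow u) t, hclosed.unipotentGL_mem u.2 (hunip.sub_one_pow u) t⟩

variable (hclosed : IsZariskiClosed U) (hunip : IsUnipotentGroup U) (u : U)

theorem oneParam_add (s t : ℂ) : oneParam hclosed hunip u (s + t)
    = oneParam hclosed hunip u s * oneParam hclosed hunip u t :=
  Subtype.ext (Units.ext (unipotentPow_add (hunip.sub_one_pow u) s t))

theorem oneParam_zero : oneParam hclosed hunip u 0 = 1 :=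
  Subtype.ext (Units.ext (unipotentPow_zero (hunip.sub_one_pow u)))

theorem oneParam_one : oneParam hclosed hunip u 1 = u :=
  Subtype.ext (Units.ext ((unipotentPow_one (hunip.sub_one_pow u)).trans (add_sub_cancel _ _)))

theorem oneParam_mem_polyFun (f : coordRing U) (g : U) :
    (fun t => f.1 (g * oneParam hclosed hunip u t)) ∈ polyFun := by
  have hr : f.1 ∈ polyFun.comap (AlgHom.pi fun t =>
      Pi.evalAlgHom ℂ (fun _ : U => ℂ) (g * oneParam hclosed hunip u t)) := by
    refine hunip.coordRing_le (fun i j => ?_) f.2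
    change (fun t => (g.val.val * unipotentPow (u.val.val - 1) t : Matrix (Fin N) (Fin N) ℂ) i j)
      ∈ polyFun
    simp only [Matrix.mul_apply]
    exact sum_mul_mem_polyFun _ (fun l => const_mem_polyFun _)
      fun l => unipotentPow_mem_polyFun _ l j
  exact hr

/-- The derivative of a function along a one-parameter subgroup. -/
def flowDeriv (f : U → ℂ) (g : U) : ℂ := deriv (fun t => f (g * oneParam hclosed hunip u t)) 0

theorem flowDeriv_mul (f f' : coordRing U) : flowDeriv hclosed hunip u (f.1 * f'.1)
    = f.1 * flowDeriv hclosed hunip u f'.1 + f'.1 * flowDeriv hclosed hunip u f.1 := by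
  ext g
  have h := deriv_fun_mul (differentiable_of_mem_polyFun (oneParam_mem_polyFun hclosed hunip u f g) 0)
    (differentiable_of_mem_polyFun (oneParam_mem_polyFun hclosed hunip u f' g) 0)
  rw [oneParam_zero, mul_one] at h
  refine h.trans ?_
  rw [add_comm, mul_comm (deriv _ _)]
  rfl

theorem flowDeriv_add (f f' : coordRing U) : flowDeriv hclosed hunip u (f.1 + f'.1)
    = flowDeriv hclosed hunip u f.1 + flowDeriv hclosed hunip u f'.1 := by
  ext g
  exact deriv_fun_add
    (differentiable_of_mem_polyFun (oneParam_mem_polyFun hclosed hunip u f g) 0)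
    (differentiable_of_mem_polyFun (oneParam_mem_polyFun hclosed hunip u f' g) 0)

theorem flowDeriv_algebraMap (c : ℂ) :
    flowDeriv hclosed hunip u (algebraMap ℂ (U → ℂ) c) = 0 :=
  funext fun _ => deriv_const (0 : ℂ) c

theorem flowDeriv_mem (f : coordRing U) : flowDeriv hclosed hunip u f.1 ∈ coordRing U := by
  let S : Subalgebra ℂ (coordRing U) :=
    { carrier := {f | flowDeriv hclosed hunip u f.1 ∈ coordRing U}
      mul_mem' := fun {f f'} hf hf' => by
        have := (coordRing U).add_mem ((coordRing U).mul_mem f.2 hf')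
          ((coordRing U).mul_mem f'.2 hf)
        rwa [← flowDeriv_mul] at this
      add_mem' := fun {f f'} hf hf' => by
        have := (coordRing U).add_mem hf hf'
        rwa [← flowDeriv_add] at this
      algebraMap_mem' := fun c => by
        have := (coordRing U).zero_mem
        rwa [← flowDeriv_algebraMap hclosed hunip u c] at this }
  refine hunip.mem_of_entryFun_mem (S := S) (fun i j => ?_) f
  have : flowDeriv hclosed hunip u (entryFun U i j).1 = ∑ k,
      deriv (fun t => unipotentPow (u.val.val - 1) t k j) 0 • (entryFun U i k).1 := by
    ext g
    have h1 : (fun t => (entryFun U i j).1 (g * oneParam hclosed hunip u t))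
        = fun t => ∑ k, g.val.val i k * unipotentPow (u.val.val - 1) t k j :=
      funext fun t => Matrix.mul_apply (M := g.val.val) (N := unipotentPow (u.val.val - 1) t)
    have h2 : ∀ k, DifferentiableAt ℂ (fun t => unipotentPow (u.val.val - 1) t k j) 0 := fun k =>
      differentiable_of_mem_polyFun (unipotentPow_mem_polyFun _ k j) 0
    rw [flowDeriv, h1, deriv_fun_sum fun k _ => (h2 k).const_mul _, Finset.sum_apply]
    refine Finset.sum_congr rfl fun k _ => ?_
    rw [deriv_const_mul _ (h2 k), mul_comm]
    rfl
  change flowDeriv hclosed hunip u (entryFun U i j).1 ∈ coordRing U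
  rw [this]
  exact sum_mem fun k _ => Subalgebra.smul_mem _ (entryFun U i k).2 _

/-- The left invariant vector field that generates a one-parameter subgroup. -/
def flowField : Derivation ℂ (coordRing U) (coordRing U) :=
  Derivation.mk'
    { toFun := fun f => ⟨flowDeriv hclosed hunip u f.1, flowDeriv_mem hclosed hunip u f⟩
      map_add' := fun f f' => Subtype.ext (flowDeriv_add hclosed hunip u f f')
      map_smul' := fun c f => Subtype.ext (by
        have h := flowDeriv_mul hclosed hunip u (algebraMap ℂ (coordRing U) c) f
        have h0 : flowDeriv hclosed hunip u (algebraMap ℂ (coordRing U) c).1 = 0 :=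
          flowDeriv_algebraMap hclosed hunip u c
        rw [h0, mul_zero, add_zero] at h
        rw [Algebra.smul_def]
        exact h) }
    fun f f' => Subtype.ext (flowDeriv_mul hclosed hunip u f f')

theorem flowField_mem : flowField hclosed hunip u ∈ lieAlg U := by
  intro g f
  refine Subtype.ext (funext fun x => ?_)
  change deriv (fun t => f.1 (g * (x * oneParam hclosed hunip u t))) 0
    = deriv (fun t => f.1 (g * x * oneParam hclosed hunip u t)) 0
  simp only [mul_assoc]

include hclosed hunip in
-- Along the one-parameter subgroup through `u` the derivative of `f` is the value of an invariant
-- field on `f`, hence zero. The curve joins the unit, at time 0, to `u`, at time 1.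
theorem eq_algebraMap_of_forall_lieAlg {f : coordRing U} (hf : ∀ v ∈ lieAlg U, v f = 0) :
    f = algebraMap ℂ (coordRing U) (evalOne U f) := by
  refine Subtype.ext (funext fun u => ?_)
  have hpoly := oneParam_mem_polyFun hclosed hunip u f 1
  have hderiv : ∀ s, deriv (fun t => f.1 (1 * oneParam hclosed hunip u t)) s = 0 := by
    intro s
    have h1 : flowDeriv hclosed hunip u f.1 (oneParam hclosed hunip u s) = 0 :=
      congrFun (congrArg Subtype.val (hf _ (flowField_mem hclosed hunip u))) _
    simp only [flowDeriv, ← oneParam_add] at h1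
    have h2 := deriv_comp_const_add (fun t => f.1 (oneParam hclosed hunip u t)) s 0
    rw [add_zero] at h2
    simp only [one_mul]
    rw [← h2]
    exact h1
  have h3 := is_const_of_deriv_eq_zero (differentiable_of_mem_polyFun hpoly) hderiv 1 0
  rw [oneParam_one, oneParam_zero, one_mul, one_mul] at h3
  exact h3

theorem isUnipotentAction_derivationMap {𝔫 : Type*} [LieRing 𝔫] [LieAlgebra ℂ 𝔫]
    (hclosed : IsZariskiClosed U) (hunip : IsUnipotentGroup U) (e : 𝔫 ≃ₗ⁅ℂ⁆ lieAlg U) :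
    IsUnipotentAction (derivationMap e) (evalOne U) where
  locallyNilpotent x f := hunip.mem_nilpotentPart (e x).2 f
  invariants f hf := ⟨evalOne U f, eq_algebraMap_of_forall_lieAlg hclosed hunip fun v hv => by
    have := hf (e.symm ⟨v, hv⟩)
    rwa [derivationMap_apply, LieEquiv.apply_symm_apply] at this⟩
  eval_injective x hx := by
    have h0 : e x = 0 := Subtype.ext (Derivation.ext fun f => Subtype.ext (funext fun g => by
      rw [apply_eq_evalOne_translate (e x).2]
      exact hx (translate U g f)))
    exact e.injective (h0.trans (map_zero e).symm)

end UnipotentGroups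

end InvDMod

end

noncomputable section

namespace InvDMod

/-! ### Isomorphism, invariants and semisimple parts -/

section Classification

variable {𝔫 : Type*} [LieRing 𝔫] [LieAlgebra ℂ 𝔫] {n : ℕ}

theorem SemisimplePartsConjugate.symm {ρ₁ ρ₂ : Rep 𝔫 n} (h : SemisimplePartsConjugate ρ₁ ρ₂) :
    SemisimplePartsConjugate ρ₂ ρ₁ := by
  obtain ⟨g, hg⟩ := h
  refine ⟨g⁻¹, fun x => ?_⟩
  rw [hg, inv_inv, mul_assoc, mul_assoc, Units.inv_mul, mul_one, Units.inv_mul_cancel_left]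

theorem SemisimplePartsConjugate.trans {ρ₁ ρ₂ ρ₃ : Rep 𝔫 n} (h : SemisimplePartsConjugate ρ₁ ρ₂)
    (h' : SemisimplePartsConjugate ρ₂ ρ₃) : SemisimplePartsConjugate ρ₁ ρ₃ := by
  obtain ⟨g, hg⟩ := h
  obtain ⟨g', hg'⟩ := h'
  refine ⟨g * g', fun x => ?_⟩
  rw [hg, hg', mul_inv_rev, Units.val_mul, Units.val_mul]
  simp only [mul_assoc]

theorem semisimplePart_diagRep (χ : Fin n → 𝔫 →ₗ[ℂ] ℂ) (hχ : ∀ i, ∀ x y : 𝔫, χ i ⁅x, y⁆ = 0)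
    (x : 𝔫) : semisimplePart (diagRep χ hχ x) = diagRep χ hχ x :=
  semisimplePart_diagonal _

variable [FiniteDimensional ℂ 𝔫] [LieRing.IsNilpotent 𝔫] {N : ℕ} {G : Subgroup (GL (Fin N) ℂ)}
  {e : 𝔫 ≃ₗ⁅ℂ⁆ lieAlg G} {ε : coordRing G →ₐ[ℂ] ℂ}

/-- Up to gauge equivalence, up to invariants and up to conjugation of semisimple parts, every
representation can be replaced by a diagonal one. -/
theorem exists_diagRep_equivalent (hD : IsUnipotentAction (derivationMap e) ε) (ρ : Rep 𝔫 n) :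
    ∃ (χ : Fin n → 𝔫 →ₗ[ℂ] ℂ) (hχ : ∀ i, ∀ x y : 𝔫, χ i ⁅x, y⁆ = 0),
      quotientMap ρ = quotientMap (diagRep χ hχ) ∧ SemisimplePartsConjugate ρ (diagRep χ hχ) ∧
      ∀ M M' : InvariantDModule G n, CorrespondsTo e M ρ → CorrespondsTo e M' (diagRep χ hχ) →
        M'.Iso M := by
  obtain ⟨χ, hχ, P, T, hP, hT, hχT, H, hH⟩ := hD.exists_diagonal_gauge ρ
  refine ⟨χ, hχ, ?_, hD.semisimplePartsConjugate H hH,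
    fun M M' hM hM' => (iso_iff_exists_gauge hD hM' hM).2 ⟨H, hH⟩⟩
  rw [← quotientMap_eq_diagRep hT hχ hχT]
  exact (quotientMap_eq_of_conj P⁻¹ fun x => by rw [hP, inv_inv]).symm

theorem iso_of_conj (hD : IsUnipotentAction (derivationMap e) ε) {M₁ M₂ : InvariantDModule G n}
    {ρ₁ ρ₂ : Rep 𝔫 n} (h₁ : CorrespondsTo e M₁ ρ₁) (h₂ : CorrespondsTo e M₂ ρ₂) (g : GL (Fin n) ℂ)
    (hg : ∀ x, ρ₁ x = g.val * ρ₂ x * (g⁻¹).val) : M₁.Iso M₂ := by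
  refine (iso_iff_exists_gauge hD h₁ h₂).2
    ⟨Units.map (algebraMap ℂ (coordRing G)).mapMatrix.toMonoidHom g⁻¹, fun x => ?_⟩
  change ((g⁻¹).val.map (algebraMap ℂ (coordRing G))).map (derivationMap e x)
    + (ρ₂ x).map (algebraMap ℂ (coordRing G)) * (g⁻¹).val.map (algebraMap ℂ (coordRing G))
    = (g⁻¹).val.map (algebraMap ℂ (coordRing G)) * (ρ₁ x).map (algebraMap ℂ (coordRing G))
  rw [derivation_const, zero_add, ← Matrix.map_mul, ← Matrix.map_mul, hg, mul_assoc,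
    Units.inv_mul_cancel_left]

theorem InvariantDModule.Iso.semisimplePartsConjugate (hD : IsUnipotentAction (derivationMap e) ε)
    {M₁ M₂ : InvariantDModule G n} {ρ₁ ρ₂ : Rep 𝔫 n} (h₁ : CorrespondsTo e M₁ ρ₁)
    (h₂ : CorrespondsTo e M₂ ρ₂) (h : M₁.Iso M₂) : SemisimplePartsConjugate ρ₁ ρ₂ := by
  obtain ⟨H, hH⟩ := (iso_iff_exists_gauge hD h₁ h₂).1 h
  exact (hD.semisimplePartsConjugate H hH).symm

/-- A diagonal representation is its own semisimple part. After passing to diagonal representatives,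
conjugacy of semisimple parts is conjugacy of representations, which invariants cannot see. -/
theorem quotientMap_eq_of_semisimplePartsConjugate
    (hD : IsUnipotentAction (derivationMap e) ε) {ρ₁ ρ₂ : Rep 𝔫 n}
    (h : SemisimplePartsConjugate ρ₁ ρ₂) : quotientMap ρ₁ = quotientMap ρ₂ := by
  obtain ⟨χ₁, hχ₁, hq₁, hs₁, -⟩ := exists_diagRep_equivalent hD ρ₁
  obtain ⟨χ₂, hχ₂, hq₂, hs₂, -⟩ := exists_diagRep_equivalent hD ρ₂
  obtain ⟨g, hg⟩ := (hs₁.symm.trans h).trans hs₂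
  rw [hq₁, hq₂]
  exact quotientMap_eq_of_conj g fun x => by
    rw [← semisimplePart_diagRep χ₁ hχ₁, hg, semisimplePart_diagRep]

/-- Diagonal representatives with the same invariants differ by a permutation matrix, which is a
constant gauge transformation. -/
theorem iso_of_quotientMap_eq (hD : IsUnipotentAction (derivationMap e) ε)
    {M₁ M₂ : InvariantDModule G n} {ρ₁ ρ₂ : Rep 𝔫 n} (h₁ : CorrespondsTo e M₁ ρ₁)
    (h₂ : CorrespondsTo e M₂ ρ₂) (h : quotientMap ρ₁ = quotientMap ρ₂) : M₁.Iso M₂ := by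
  obtain ⟨χ₁, hχ₁, hq₁, -, hi₁⟩ := exists_diagRep_equivalent hD ρ₁
  obtain ⟨χ₂, hχ₂, hq₂, -, hi₂⟩ := exists_diagRep_equivalent hD ρ₂
  obtain ⟨g, hg⟩ := exists_conj_of_quotientMap_diagRep_eq hχ₁ hχ₂ (hq₁.symm.trans (h.trans hq₂))
  obtain ⟨M₁', h₁'⟩ := exists_correspondsTo hD (diagRep χ₁ hχ₁)
  obtain ⟨M₂', h₂'⟩ := exists_correspondsTo hD (diagRep χ₂ hχ₂)
  exact (isoSetoid G n).trans ((isoSetoid G n).symm (hi₁ M₁ M₁' h₁ h₁'))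
    ((isoSetoid G n).trans (iso_of_conj hD h₁' h₂' g hg) (hi₂ M₂ M₂' h₂ h₂'))

/-- The bijection between representations and invariant D-modules. -/
theorem exists_equiv_correspondsTo (hD : IsUnipotentAction (derivationMap e) ε) :
    ∃ Θ : Rep 𝔫 n ≃ InvariantDModule G n, ∀ ρ, CorrespondsTo e (Θ ρ) ρ := by
  choose M hM using fun ρ : Rep 𝔫 n => exists_correspondsTo hD ρ
  refine ⟨Equiv.ofBijective M ⟨fun ρ ρ' h => ?_, fun M' => ?_⟩, hM⟩
  · exact (hM ρ).rep_eq (h ▸ hM ρ')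
  · obtain ⟨ρ, hρ⟩ := exists_rep_correspondsTo e M'
    exact ⟨ρ, (hM ρ).eq hD hρ⟩

end Classification

/-- A surjection and a bijection whose targets carry the same equivalence induce a bijection. -/
theorem exists_quotient_equiv {X Y Q : Type*} [s : Setoid Y] (Θ : X ≃ Y) {π : X → Q}
    (hπ : Function.Surjective π) (h : ∀ x x', Θ x ≈ Θ x' ↔ π x = π x') :
    ∃ Φ : Q ≃ Quotient s, ∀ x, Φ (π x) = ⟦Θ x⟧ := by
  have hval : ∀ x, (⟦Θ (Function.surjInv hπ (π x))⟧ : Quotient s) = ⟦Θ x⟧ := fun x =>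
    Quotient.sound ((h _ _).2 (Function.surjInv_eq hπ (π x)))
  refine ⟨Equiv.ofBijective (fun p => ⟦Θ (Function.surjInv hπ p)⟧) ⟨fun p p' hp => ?_, fun q => ?_⟩,
    hval⟩
  · rw [← Function.surjInv_eq hπ p, ← Function.surjInv_eq hπ p']
    exact (h _ _).1 (Quotient.exact hp)
  · obtain ⟨y, rfl⟩ := Quotient.exists_rep q
    exact ⟨π (Θ.symm y), (hval _).trans (by rw [Equiv.apply_symm_apply])⟩

end InvDMod

end

theorem theorem1 (𝔫 : Type*) [LieRing 𝔫] [LieAlgebra ℂ 𝔫] [FiniteDimensional ℂ 𝔫]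
    [LieRing.IsNilpotent 𝔫] (N : ℕ) (U : Subgroup (GL (Fin N) ℂ))
    (hclosed : InvDMod.IsZariskiClosed U) (hunip : InvDMod.IsUnipotentGroup U)
    (e : 𝔫 ≃ₗ⁅ℂ⁆ InvDMod.lieAlg U) (n : ℕ) :
    ∃ (Θ : InvDMod.Rep 𝔫 n ≃ InvDMod.InvariantDModule U n)
      (Φ : InvDMod.CategoricalQuotient 𝔫 n ≃ InvDMod.IsoClasses U n),
      (∀ ρ : InvDMod.Rep 𝔫 n, InvDMod.CorrespondsTo e (Θ ρ) ρ) ∧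
      Function.Surjective (InvDMod.quotientMap (𝔫 := 𝔫) (n := n)) ∧
      (∀ ρ : InvDMod.Rep 𝔫 n, Φ (InvDMod.quotientMap ρ) = ⟦Θ ρ⟧) ∧
      (∀ p, Θ '' {ρ | InvDMod.quotientMap ρ = p} = {M | ⟦M⟧ = Φ p}) ∧
      (∀ ρ₁ ρ₂ : InvDMod.Rep 𝔫 n, (Θ ρ₁).Iso (Θ ρ₂) ↔ InvDMod.quotientMap ρ₁ = InvDMod.quotientMap ρ₂) ∧
      (∀ ρ₁ ρ₂ : InvDMod.Rep 𝔫 n, InvDMod.quotientMap ρ₁ = InvDMod.quotientMap ρ₂ ↔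
        InvDMod.SemisimplePartsConjugate ρ₁ ρ₂) := by
  have hD := InvDMod.isUnipotentAction_derivationMap hclosed hunip e
  obtain ⟨Θ, hΘ⟩ := InvDMod.exists_equiv_correspondsTo (n := n) hD
  -- The three relations are compared in a cycle: isomorphic modules, conjugate semisimple parts,
  -- equal invariants, isomorphic modules.
  have hiso : ∀ ρ₁ ρ₂ : InvDMod.Rep 𝔫 n,
      (Θ ρ₁).Iso (Θ ρ₂) → InvDMod.SemisimplePartsConjugate ρ₁ ρ₂ := fun ρ₁ ρ₂ h =>
    h.semisimplePartsConjugate hD (hΘ ρ₁) (hΘ ρ₂)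
  have hquot : ∀ ρ₁ ρ₂ : InvDMod.Rep 𝔫 n, InvDMod.quotientMap ρ₁ = InvDMod.quotientMap ρ₂ →
      (Θ ρ₁).Iso (Θ ρ₂) := fun ρ₁ ρ₂ => InvDMod.iso_of_quotientMap_eq hD (hΘ ρ₁) (hΘ ρ₂)
  have hss : ∀ ρ₁ ρ₂ : InvDMod.Rep 𝔫 n, InvDMod.SemisimplePartsConjugate ρ₁ ρ₂ →
      InvDMod.quotientMap ρ₁ = InvDMod.quotientMap ρ₂ := fun ρ₁ ρ₂ =>
    InvDMod.quotientMap_eq_of_semisimplePartsConjugate hD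
  have hiff : ∀ ρ₁ ρ₂ : InvDMod.Rep 𝔫 n,
      (Θ ρ₁).Iso (Θ ρ₂) ↔ InvDMod.quotientMap ρ₁ = InvDMod.quotientMap ρ₂ := fun ρ₁ ρ₂ =>
    ⟨fun h => hss _ _ (hiso _ _ h), hquot _ _⟩
  obtain ⟨Φ, hΦ⟩ := InvDMod.exists_quotient_equiv Θ InvDMod.quotientMap_surjective hiff
  refine ⟨Θ, Φ, hΘ, InvDMod.quotientMap_surjective, hΦ, fun p => ?_, hiff,
    fun ρ₁ ρ₂ => ⟨fun h => hiso _ _ (hquot _ _ h), hss _ _⟩⟩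
  ext M
  obtain ⟨ρ, rfl⟩ := Θ.surjective M
  rw [Set.mem_image_equiv, Set.mem_ofPred_eq, Set.mem_ofPred_eq, Equiv.symm_apply_apply, ← hΦ,
    Φ.apply_eq_iff_eq]
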